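/- Theorem 5 (Passivity–Analyticity compatibility). Let $\mathcal H_s$ be a finite-dimensional complex Hilbert space, let $\mathcal B_{\mathrm{HS}}(\mathcal H_s)$ be the space of operators on $\mathcal H_s$ with the Hilbert–Schmidt inner product $\langle\!\langle A,B\rangle\!\rangle=\mathrm{Tr}[A^\dagger B]$, and let $\mathcal B=\mathcal B(\mathcal B_{\mathrm{HS}}(\mathcal H_s))$ be the bounded superoperators with the operator norm. Let $\mathbb H_+=\{z\in\mathbb C:\operatorname{Im}z>0\}$ and let $\tilde{\mathcal K}:\mathbb H_+\to\mathcal B$. Assume: (a) (Hardy spectral hypothesis) there are $p_0\in(1,\infty]$ and $w\in L^1(\mathbb R;\mathcal B)\cap L^{p_0}(\mathbb R;\mathcal B)$ with $$\tilde{\mathcal K}(z)=\int_{\mathbb R}\frac{w(\lambda)}{z-\lambda}\,d\lambda\qquad(z\in\mathbb H_+);$$ (b) $w(\lambda)\ge 0$ as an operator on $\mathcal B_{\mathrm{HS}}(\mathcal H_s)$ for almost every $\lambda\in\mathbb R$; (c) (operator dissipation) $\operatorname{Im}\langle\!\langle\xi,\tilde{\mathcal K}(z)\xi\rangle\!\rangle\le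 0$ for all $z\in\mathbb H_+$ and all $\xi\in\mathcal B_{\mathrm{HS}}(\mathcal H_s)$. Then the following hold. (i) For every finite $p$ with $1<p\le p_0$, $\tilde{\mathcal K}$ belongs to the Hardy space $H^p(\mathcal B)$: it is analytic in $\mathbb H_+$ and $\sup_{y>0}\int_{\mathbb R}\|\tilde{\mathcal K}(x+iy)\|_{\mathrm{op}}^p\,dx<\infty$. (ii) For every such $p$, $\tilde{\mathcal K}$ obeys the Kramers–Kronig relation in the $L^p$ boundary-value and principal-value sense. That is, $\tilde{\mathcal K}$ has a boundary value $\tilde{\mathcal K}(\omega)$, $\omega\in\mathbb R$, which lies in $L^p(\mathbb R;\mathcal B)$, is the non-tangential limit of $\tilde{\mathcal K}$ at almost every $\omega$, and is the $L^p$ limit of $\tilde{\mathcal K}(\cdot+iy)$ as $y\downarrow0$; and $$\tilde{\mathcal K}'(\omega)=\frac1\pi\,\mathcal P\!\int_{-\infty}^{\infty}\frac{\tilde{\mathcal K}''(\omega')}{\omega'-\omega}\,d\omega',$$ where the integrals over $|\omega'-\omega|>\varepsilon$ converge absolutely and tend, times $1/\pi$, to the left-hand side as $\varepsilon\downarrow0$,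 both for almost every $\omega$ and in $L^p$. Here $\tilde{\mathcal K}'=(\tilde{\mathcal K}+\tilde{\mathcal K}^\dagger)/2$ and $\tilde{\mathcal K}''=(\tilde{\mathcal K}-\tilde{\mathcal K}^\dagger)/(2i)$; the same relation holds between the real and imaginary parts of every matrix element $\langle\!\langle\xi,\tilde{\mathcal K}(\omega)\eta\rangle\!\rangle$. (iii) $-\tilde{\mathcal K}$ is an operator-valued Herglotz–Nevanlinna function, i.e. it is analytic in $\mathbb H_+$ with $\operatorname{Im}(-\tilde{\mathcal K}(z))\ge0$ as an operator for every $z\in\mathbb H_+$; equivalently, $\tilde{\mathcal K}$ is anti-Herglotz. Since $\tilde{\mathcal K}$ is an arbitrary function satisfying (a)–(c), this applies in particular to the memory kernel of any passive bosonic bath at thermal equilibrium whose kernel satisfies (a)–(c). -/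

import Mathlib

open MeasureTheory Filter Topology
open scoped ENNReal ComplexStarModule

noncomputable section

/-- The Hilbert–Schmidt (Liouville) space of a finite-dimensional complex Hilbert space `H`:
the linear operators on `H`, with inner product `⟪A, B⟫ = Tr (A† B)`. -/
def HilbertSchmidt (H : Type*) [NormedAddCommGroup H] [InnerProductSpace ℂ H] : Type _ :=
  H →ₗ[ℂ] H

namespace HilbertSchmidt

variable (H : Type*) [NormedAddCommGroup H] [InnerProductSpace ℂ H]

instance instAddCommGroup : AddCommGroup (HilbertSchmidt H) :=
  inferInstanceAs (AddCommGroup (H →ₗ[ℂ] H))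

instance instModule : Module ℂ (HilbertSchmidt H) :=
  inferInstanceAs (Module ℂ (H →ₗ[ℂ] H))

variable [FiniteDimensional ℂ H]

instance instFiniteDimensional : FiniteDimensional ℂ (HilbertSchmidt H) :=
  inferInstanceAs (FiniteDimensional ℂ (H →ₗ[ℂ] H))

/-- The operator on `H` underlying an element of the Hilbert–Schmidt space. -/
def toLin : HilbertSchmidt H ≃ₗ[ℂ] (H →ₗ[ℂ] H) :=
  LinearEquiv.refl ℂ (H →ₗ[ℂ] H)

/-- The Hilbert–Schmidt pairing `Tr (A† B)`. -/
def pairing (A B : HilbertSchmidt H) : ℂ :=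
  LinearMap.trace ℂ H (LinearMap.adjoint (toLin H A) * toLin H B)

lemma pairing_eq_sum (A B : HilbertSchmidt H) :
    pairing H A B = ∑ i, inner ℂ (toLin H A (stdOrthonormalBasis ℂ H i))
      (toLin H B (stdOrthonormalBasis ℂ H i)) := by
  rw [pairing, LinearMap.trace_eq_sum_inner _ (stdOrthonormalBasis ℂ H)]
  simp [LinearMap.adjoint_inner_right]

/-- The Hilbert–Schmidt pairing is an inner product. -/
abbrev innerCore : InnerProductSpace.Core ℂ (HilbertSchmidt H) where
  inner A B := pairing H A B
  conj_inner_symm A B := by simp [pairing_eq_sum]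
  re_inner_nonneg A := by
    rw [pairing_eq_sum, map_sum]
    exact Finset.sum_nonneg fun i _ => inner_self_nonneg
  add_left A B C := by simp [pairing_eq_sum, Finset.sum_add_distrib]
  smul_left A B r := by simp [pairing_eq_sum, Finset.mul_sum, mul_comm]
  definite A h := by
    have h' : ∑ i, ‖toLin H A (stdOrthonormalBasis ℂ H i)‖ ^ 2 = 0 := by
      have := congrArg Complex.re h
      simpa [pairing_eq_sum, inner_self_eq_norm_sq_to_K, ← Complex.ofReal_pow] using this
    rw [Finset.sum_eq_zero_iff_of_nonneg (fun i _ => by positivity)] at h'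
    refine (toLin H).map_eq_zero_iff.1 ((stdOrthonormalBasis ℂ H).toBasis.ext fun i => ?_)
    simpa using h' i (Finset.mem_univ i)

instance instNormedAddCommGroup : NormedAddCommGroup (HilbertSchmidt H) :=
  (innerCore H).toNormedAddCommGroup

instance instInnerProductSpace : InnerProductSpace ℂ (HilbertSchmidt H) :=
  InnerProductSpace.ofCore (innerCore H).toCore

instance instCompleteSpace : CompleteSpace (HilbertSchmidt H) :=
  FiniteDimensional.complete ℂ (HilbertSchmidt H)

lemma inner_def (A B : HilbertSchmidt H) :
    inner ℂ A B = LinearMap.trace ℂ H (LinearMap.adjoint (toLin H A) * toLin H B) :=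
  rfl

end HilbertSchmidt

/-- The Banach algebra `𝓑` of superoperators on the system Liouville space, with the operator
norm. -/
abbrev SuperOp (H : Type*) [NormedAddCommGroup H] [InnerProductSpace ℂ H]
    [FiniteDimensional ℂ H] : Type _ :=
  HilbertSchmidt H →L[ℂ] HilbertSchmidt H

/-- The open upper half-plane `ℍ₊` as a subset of `ℂ`. -/
def upperPlane : Set ℂ := {z | 0 < z.im}

/-- The vector-valued Hardy space `H^p` of the upper half-plane: `F` is analytic on `ℍ₊` and
`sup_{y > 0} ‖F(· + iy)‖_{L^p(ℝ)} < ∞`. -/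
structure MemHardy {V : Type*} [NormedAddCommGroup V] [NormedSpace ℂ V]
    (F : ℂ → V) (p : ℝ≥0∞) : Prop where
  analytic : DifferentiableOn ℂ F upperPlane
  bounded : ⨆ (y : ℝ) (_ : 0 < y),
    eLpNorm (fun x : ℝ => F (x + y * Complex.I)) p volume < ∞

/-- The non-tangential approach region (Stolz cone) in `ℍ₊` with vertex `x ∈ ℝ` and
aperture `a`. -/
def stolzCone (a x : ℝ) : Set ℂ := {z | 0 < z.im ∧ |z.re - x| < a * z.im}

/-- `Fb : ℝ → V` is the `L^p` boundary value of `F` on the real axis: it is in `L^p(ℝ; V)`, it is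
the non-tangential limit of `F` almost everywhere, and it is the `L^p` limit of `F(· + iy)` as
`y ↓ 0`. -/
structure IsBoundaryValue {V : Type*} [NormedAddCommGroup V]
    (F : ℂ → V) (Fb : ℝ → V) (p : ℝ≥0∞) : Prop where
  memLp : MemLp Fb p volume
  nontangential : ∀ᵐ x : ℝ, ∀ a : ℝ, 0 < a → Tendsto F (𝓝[stolzCone a x] (x : ℂ)) (𝓝 (Fb x))
  tendsto_Lp : Tendsto
    (fun y : ℝ => eLpNorm (fun x : ℝ => F (x + y * Complex.I) - Fb x) p volume) (𝓝[>] 0) (𝓝 0)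

/-- The truncated dispersion integral `(1/π) ∫_{|ω' - ω| > ε} v(ω') / (ω' - ω) dω'`. -/
def truncatedDispersion {V : Type*} [NormedAddCommGroup V] [NormedSpace ℝ V]
    (v : ℝ → V) (ε ω : ℝ) : V :=
  Real.pi⁻¹ • ∫ ω' in {ω' : ℝ | ε < |ω' - ω|}, (ω' - ω)⁻¹ • v ω'

/-- `u(ω) = (1/π) P∫ v(ω') / (ω' - ω) dω'`, as a principal value: the truncated integrals converge
absolutely, and tend to `u`, as the truncation is removed, both almost everywhere and in `L^p`. -/
structure IsDispersionPair {V : Type*} [NormedAddCommGroup V] [NormedSpace ℝ V]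
    (u v : ℝ → V) (p : ℝ≥0∞) : Prop where
  integrable : ∀ ω ε : ℝ, 0 < ε →
    IntegrableOn (fun ω' : ℝ => (ω' - ω)⁻¹ • v ω') {ω' : ℝ | ε < |ω' - ω|} volume
  tendsto_ae : ∀ᵐ ω : ℝ, Tendsto (fun ε : ℝ => truncatedDispersion v ε ω) (𝓝[>] 0) (𝓝 (u ω))
  tendsto_Lp : Tendsto
    (fun ε : ℝ => eLpNorm (fun ω : ℝ => truncatedDispersion v ε ω - u ω) p volume)
    (𝓝[>] 0) (𝓝 0)

/-- The Kramers–Kronig relation in `L^p` for an operator-valued function `F` on `ℍ₊`: `F` has an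
`L^p` boundary value whose real (reactive) part is the dispersion integral of its imaginary
(dissipative) part. This holds for the operator real and imaginary parts `(A + A†)/2` and
`(A - A†)/(2i)`, and for the real and imaginary parts of every matrix element `⟪ξ, F η⟫`. -/
def ObeysKramersKronig {E : Type*} [NormedAddCommGroup E] [InnerProductSpace ℂ E] [CompleteSpace E]
    (F : ℂ → E →L[ℂ] E) (p : ℝ≥0∞) : Prop :=
  ∃ Fb : ℝ → E →L[ℂ] E, IsBoundaryValue F Fb p ∧
    IsDispersionPair (fun ω => (ℜ (Fb ω) : E →L[ℂ] E)) (fun ω => (ℑ (Fb ω) : E →L[ℂ] E)) p ∧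
    ∀ ξ η : E, IsDispersionPair
      (fun ω => (inner ℂ ξ (Fb ω η)).re) (fun ω => (inner ℂ ξ (Fb ω η)).im) p

/-- Operator-valued Herglotz–Nevanlinna functions: analytic on `ℍ₊` with `Im F(z) ≥ 0` there. -/
structure IsHerglotz {E : Type*} [NormedAddCommGroup E] [InnerProductSpace ℂ E] [CompleteSpace E]
    (F : ℂ → E →L[ℂ] E) : Prop where
  analytic : DifferentiableOn ℂ F upperPlane
  im_nonneg : ∀ z ∈ upperPlane, (ℑ (F z) : E →L[ℂ] E).IsPositive

/-- Operator-valued anti-Herglotz functions: analytic on `ℍ₊` with `Im F(z) ≤ 0` there. -/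
structure IsAntiHerglotz {E : Type*} [NormedAddCommGroup E] [InnerProductSpace ℂ E]
    [CompleteSpace E] (F : ℂ → E →L[ℂ] E) : Prop where
  analytic : DifferentiableOn ℂ F upperPlane
  im_nonpos : ∀ z ∈ upperPlane, (-(ℑ (F z) : E →L[ℂ] E)).IsPositive

/-- The spectral hypothesis of Hardy placement: on `ℍ₊`, `K` is the Cauchy transform of an
operator-valued density `w` (no singular part), and `w ∈ L^1 ∩ L^{p₀}` with `p₀ > 1`. -/
structure IsHardySpectralDensity {V : Type*} [NormedAddCommGroup V] [NormedSpace ℂ V]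
    (K : ℂ → V) (w : ℝ → V) (p₀ : ℝ≥0∞) : Prop where
  one_lt : 1 < p₀
  memLp_one : MemLp w 1 volume
  memLp : MemLp w p₀ volume
  cauchy : ∀ z ∈ upperPlane, K z = ∫ lam : ℝ, (z - (lam : ℂ))⁻¹ • w lam

/-- The operator dissipation (passivity) condition: `Im ⟪ξ, K(z) ξ⟫ ≤ 0` for every vector `ξ` and
every `z ∈ ℍ₊`. -/
def IsDissipative {E : Type*} [NormedAddCommGroup E] [InnerProductSpace ℂ E]
    (K : ℂ → E →L[ℂ] E) : Prop :=
  ∀ z ∈ upperPlane, ∀ ξ : E, (inner ℂ ξ (K z ξ)).im ≤ 0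

end

/-!
The superoperator kernel is a Cauchy transform, so every assertion reduces to one about the scalar
function `F z = ∫ g(λ) / (z - λ) dλ` with `g ∈ L¹ ∩ L^p`, `1 < p < ∞`: an operator on a
finite-dimensional space is a fixed linear combination of finitely many diagonal matrix elements
`⟪ζ, A ζ⟫` (`exists_diagonal_expansion`), and the matrix elements of the kernel are Cauchy transforms
of the matrix elements of the spectral density.

*Hardy bound.* The inequality `‖F(· + iy)‖_p ≤ C ‖g‖_p`, uniform in `y > 0`, is M. Riesz's theorem
(`exists_cauchyTransformBounded`). For `g ≥ 0` and `1 < p ≤ 2` the function `U = i F` takes values in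
the right half-plane, where `|U|^p ≤ A (Re U)^p - B Re (U^p)`. By Cauchy's theorem `U^p` has vanishing
integral over horizontal lines, and `Re U` is `π` times the Poisson integral of `g`. Splitting `g`
into positive parts gives all `p ≤ 2`, and duality gives `p > 2`; the duality argument is legitimate
because each `F(· + iy)` is known beforehand to lie in every `L^q`, `q > 1`.

*Boundary values.* Since `F(· + i(y + η))` is the Cauchy transform at height `y` of the Poisson
integral `P_η g`, the Hardy bound applied to `g - P_η g` shows that `F(· + iy)` converges in `L^p` to
some `f` as `y ↓ 0`. Residue calculus (`integral_inv_mul_cauchyTransform_of_pos` and its companion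
in the lower half-plane) passes to the limit: `∫ f(t) / (t - z) dt` is `2πi F(z)` above the real axis
and `0` below it. Hence `F` is the Poisson integral of `f`, which converges non-tangentially at every
Lebesgue point (`IsCauchyBoundary.isBoundaryValue`).

*Kramers–Kronig.* Taking conjugates in the lower half-plane, `π F(z) = ∫ Im f(t) / (t - z) dt`, so
`Re F(ω + iε)` is the conjugate Poisson integral of `Im f`. It differs from the dispersion integral
truncated at `ε` by convolution with an odd kernel dominated by the Poisson kernel, and this
difference vanishes both almost everywhere and in `L^p` as `ε ↓ 0`
(`IsCauchyBoundary.isDispersionPair`). The operator relation for `(A + A†)/2` and `(A - A†)/(2i)`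
follows because their diagonal matrix elements are the real and imaginary parts of those of `A`.

The Herglotz property is the dissipation condition, read through
`⟪ξ, Im(A) ξ⟫ = Im ⟪ξ, A ξ⟫`, together with analyticity of the Cauchy transform.
-/

/-! ### The Cauchy kernel -/

lemma one_lt_toReal {p : ℝ≥0∞} (hp : 1 < p) (hp' : p ≠ ∞) : 1 < p.toReal := by
  simpa using (ENNReal.toReal_lt_toReal ENNReal.one_ne_top hp').2 hp

lemma sub_ofReal_ne_zero {z : ℂ} (hz : z.im ≠ 0) (t : ℝ) : z - (t : ℂ) ≠ 0 := fun h =>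
  hz (by simpa using congrArg Complex.im h)

lemma ofReal_sub_ne_zero {z : ℂ} (hz : z.im ≠ 0) (t : ℝ) : (t : ℂ) - z ≠ 0 := fun h =>
  sub_ofReal_ne_zero hz t (by linear_combination -h)

lemma norm_inv_sub_ofReal_le {z : ℂ} (hz : z.im ≠ 0) (t : ℝ) :
    ‖(z - (t : ℂ))⁻¹‖ ≤ |z.im|⁻¹ := by
  rw [norm_inv]
  exact inv_anti₀ (abs_pos.2 hz) (by simpa using Complex.abs_im_le_norm (z - (t : ℂ)))

lemma continuous_inv_sub_ofReal {z : ℂ} (hz : z.im ≠ 0) :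
    Continuous fun t : ℝ => (z - (t : ℂ))⁻¹ :=
  Continuous.inv₀ (by fun_prop) (sub_ofReal_ne_zero hz)

lemma continuous_inv_ofReal_sub {z : ℂ} (hz : z.im ≠ 0) :
    Continuous fun t : ℝ => ((t : ℂ) - z)⁻¹ :=
  Continuous.inv₀ (by fun_prop) (ofReal_sub_ne_zero hz)

lemma integrable_inv_sub_smul {V : Type*} [NormedAddCommGroup V] [NormedSpace ℂ V]
    {g : ℝ → V} (hg : Integrable g) {z : ℂ} (hz : z.im ≠ 0) :
    Integrable fun t : ℝ => (z - (t : ℂ))⁻¹ • g t :=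
  hg.bdd_smul _ (continuous_inv_sub_ofReal hz).aestronglyMeasurable
    (Eventually.of_forall (norm_inv_sub_ofReal_le hz))

/-- The Cauchy kernel decays like `(1 + t²)^{-1/2}`. -/
lemma exists_norm_inv_sub_ofReal_le {z : ℂ} (hz : z.im ≠ 0) :
    ∃ C : ℝ, 0 ≤ C ∧ ∀ t : ℝ, ‖(z - (t : ℂ))⁻¹‖ ≤ C * (1 + ‖t‖ ^ 2) ^ (-(1 : ℝ) / 2) := by
  have hy : 0 < z.im ^ 2 := by positivity
  set c : ℝ := 2 + (2 * z.re ^ 2 + 1) / z.im ^ 2 with hc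
  have hc0 : 0 < c := by positivity
  refine ⟨√c, Real.sqrt_nonneg _, fun t => ?_⟩
  have hpos : 0 < 1 + ‖t‖ ^ 2 := by positivity
  have hn : 0 < ‖z - (t : ℂ)‖ := norm_pos_iff.2 (sub_ofReal_ne_zero hz t)
  rw [show (-(1 : ℝ) / 2) = -(1 / 2) by ring, Real.rpow_neg hpos.le, ← Real.sqrt_eq_rpow, norm_inv,
    ← div_eq_mul_inv, inv_eq_one_div, div_le_div_iff₀ hn (Real.sqrt_pos.2 hpos), one_mul,
    Real.sqrt_le_left (by positivity), mul_pow, Real.sq_sqrt hc0.le, Complex.sq_norm,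
    Complex.normSq_apply, Real.norm_eq_abs, sq_abs]
  simp only [Complex.sub_re, Complex.ofReal_re, Complex.sub_im, Complex.ofReal_im, sub_zero]
  have h1 : c * z.im ^ 2 = 2 * z.im ^ 2 + (2 * z.re ^ 2 + 1) := by
    rw [hc]; field_simp
  have h2 : 0 ≤ (2 * z.re ^ 2 + 1) / z.im ^ 2 * (z.re - t) ^ 2 := by positivity
  nlinarith [sq_nonneg (2 * z.re - t)]

/-- The Cauchy kernel lies in every `L^p` with `p > 1`. -/
lemma memLp_inv_sub_ofReal {z : ℂ} (hz : z.im ≠ 0) {p : ℝ≥0∞} (hp : 1 < p) :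
    MemLp (fun t : ℝ => (z - (t : ℂ))⁻¹) p := by
  have hm := (continuous_inv_sub_ofReal hz).aestronglyMeasurable (μ := volume)
  rcases eq_or_ne p ∞ with rfl | hp'
  · exact memLp_top_of_bound hm _ (Eventually.of_forall (norm_inv_sub_ofReal_le hz))
  obtain ⟨C, hC, hb⟩ := exists_norm_inv_sub_ofReal_le hz
  have hr : 1 < p.toReal := one_lt_toReal hp hp'
  have key : MemLp (fun t : ℝ => (1 + ‖t‖ ^ 2) ^ (-(1 : ℝ) / 2)) p := by
    rw [← integrable_norm_rpow_iff (by
      refine Continuous.aestronglyMeasurable (Continuous.rpow_const (by fun_prop) fun t => ?_)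
      left; positivity) (by positivity) hp']
    have := integrable_rpow_neg_one_add_norm_sq (E := ℝ) (μ := volume) (r := p.toReal)
      (by simpa using hr)
    refine this.congr (Eventually.of_forall fun t => ?_)
    have hpos : 0 ≤ 1 + ‖t‖ ^ 2 := by positivity
    simp only
    rw [Real.norm_of_nonneg (Real.rpow_nonneg hpos _), ← Real.rpow_mul hpos]
    congr 1; ring
  refine (key.const_mul C).mono hm (Eventually.of_forall fun t => (hb t).trans (le_abs_self _))

lemma memLp_inv_ofReal_sub {z : ℂ} (hz : z.im ≠ 0) {p : ℝ≥0∞} (hp : 1 < p) :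
    MemLp (fun t : ℝ => ((t : ℂ) - z)⁻¹) p := by
  refine (memLp_inv_sub_ofReal hz hp).neg.congr_norm
    (continuous_inv_ofReal_sub hz).aestronglyMeasurable (Eventually.of_forall fun t => ?_)
  simp [norm_sub_rev]

lemma integrable_inv_mul_inv {a b : ℂ} (ha : a.im ≠ 0) (hb : b.im ≠ 0) :
    Integrable fun t : ℝ => ((t : ℂ) - a)⁻¹ * ((t : ℂ) - b)⁻¹ :=
  (memLp_inv_ofReal_sub ha (p := 2) (by norm_num)).integrable_mul
    (memLp_inv_ofReal_sub hb (p := 2) (by norm_num))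

/-- A primitive of `t ↦ (t - a)⁻¹` on the real line, normalised to be symmetric at `±∞`. -/
noncomputable def cauchyPrimitive (a : ℂ) (t : ℝ) : ℂ :=
  ((Real.log ((t - a.re) ^ 2 + a.im ^ 2) / 2 : ℝ) : ℂ)
    + ((Real.arctan ((t - a.re) / a.im) : ℝ) : ℂ) * Complex.I

lemma hasDerivAt_cauchyPrimitive {a : ℂ} (ha : a.im ≠ 0) (t : ℝ) :
    HasDerivAt (cauchyPrimitive a) ((t : ℂ) - a)⁻¹ t := by
  have hpos : (t - a.re) ^ 2 + a.im ^ 2 ≠ 0 := by positivity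
  have hid : HasDerivAt (fun t : ℝ => t - a.re) 1 t := (hasDerivAt_id t).sub_const _
  have h1 : HasDerivAt (fun t : ℝ => Real.log ((t - a.re) ^ 2 + a.im ^ 2) / 2)
      ((t - a.re) / ((t - a.re) ^ 2 + a.im ^ 2)) t := by
    refine ((((hid.pow 2).add_const (a.im ^ 2)).log hpos).div_const 2).congr_deriv ?_
    simp only [Pi.pow_apply]
    field_simp
    push_cast
    ring
  have h2 : HasDerivAt (fun t : ℝ => Real.arctan ((t - a.re) / a.im))
      (a.im / ((t - a.re) ^ 2 + a.im ^ 2)) t := by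
    refine (hid.div_const a.im).arctan.congr_deriv ?_
    rw [show 1 + ((t - a.re) / a.im) ^ 2 = ((t - a.re) ^ 2 + a.im ^ 2) / a.im ^ 2 by
      field_simp; ring]
    field_simp
  refine (h1.ofReal_comp.add (h2.ofReal_comp.mul_const Complex.I)).congr_deriv ?_
  have e3 : Complex.normSq ((t : ℂ) - a) = (t - a.re) ^ 2 + a.im ^ 2 := by
    simp [Complex.normSq_apply]; ring
  apply Complex.ext
  · rw [Complex.inv_re, e3, Complex.add_re, Complex.ofReal_re, Complex.re_ofReal_mul]; simp
  · rw [Complex.inv_im, e3, Complex.add_im, Complex.ofReal_im, Complex.im_ofReal_mul]; simp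

lemma tendsto_log_quadratic_sub (α β : ℝ) (hβ : β ≠ 0) {l : Filter ℝ}
    (hl : Tendsto (fun t : ℝ => t⁻¹) l (𝓝 0)) (hl0 : ∀ᶠ t in l, t ≠ 0) :
    Tendsto (fun t : ℝ => Real.log ((t - α) ^ 2 + β ^ 2) - Real.log (t ^ 2)) l (𝓝 0) := by
  have h1 : Tendsto (fun t : ℝ => (1 - α * t⁻¹) ^ 2 + (β * t⁻¹) ^ 2) l (𝓝 1) := by
    have := ((tendsto_const_nhds (x := (1 : ℝ))).sub (hl.const_mul α)).pow 2 |>.add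
      ((hl.const_mul β).pow 2)
    simpa using this
  have h2 := (Real.continuousAt_log one_ne_zero).tendsto.comp h1
  rw [Real.log_one] at h2
  refine h2.congr' ?_
  filter_upwards [hl0] with t ht
  have : 0 < (t - α) ^ 2 + β ^ 2 := by positivity
  rw [Function.comp_apply, ← Real.log_div this.ne' (by positivity)]
  congr 1
  field_simp

lemma tendsto_cauchyPrimitive_sub {a b : ℂ} (ha : a.im ≠ 0) (hb : b.im ≠ 0) {l : Filter ℝ}
    (hl : Tendsto (fun t : ℝ => t⁻¹) l (𝓝 0)) (hl0 : ∀ᶠ t in l, t ≠ 0) {θ φ : ℝ}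
    (hθ : Tendsto (fun t : ℝ => Real.arctan ((t - a.re) / a.im)) l (𝓝 θ))
    (hφ : Tendsto (fun t : ℝ => Real.arctan ((t - b.re) / b.im)) l (𝓝 φ)) :
    Tendsto (fun t => cauchyPrimitive a t - cauchyPrimitive b t) l
      (𝓝 (((θ - φ : ℝ) : ℂ) * Complex.I)) := by
  have h1 := ((tendsto_log_quadratic_sub a.re a.im ha hl hl0).sub
    (tendsto_log_quadratic_sub b.re b.im hb hl hl0)).div_const 2
  have h1' := (Complex.continuous_ofReal.tendsto _).comp h1
  have h2 := ((Complex.continuous_ofReal.tendsto _).comp (hθ.sub hφ)).mul_const Complex.I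
  have h3 := h1'.add h2
  have e : (((0 - 0) / 2 : ℝ) : ℂ) + ((θ - φ : ℝ) : ℂ) * Complex.I
      = ((θ - φ : ℝ) : ℂ) * Complex.I := by simp
  rw [e] at h3
  refine h3.congr fun t => ?_
  simp only [Function.comp_apply, cauchyPrimitive]
  push_cast
  ring

lemma tendsto_arctan_affine_atTop_of_pos (x : ℝ) {y : ℝ} (hy : 0 < y) :
    Tendsto (fun t : ℝ => Real.arctan ((t - x) / y)) atTop (𝓝 (Real.pi / 2)) :=
  (tendsto_nhds_of_tendsto_nhdsWithin Real.tendsto_arctan_atTop).comp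
    ((tendsto_atTop_add_const_right _ (-x) tendsto_id).atTop_div_const hy)

lemma tendsto_arctan_affine_atBot_of_pos (x : ℝ) {y : ℝ} (hy : 0 < y) :
    Tendsto (fun t : ℝ => Real.arctan ((t - x) / y)) atBot (𝓝 (-(Real.pi / 2))) :=
  (tendsto_nhds_of_tendsto_nhdsWithin Real.tendsto_arctan_atBot).comp
    ((tendsto_atBot_add_const_right _ (-x) tendsto_id).atBot_div_const hy)

lemma tendsto_arctan_affine_atTop_of_neg (x : ℝ) {y : ℝ} (hy : y < 0) :
    Tendsto (fun t : ℝ => Real.arctan ((t - x) / y)) atTop (𝓝 (-(Real.pi / 2))) := by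
  refine (tendsto_arctan_affine_atTop_of_pos x (neg_pos.2 hy)).neg.congr fun t => ?_
  rw [← Real.arctan_neg, div_neg, neg_neg]

lemma tendsto_arctan_affine_atBot_of_neg (x : ℝ) {y : ℝ} (hy : y < 0) :
    Tendsto (fun t : ℝ => Real.arctan ((t - x) / y)) atBot (𝓝 (Real.pi / 2)) := by
  have := (tendsto_arctan_affine_atBot_of_pos x (neg_pos.2 hy)).neg
  rw [neg_neg] at this
  refine this.congr fun t => ?_
  rw [← Real.arctan_neg, div_neg, neg_neg]

lemma integral_inv_mul_inv_of_tendsto {a b : ℂ} (ha : a.im ≠ 0) (hb : b.im ≠ 0) (hab : a ≠ b)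
    {θ φ θ' φ' : ℝ}
    (h1 : Tendsto (fun t : ℝ => Real.arctan ((t - a.re) / a.im)) atTop (𝓝 θ))
    (h2 : Tendsto (fun t : ℝ => Real.arctan ((t - b.re) / b.im)) atTop (𝓝 φ))
    (h3 : Tendsto (fun t : ℝ => Real.arctan ((t - a.re) / a.im)) atBot (𝓝 θ'))
    (h4 : Tendsto (fun t : ℝ => Real.arctan ((t - b.re) / b.im)) atBot (𝓝 φ')) :
    ∫ t : ℝ, ((t : ℂ) - a)⁻¹ * ((t : ℂ) - b)⁻¹
      = (a - b)⁻¹ * (((θ - φ - (θ' - φ') : ℝ) : ℂ) * Complex.I) := by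
  have hab' : a - b ≠ 0 := sub_ne_zero.2 hab
  have hd : ∀ t : ℝ, HasDerivAt
      (fun t => (a - b)⁻¹ * (cauchyPrimitive a t - cauchyPrimitive b t))
      (((t : ℂ) - a)⁻¹ * ((t : ℂ) - b)⁻¹) t := fun t => by
    refine (((hasDerivAt_cauchyPrimitive ha t).sub
      (hasDerivAt_cauchyPrimitive hb t)).const_mul _).congr_deriv ?_
    have := ofReal_sub_ne_zero ha t
    have := ofReal_sub_ne_zero hb t
    field_simp
    ring
  rw [integral_of_hasDerivAt_of_tendsto hd (integrable_inv_mul_inv ha hb)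
    ((tendsto_cauchyPrimitive_sub ha hb tendsto_inv_atBot_zero
      (eventually_ne_atBot 0) h3 h4).const_mul _)
    ((tendsto_cauchyPrimitive_sub ha hb tendsto_inv_atTop_zero
      (eventually_ne_atTop 0) h1 h2).const_mul _)]
  push_cast
  ring

lemma integral_inv_mul_inv_of_neg_of_pos {a b : ℂ} (ha : a.im < 0) (hb : 0 < b.im) :
    ∫ t : ℝ, ((t : ℂ) - a)⁻¹ * ((t : ℂ) - b)⁻¹ = 2 * Real.pi * Complex.I * (b - a)⁻¹ := by
  have hab : a ≠ b := fun h => by rw [h] at ha; exact lt_asymm ha hb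
  rw [integral_inv_mul_inv_of_tendsto ha.ne hb.ne' hab
    (tendsto_arctan_affine_atTop_of_neg _ ha) (tendsto_arctan_affine_atTop_of_pos _ hb)
    (tendsto_arctan_affine_atBot_of_neg _ ha) (tendsto_arctan_affine_atBot_of_pos _ hb),
    ← neg_sub b a, inv_neg]
  push_cast
  ring

lemma integral_inv_mul_inv_of_same_side {a b : ℂ} (h : 0 < a.im * b.im) :
    ∫ t : ℝ, ((t : ℂ) - a)⁻¹ * ((t : ℂ) - b)⁻¹ = 0 := by
  have ha : a.im ≠ 0 := fun h0 => by simp [h0] at h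
  have hb : b.im ≠ 0 := fun h0 => by simp [h0] at h
  rcases eq_or_ne a b with rfl | hab
  · -- a double pole: the primitive is `-(t - a)⁻¹`
    have hd : ∀ t : ℝ, HasDerivAt (fun t : ℝ => -((t : ℂ) - a)⁻¹)
        (((t : ℂ) - a)⁻¹ * ((t : ℂ) - a)⁻¹) t := fun t => by
      have hne := ofReal_sub_ne_zero ha t
      refine ((((hasDerivAt_id t).ofReal_comp).sub_const a).inv hne).neg.congr_deriv ?_
      simp only [id, Complex.ofReal_one]
      field_simp
    have hlim : ∀ l : Filter ℝ, Tendsto (fun t : ℝ => ‖t‖) l atTop →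
        Tendsto (fun t : ℝ => -((t : ℂ) - a)⁻¹) l (𝓝 0) := fun l hl => by
      rw [← neg_zero]
      refine (tendsto_inv₀_cobounded.comp (tendsto_norm_atTop_iff_cobounded.1 ?_)).neg
      refine tendsto_atTop_mono (fun t => ?_) (tendsto_atTop_add_const_right l (-‖a‖) hl)
      have := norm_sub_norm_le (t : ℂ) a
      simpa [sub_eq_add_neg] using this
    rw [integral_of_hasDerivAt_of_tendsto hd (integrable_inv_mul_inv ha ha)
      (hlim _ tendsto_abs_atBot_atTop) (hlim _ tendsto_abs_atTop_atTop), sub_self]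
  · rcases lt_or_gt_of_ne ha with ha' | ha'
    · have hb' : b.im < 0 := by nlinarith
      rw [integral_inv_mul_inv_of_tendsto ha hb hab
        (tendsto_arctan_affine_atTop_of_neg _ ha') (tendsto_arctan_affine_atTop_of_neg _ hb')
        (tendsto_arctan_affine_atBot_of_neg _ ha') (tendsto_arctan_affine_atBot_of_neg _ hb')]
      simp
    · have hb' : 0 < b.im := by nlinarith
      rw [integral_inv_mul_inv_of_tendsto ha hb hab
        (tendsto_arctan_affine_atTop_of_pos _ ha') (tendsto_arctan_affine_atTop_of_pos _ hb')
        (tendsto_arctan_affine_atBot_of_pos _ ha') (tendsto_arctan_affine_atBot_of_pos _ hb')]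
      simp

/-! ### The Cauchy transform -/

/-- The Cauchy transform `z ↦ ∫ g(λ) / (z - λ) dλ` of a density on the real line. -/
noncomputable def cauchyTransform (g : ℝ → ℂ) (z : ℂ) : ℂ :=
  ∫ lam : ℝ, (z - (lam : ℂ))⁻¹ * g lam

lemma integrable_inv_sub_mul {g : ℝ → ℂ} (hg : Integrable g) {z : ℂ} (hz : z.im ≠ 0) :
    Integrable fun t : ℝ => (z - (t : ℂ))⁻¹ * g t :=
  integrable_inv_sub_smul hg hz

lemma cauchyTransform_congr {g h : ℝ → ℂ} (hgh : g =ᵐ[volume] h) :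
    cauchyTransform g = cauchyTransform h :=
  funext fun _ => integral_congr_ae (hgh.mono fun t ht => by simp only [ht])

lemma cauchyTransform_add {g h : ℝ → ℂ} (hg : Integrable g) (hh : Integrable h) {z : ℂ}
    (hz : z.im ≠ 0) :
    cauchyTransform (fun t => g t + h t) z = cauchyTransform g z + cauchyTransform h z := by
  simp only [cauchyTransform, mul_add]
  exact integral_add (integrable_inv_sub_mul hg hz) (integrable_inv_sub_mul hh hz)

lemma cauchyTransform_sub {g h : ℝ → ℂ} (hg : Integrable g) (hh : Integrable h) {z : ℂ}
    (hz : z.im ≠ 0) :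
    cauchyTransform (fun t => g t - h t) z = cauchyTransform g z - cauchyTransform h z := by
  simp only [cauchyTransform, mul_sub]
  exact integral_sub (integrable_inv_sub_mul hg hz) (integrable_inv_sub_mul hh hz)

lemma cauchyTransform_const_mul (c : ℂ) (g : ℝ → ℂ) (z : ℂ) :
    cauchyTransform (fun t => c * g t) z = c * cauchyTransform g z := by
  simp only [cauchyTransform, mul_left_comm _ c]
  exact integral_const_mul _ _

lemma hasDerivAt_cauchyTransform {g : ℝ → ℂ} (hg : Integrable g) {z : ℂ} (hz : z.im ≠ 0) :
    HasDerivAt (cauchyTransform g) (∫ t : ℝ, -((z - (t : ℂ)) ^ 2)⁻¹ * g t) z := by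
  have hpos : 0 < |z.im| := abs_pos.2 hz
  have him : ∀ x ∈ Metric.ball z (|z.im| / 2), |z.im| / 2 ≤ |x.im| := fun x hx => by
    have h1 := Complex.abs_im_le_norm (x - z)
    rw [Metric.mem_ball, dist_eq_norm] at hx
    have h2 := abs_sub_abs_le_abs_sub z.im x.im
    rw [abs_sub_comm] at h2
    simp only [Complex.sub_im] at h1
    linarith
  have hne : ∀ x ∈ Metric.ball z (|z.im| / 2), x.im ≠ 0 := fun x hx h => by
    have := him x hx
    rw [h, abs_zero] at this
    linarith
  refine (hasDerivAt_integral_of_dominated_loc_of_deriv_le (μ := volume)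
    (F := fun z (t : ℝ) => (z - (t : ℂ))⁻¹ * g t)
    (F' := fun z (t : ℝ) => -((z - (t : ℂ)) ^ 2)⁻¹ * g t)
    (bound := fun t => ((|z.im| / 2)⁻¹) ^ 2 * ‖g t‖)
    (Metric.ball_mem_nhds z (half_pos hpos)) ?_ (integrable_inv_sub_mul hg hz) ?_ ?_
    (hg.norm.const_mul _) ?_).2
  · filter_upwards [Metric.ball_mem_nhds z (half_pos hpos)] with x hx
    exact (integrable_inv_sub_mul hg (hne x hx)).aestronglyMeasurable
  · refine AEStronglyMeasurable.mul ?_ hg.aestronglyMeasurable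
    exact (Continuous.neg (Continuous.inv₀ (by fun_prop)
      fun t => pow_ne_zero 2 (sub_ofReal_ne_zero hz t))).aestronglyMeasurable
  · refine Eventually.of_forall fun t x hx => ?_
    rw [norm_mul, norm_neg, norm_inv, norm_pow, ← inv_pow, ← norm_inv]
    gcongr
    exact (norm_inv_sub_ofReal_le (hne x hx) t).trans
      (inv_anti₀ (half_pos hpos) (him x hx))
  · refine Eventually.of_forall fun t x hx => ?_
    refine ((((hasDerivAt_id x).sub_const (t : ℂ)).inv
      (sub_ofReal_ne_zero (hne x hx) t)).mul_const (g t)).congr_deriv ?_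
    simp [neg_div]

lemma continuousAt_cauchyTransform {g : ℝ → ℂ} (hg : Integrable g) {z : ℂ} (hz : z.im ≠ 0) :
    ContinuousAt (cauchyTransform g) z :=
  (hasDerivAt_cauchyTransform hg hz).continuousAt

lemma continuous_cauchyTransform_horizontal {g : ℝ → ℂ} (hg : Integrable g) {y : ℝ} (hy : y ≠ 0) :
    Continuous fun x : ℝ => cauchyTransform g (x + y * Complex.I) :=
  continuous_iff_continuousAt.2 fun x =>
    ContinuousAt.comp (f := fun x : ℝ => (x : ℂ) + y * Complex.I)
      (continuousAt_cauchyTransform hg (by simpa using hy)) (by fun_prop)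

/-! ### Mean oscillation against the Poisson weight -/

/-- The measure `ds / (1 + s²)` on the real line, i.e. `d(arctan s)`. It is `π` times the Poisson
kernel of the half-plane at height one; averages at height `ε` are written `s ↦ f (x + ε s)`. -/
noncomputable def arctanMeasure : Measure ℝ :=
  volume.withDensity fun s => ENNReal.ofReal (1 + s ^ 2)⁻¹

lemma measurable_arctanDensity : Measurable fun s : ℝ => ENNReal.ofReal (1 + s ^ 2)⁻¹ := by
  fun_prop

lemma arctanMeasure_univ : arctanMeasure Set.univ = ENNReal.ofReal Real.pi := by
  rw [arctanMeasure, withDensity_apply _ MeasurableSet.univ, Measure.restrict_univ,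
    ← ofReal_integral_eq_lintegral_ofReal integrable_inv_one_add_sq
      (Eventually.of_forall fun s => by positivity), integral_univ_inv_one_add_sq]

instance : IsFiniteMeasure arctanMeasure := ⟨by rw [arctanMeasure_univ]; exact ENNReal.ofReal_lt_top⟩

lemma lintegral_arctanMeasure {f : ℝ → ℝ≥0∞} (hf : Measurable f) :
    ∫⁻ s, f s ∂arctanMeasure = ∫⁻ s, ENNReal.ofReal (1 + s ^ 2)⁻¹ * f s := by
  rw [arctanMeasure, lintegral_withDensity_eq_lintegral_mul _ measurable_arctanDensity hf]
  rfl

/-- Jensen's inequality for the convex function `t ↦ t ^ r` and a finite measure. -/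
lemma rpow_lintegral_le {β : Type*} [MeasurableSpace β] {μ : Measure β} {r : ℝ} (hr : 1 < r)
    {f : β → ℝ≥0∞} (hf : AEMeasurable f μ) :
    (∫⁻ s, f s ∂μ) ^ r ≤ μ Set.univ ^ (r - 1) * ∫⁻ s, f s ^ r ∂μ := by
  have hr0 : 0 < r := by linarith
  have hc := Real.HolderConjugate.conjExponent hr
  have := ENNReal.lintegral_mul_le_Lp_mul_Lq μ hc hf (aemeasurable_const (b := (1 : ℝ≥0∞)))
  simp only [Pi.mul_apply, mul_one, ENNReal.one_rpow, lintegral_const, one_mul] at this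
  calc (∫⁻ s, f s ∂μ) ^ r
      ≤ ((∫⁻ s, f s ^ r ∂μ) ^ (1 / r) * μ Set.univ ^ (1 / r.conjExponent)) ^ r := by gcongr
    _ = μ Set.univ ^ (r - 1) * ∫⁻ s, f s ^ r ∂μ := by
      rw [ENNReal.mul_rpow_of_nonneg _ _ hr0.le, ← ENNReal.rpow_mul, ← ENNReal.rpow_mul,
        one_div_mul_cancel hr0.ne', ENNReal.rpow_one, mul_comm]
      congr 2
      rw [Real.conjExponent]
      field_simp

lemma lintegral_rpow_lintegral_le {α β : Type*} [MeasurableSpace α] [MeasurableSpace β]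
    {ν : Measure α} {μ : Measure β} [SFinite ν] [SFinite μ] {r : ℝ} (hr : 1 < r)
    {h : α → β → ℝ≥0∞} (hm : Measurable (Function.uncurry h)) :
    ∫⁻ x, (∫⁻ s, h x s ∂μ) ^ r ∂ν
      ≤ μ Set.univ ^ (r - 1) * ∫⁻ s, ∫⁻ x, h x s ^ r ∂ν ∂μ := by
  have hm' : Measurable (Function.uncurry fun x s => h x s ^ r) := hm.pow_const r
  rw [← lintegral_lintegral_swap (f := fun x s => h x s ^ r) hm'.aemeasurable,
    ← lintegral_const_mul _ (Measurable.lintegral_prod_right hm')]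
  exact lintegral_mono fun x => rpow_lintegral_le hr (hm.of_uncurry_left).aemeasurable

section Oscillation

variable {E : Type*} [NormedAddCommGroup E]

lemma tendsto_eLpNorm_translate_sub {f : ℝ → E} {p : ℝ≥0∞} (hp : 1 ≤ p) (hp' : p ≠ ∞)
    (hf : MemLp f p) :
    Tendsto (fun a : ℝ => eLpNorm (fun x => f (a + x) - f x) p volume) (𝓝 0) (𝓝 0) := by
  have : Fact (1 ≤ p) := ⟨hp⟩
  have : Fact (p ≠ ∞) := ⟨hp'⟩
  have hc : Continuous fun a : ℝ => (DomAddAct.mk a) +ᵥ hf.toLp f :=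
    Continuous.vadd DomAddAct.continuous_mk continuous_const
  have h0 := hc.tendsto 0
  rw [show (DomAddAct.mk (0 : ℝ)) +ᵥ hf.toLp f = hf.toLp f from by
    rw [DomAddAct.mk_zero, zero_vadd]] at h0
  rw [tendsto_iff_edist_tendsto_0] at h0
  refine h0.congr fun a => ?_
  rw [DomAddAct.mk_vadd_toLp, Lp.edist_toLp_toLp]
  rfl

lemma measurable_enorm_translate_sub {f : ℝ → E} (hf : StronglyMeasurable f) (ε : ℝ) :
    Measurable (Function.uncurry fun x s : ℝ => ‖f (x + ε * s) - f x‖ₑ) :=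
  ((hf.comp_measurable (g := fun q : ℝ × ℝ => q.1 + ε * q.2) (by fun_prop)).sub
    (hf.comp_measurable measurable_fst)).enorm

/-- The Poisson mean of the oscillation of an `L^p` function tends to zero in `L^p`. -/
lemma tendsto_lintegral_rpow_oscillation {f : ℝ → E} (hfm : StronglyMeasurable f) {p : ℝ≥0∞}
    (hp : 1 < p) (hp' : p ≠ ∞) (hf : MemLp f p) :
    Tendsto (fun ε : ℝ => ∫⁻ x, (∫⁻ s, ‖f (x + ε * s) - f x‖ₑ ∂arctanMeasure) ^ p.toReal)
      (𝓝 0) (𝓝 0) := by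
  have hr : 1 < p.toReal := one_lt_toReal hp hp'
  have hp0 : p ≠ 0 := (zero_lt_one.trans hp).ne'
  set N : ℝ → ℝ≥0∞ := fun a => eLpNorm (fun x => f (a + x) - f x) p volume with hN
  have hNle : ∀ a, N a ≤ 2 * eLpNorm f p volume := fun a => by
    refine (eLpNorm_sub_le (hfm.comp_measurable (by fun_prop)).aestronglyMeasurable
      hfm.aestronglyMeasurable hp.le).trans ?_
    rw [two_mul]
    gcongr
    exact (eLpNorm_comp_measurePreserving hfm.aestronglyMeasurable
      (measurePreserving_add_left volume a)).le
  have hNr : ∀ a, N a ^ p.toReal = ∫⁻ x, ‖f (x + a) - f x‖ₑ ^ p.toReal := fun a => by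
    rw [hN]
    simp only
    rw [eLpNorm_eq_lintegral_rpow_enorm_toReal hp0 hp', ← ENNReal.rpow_mul,
      one_div_mul_cancel (by linarith), ENNReal.rpow_one]
    simp only [add_comm a]
  have hub : ∀ ε : ℝ, ∫⁻ x, (∫⁻ s, ‖f (x + ε * s) - f x‖ₑ ∂arctanMeasure) ^ p.toReal
      ≤ arctanMeasure Set.univ ^ (p.toReal - 1) * ∫⁻ s, N (ε * s) ^ p.toReal ∂arctanMeasure :=
    fun ε => by
      simp only [hNr]
      exact lintegral_rpow_lintegral_le hr (measurable_enorm_translate_sub hfm ε)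
  have hlim : Tendsto (fun ε : ℝ => ∫⁻ s, N (ε * s) ^ p.toReal ∂arctanMeasure) (𝓝 0) (𝓝 0) := by
    have h := tendsto_lintegral_filter_of_dominated_convergence (μ := arctanMeasure)
      (l := 𝓝 (0 : ℝ)) (F := fun ε s => N (ε * s) ^ p.toReal) (f := fun _ => 0)
      (fun _ => (2 * eLpNorm f p volume) ^ p.toReal) ?_ ?_ ?_ ?_
    · simpa using h
    · refine Eventually.of_forall fun ε => ?_
      simp only [hNr]
      exact Measurable.lintegral_prod_left'
        (f := fun q : ℝ × ℝ => ‖f (q.1 + ε * q.2) - f q.1‖ₑ ^ p.toReal)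
        ((measurable_enorm_translate_sub hfm ε).pow_const _)
    · refine Eventually.of_forall fun ε => Eventually.of_forall fun s => ?_
      exact ENNReal.rpow_le_rpow (hNle _) (by linarith)
    · rw [lintegral_const]
      refine ENNReal.mul_ne_top (ENNReal.rpow_ne_top_of_nonneg (by linarith)
        (ENNReal.mul_ne_top (by simp) hf.eLpNorm_ne_top)) (measure_ne_top _ _)
    · refine Eventually.of_forall fun s => ?_
      have h1 : Tendsto (fun ε : ℝ => ε * s) (𝓝 0) (𝓝 0) := by
        simpa using (tendsto_id (α := ℝ) (x := 𝓝 0)).mul_const s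
      have h2 := ((tendsto_eLpNorm_translate_sub hp.le hp' hf).comp h1).ennrpow_const p.toReal
      rwa [ENNReal.zero_rpow_of_pos (by linarith)] at h2
  have hC : arctanMeasure Set.univ ^ (p.toReal - 1) ≠ ∞ :=
    ENNReal.rpow_ne_top_of_nonneg (by linarith) (measure_ne_top _ _)
  have h3 := ENNReal.Tendsto.const_mul hlim (Or.inr hC)
  rw [mul_zero] at h3
  exact tendsto_of_tendsto_of_tendsto_of_le_of_le tendsto_const_nhds h3 (fun _ => zero_le) hub

lemma lintegral_comp_affine (G : ℝ → ℝ≥0∞) (x : ℝ) {ε : ℝ} (hε : 0 < ε) :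
    ∫⁻ s, G (x + ε * s) = ENNReal.ofReal ε⁻¹ * ∫⁻ t, G t := by
  have h1 : ∫⁻ s, G (x + ε * s) = ∫⁻ s, G (x + s) ∂(Measure.map (ε * ·) volume) :=
    (lintegral_map_equiv (fun s => G (x + s))
      (Homeomorph.mulLeft₀ ε hε.ne').toMeasurableEquiv).symm
  rw [h1, Real.map_volume_mul_left hε.ne', lintegral_smul_measure, abs_of_pos (inv_pos.2 hε),
    lintegral_add_left_eq_self (fun t => G t) x]
  rfl

/-- The Poisson weight is dominated by a geometric series of indicators of dyadic balls. -/
lemma ofReal_inv_one_add_sq_le_tsum (s : ℝ) :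
    ENNReal.ofReal (1 + s ^ 2)⁻¹ ≤
      ∑' k : ℕ, 4 * (4⁻¹ : ℝ≥0∞) ^ k * (Metric.closedBall (0 : ℝ) (2 ^ k)).indicator 1 s := by
  have hex : ∃ k : ℕ, |s| ≤ 2 ^ k :=
    (pow_unbounded_of_one_lt |s| one_lt_two).imp fun k hk => hk.le
  classical
  set k := Nat.find hex with hk
  have hks : |s| ≤ 2 ^ k := Nat.find_spec hex
  refine le_trans ?_ (ENNReal.le_tsum k)
  rw [Set.indicator_of_mem (by simpa using hks), Pi.one_apply, mul_one]
  have e : (4 * (4⁻¹ : ℝ≥0∞) ^ k) = ENNReal.ofReal (4 * (4⁻¹ : ℝ) ^ k) := by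
    rw [ENNReal.ofReal_mul (by norm_num), ENNReal.ofReal_pow (by norm_num),
      ENNReal.ofReal_inv_of_pos (by norm_num)]
    simp
  rw [e]
  refine ENNReal.ofReal_le_ofReal ?_
  rcases Nat.eq_zero_or_pos k with h0 | h0
  · rw [h0, pow_zero, mul_one]
    exact (inv_le_one_of_one_le₀ (by nlinarith [sq_nonneg s])).trans (by norm_num)
  · have hlt : 2 ^ (k - 1) < |s| := not_le.1 (Nat.find_min hex (Nat.sub_one_lt h0.ne'))
    have h2 : ((2 : ℝ) ^ (k - 1)) ^ 2 ≤ s ^ 2 := by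
      rw [← sq_abs s]; gcongr
    have h3 : (4 : ℝ) ^ k = 4 * ((2 : ℝ) ^ (k - 1)) ^ 2 := by
      obtain ⟨m, hm⟩ : ∃ m, k = m + 1 := ⟨k - 1, by omega⟩
      rw [hm, Nat.add_sub_cancel, ← pow_mul, mul_comm m 2, pow_mul, pow_succ]
      norm_num [mul_comm]
    rw [inv_pow, h3, mul_inv, ← mul_assoc, mul_inv_cancel₀ (by norm_num), one_mul]
    exact inv_anti₀ (by positivity) (by linarith)

/-- At almost every point the Poisson mean of the oscillation of an `L^p` function tends to zero;
this holds at each Lebesgue point, after a dyadic decomposition of the Poisson weight. -/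
lemma ae_tendsto_lintegral_oscillation {f : ℝ → E} (hfm : StronglyMeasurable f) {p : ℝ≥0∞}
    (hp : 1 < p) (hp' : p ≠ ∞) (hf : MemLp f p) :
    ∀ᵐ x : ℝ, Tendsto (fun ε : ℝ => ∫⁻ s, ‖f (x + ε * s) - f x‖ₑ ∂arctanMeasure)
      (𝓝[>] 0) (𝓝 0) := by
  have hr : 1 < p.toReal := one_lt_toReal hp hp'
  have hp0 : p ≠ 0 := (zero_lt_one.trans hp).ne'
  have hfin : ∫⁻ t, ‖f t‖ₑ ^ p.toReal < ∞ :=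
    (eLpNorm_lt_top_iff_lintegral_rpow_enorm_lt_top hp0 hp').1 hf.eLpNorm_lt_top
  filter_upwards [(Besicovitch.vitaliFamily (volume : Measure ℝ)).ae_tendsto_lintegral_enorm_sub_div
    (hf.locallyIntegrable hp.le)] with x hx
  set M : ℝ → ℝ≥0∞ := fun ρ => (∫⁻ t in Metric.closedBall x ρ, ‖f t - f x‖ₑ) /
    volume (Metric.closedBall x ρ) with hM
  have hM0 : Tendsto M (𝓝[>] 0) (𝓝 0) := hx.comp (Besicovitch.tendsto_filterAt volume x)
  -- `M` is bounded: near `0` because it tends to zero, elsewhere because `f ∈ L^p`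
  obtain ⟨B, hB, hMB⟩ : ∃ B : ℝ≥0∞, B ≠ ∞ ∧ ∀ ρ, 0 < ρ → M ρ ≤ B := by
    obtain ⟨δ, hδ, hδM⟩ := mem_nhdsGT_iff_exists_Ioo_subset.1
      (hM0.eventually (gt_mem_nhds zero_lt_one))
    rw [Set.mem_Ioi] at hδ
    set B' : ℝ≥0∞ := (∫⁻ t, ‖f t‖ₑ ^ p.toReal) / ENNReal.ofReal (2 * δ) + 1 + ‖f x‖ₑ with hB'
    refine ⟨B', ?_, fun ρ hρ => ?_⟩
    · have : (∫⁻ t, ‖f t‖ₑ ^ p.toReal) / ENNReal.ofReal (2 * δ) ≠ ∞ :=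
        ENNReal.div_ne_top hfin.ne (by simpa using hδ)
      exact ENNReal.add_ne_top.2 ⟨ENNReal.add_ne_top.2 ⟨this, ENNReal.one_ne_top⟩, enorm_ne_top⟩
    · rcases lt_or_ge ρ δ with h | h
      · refine (hδM ⟨hρ, h⟩).le.trans ?_
        rw [hB', add_right_comm]
        exact le_add_self
      · have hv : volume (Metric.closedBall x ρ) = ENNReal.ofReal (2 * ρ) :=
          Real.volume_closedBall x ρ
        have hpt : ∀ t, ‖f t - f x‖ₑ ≤ ‖f t‖ₑ ^ p.toReal + (1 + ‖f x‖ₑ) := fun t => by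
          refine enorm_sub_le.trans ?_
          rw [← add_assoc]
          gcongr
          rcases le_total ‖f t‖ₑ 1 with h1 | h1
          · exact h1.trans le_add_self
          · refine le_trans ?_ le_self_add
            simpa using ENNReal.rpow_le_rpow_of_exponent_le h1 hr.le
        have hv0 : volume (Metric.closedBall x ρ) ≠ 0 := by rw [hv]; simpa using hρ
        have hvt : volume (Metric.closedBall x ρ) ≠ ∞ := by rw [hv]; exact ENNReal.ofReal_ne_top
        calc M ρ ≤ (∫⁻ t in Metric.closedBall x ρ, (‖f t‖ₑ ^ p.toReal + (1 + ‖f x‖ₑ))) /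
              volume (Metric.closedBall x ρ) := by
              simp only [hM]
              gcongr with t
              exact hpt t
          _ = (∫⁻ t in Metric.closedBall x ρ, ‖f t‖ₑ ^ p.toReal) /
              volume (Metric.closedBall x ρ) + (1 + ‖f x‖ₑ) := by
              rw [lintegral_add_right _ measurable_const, setLIntegral_const, ENNReal.add_div,
                ENNReal.mul_div_cancel_right hv0 hvt]
          _ ≤ B' := by
              rw [hB', add_assoc, hv]
              gcongr
              exact Measure.restrict_le_self
  have hub : ∀ ε : ℝ, 0 < ε → ∫⁻ s, ‖f (x + ε * s) - f x‖ₑ ∂arctanMeasure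
      ≤ ∑' k : ℕ, 8 * (2⁻¹ : ℝ≥0∞) ^ k * M (ε * 2 ^ k) := fun ε hε => by
    have hmeas : Measurable fun s => ‖f (x + ε * s) - f x‖ₑ :=
      (measurable_enorm_translate_sub hfm ε).of_uncurry_left
    rw [lintegral_arctanMeasure hmeas]
    calc ∫⁻ s, ENNReal.ofReal (1 + s ^ 2)⁻¹ * ‖f (x + ε * s) - f x‖ₑ
        ≤ ∫⁻ s, ∑' k : ℕ, 4 * (4⁻¹ : ℝ≥0∞) ^ k *
            ((Metric.closedBall (0 : ℝ) (2 ^ k)).indicator 1 s * ‖f (x + ε * s) - f x‖ₑ) := by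
          refine lintegral_mono fun s => ?_
          simp only [← mul_assoc]
          rw [ENNReal.tsum_mul_right]
          gcongr
          exact ofReal_inv_one_add_sq_le_tsum s
      _ = ∑' k : ℕ, 4 * (4⁻¹ : ℝ≥0∞) ^ k * ∫⁻ s,
            (Metric.closedBall (0 : ℝ) (2 ^ k)).indicator 1 s * ‖f (x + ε * s) - f x‖ₑ := by
          have hm : ∀ k : ℕ, Measurable fun s =>
              (Metric.closedBall (0 : ℝ) (2 ^ k)).indicator (1 : ℝ → ℝ≥0∞) s
                * ‖f (x + ε * s) - f x‖ₑ := fun k =>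
            (measurable_one.indicator measurableSet_closedBall).mul hmeas
          rw [lintegral_tsum fun k => ((hm k).const_mul _).aemeasurable]
          exact tsum_congr fun k => lintegral_const_mul _ (hm k)
      _ = ∑' k : ℕ, 8 * (2⁻¹ : ℝ≥0∞) ^ k * M (ε * 2 ^ k) := by
          refine tsum_congr fun k => ?_
          have hρ : 0 < ε * 2 ^ k := by positivity
          have h1 : ∀ s, (Metric.closedBall (0 : ℝ) (2 ^ k)).indicator (1 : ℝ → ℝ≥0∞) s
              * ‖f (x + ε * s) - f x‖ₑ = (Metric.closedBall x (ε * 2 ^ k)).indicator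
                (fun t => ‖f t - f x‖ₑ) (x + ε * s) := fun s => by
            have hiff : s ∈ Metric.closedBall (0 : ℝ) (2 ^ k) ↔
                x + ε * s ∈ Metric.closedBall x (ε * 2 ^ k) := by
              simp only [Metric.mem_closedBall, dist_zero_right, Real.norm_eq_abs, Real.dist_eq,
                add_sub_cancel_left, abs_mul, abs_of_pos hε]
              exact (mul_le_mul_iff_right₀ hε).symm
            by_cases hs : s ∈ Metric.closedBall (0 : ℝ) (2 ^ k)
            · rw [Set.indicator_of_mem hs, Set.indicator_of_mem (hiff.1 hs), Pi.one_apply, one_mul]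
            · rw [Set.indicator_of_notMem hs, Set.indicator_of_notMem (fun h => hs (hiff.2 h)),
                zero_mul]
          simp only [h1]
          rw [lintegral_comp_affine _ _ hε, lintegral_indicator measurableSet_closedBall]
          have hv : volume (Metric.closedBall x (ε * 2 ^ k)) = ENNReal.ofReal (2 * (ε * 2 ^ k)) :=
            Real.volume_closedBall x _
          have hv0 : ENNReal.ofReal (2 * (ε * 2 ^ k)) ≠ 0 := by simpa using hρ
          have h2 : ∫⁻ t in Metric.closedBall x (ε * 2 ^ k), ‖f t - f x‖ₑ
              = ENNReal.ofReal (2 * (ε * 2 ^ k)) * M (ε * 2 ^ k) := by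
            simp only [hM]
            rw [hv, ENNReal.mul_div_cancel hv0 ENNReal.ofReal_ne_top]
          rw [h2, ← mul_assoc, ← mul_assoc]
          congr 1
          have e1 : (4 * (4⁻¹ : ℝ≥0∞) ^ k) = ENNReal.ofReal (4 * (4⁻¹ : ℝ) ^ k) := by
            rw [ENNReal.ofReal_mul (by norm_num), ENNReal.ofReal_pow (by norm_num),
              ENNReal.ofReal_inv_of_pos (by norm_num)]
            simp
          have e2 : (8 * (2⁻¹ : ℝ≥0∞) ^ k) = ENNReal.ofReal (8 * (2⁻¹ : ℝ) ^ k) := by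
            rw [ENNReal.ofReal_mul (by norm_num), ENNReal.ofReal_pow (by norm_num),
              ENNReal.ofReal_inv_of_pos (by norm_num)]
            simp
          rw [e1, e2, ← ENNReal.ofReal_mul (by positivity), ← ENNReal.ofReal_mul (by positivity)]
          congr 1
          have e3 : (4 : ℝ) ^ k = 2 ^ k * 2 ^ k := by rw [← mul_pow]; norm_num
          rw [inv_pow, inv_pow, e3]
          field_simp
          norm_num
  have hlim : Tendsto (fun ε : ℝ => ∑' k : ℕ, 8 * (2⁻¹ : ℝ≥0∞) ^ k * M (ε * 2 ^ k))
      (𝓝[>] 0) (𝓝 0) := by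
    have h := tendsto_lintegral_filter_of_dominated_convergence
      (μ := (Measure.count : Measure ℕ)) (l := 𝓝[>] (0 : ℝ))
      (F := fun ε k => 8 * (2⁻¹ : ℝ≥0∞) ^ k * M (ε * 2 ^ k)) (f := fun _ => 0)
      (fun k => 8 * (2⁻¹ : ℝ≥0∞) ^ k * B) ?_ ?_ ?_ ?_
    · simpa [lintegral_count] using h
    · exact Eventually.of_forall fun ε => measurable_of_countable _
    · filter_upwards [self_mem_nhdsWithin] with ε hε
      refine Eventually.of_forall fun k => ?_
      rw [Set.mem_Ioi] at hε
      gcongr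
      exact hMB _ (by positivity)
    · rw [lintegral_count, ENNReal.tsum_mul_right, ENNReal.tsum_mul_left, ENNReal.tsum_geometric]
      refine ENNReal.mul_ne_top (ENNReal.mul_ne_top (by simp) ?_) hB
      simp
    · refine Eventually.of_forall fun k => ?_
      have h1 : Tendsto (fun ε : ℝ => ε * 2 ^ k) (𝓝[>] 0) (𝓝[>] 0) := by
        refine tendsto_nhdsWithin_iff.2 ⟨?_, ?_⟩
        · have := ((tendsto_id (α := ℝ) (x := 𝓝 0)).mul_const ((2 : ℝ) ^ k))
          rw [zero_mul] at this
          exact this.mono_left nhdsWithin_le_nhds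
        · filter_upwards [self_mem_nhdsWithin] with ε hε
          rw [Set.mem_Ioi] at hε ⊢
          positivity
      have h2 := ENNReal.Tendsto.const_mul (hM0.comp h1) (a := 8 * (2⁻¹ : ℝ≥0∞) ^ k)
        (Or.inr (ENNReal.mul_ne_top (by simp) (by simp)))
      rwa [mul_zero] at h2
  refine tendsto_of_tendsto_of_tendsto_of_le_of_le' tendsto_const_nhds hlim
    (Eventually.of_forall fun _ => zero_le) ?_
  filter_upwards [self_mem_nhdsWithin] with ε hε using hub ε hε

end Oscillation

/-! ### The Riesz inequality for the Cauchy transform -/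

lemma lintegral_rpow_cauchyTransform_le {g : ℝ → ℂ} (hg : Integrable g) {r : ℝ} (hr : 1 < r)
    {y : ℝ} (hy : y ≠ 0) :
    ∫⁻ x : ℝ, ‖cauchyTransform g (x + y * Complex.I)‖ₑ ^ r
      ≤ (∫⁻ t, ‖g t‖ₑ) ^ r * ∫⁻ x : ℝ, ‖((x : ℂ) + y * Complex.I)⁻¹‖ₑ ^ r := by
  set μ : Measure ℝ := volume.withDensity fun t => ‖g t‖ₑ with hμ
  have hμu : μ Set.univ = ∫⁻ t, ‖g t‖ₑ := by
    rw [hμ, withDensity_apply _ MeasurableSet.univ, Measure.restrict_univ]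
  have : IsFiniteMeasure μ := ⟨by rw [hμu]; exact hg.2⟩
  have hc : Continuous (Function.uncurry fun x t : ℝ =>
      ((x : ℂ) + y * Complex.I - (t : ℂ))⁻¹) := by
    refine Continuous.inv₀ (by fun_prop) fun q => ?_
    exact sub_ofReal_ne_zero (by simpa using hy) q.2
  have hm : Measurable (Function.uncurry fun x t : ℝ =>
      ‖((x : ℂ) + y * Complex.I - (t : ℂ))⁻¹‖ₑ) := hc.measurable.enorm
  have hpt : ∀ x : ℝ, ‖cauchyTransform g (x + y * Complex.I)‖ₑ
      ≤ ∫⁻ t, ‖((x : ℂ) + y * Complex.I - (t : ℂ))⁻¹‖ₑ ∂μ := fun x => by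
    refine (enorm_integral_le_lintegral_enorm _).trans (le_of_eq ?_)
    rw [hμ, lintegral_withDensity_eq_lintegral_mul₀ hg.aestronglyMeasurable.enorm
      (hm.of_uncurry_left (x := x)).aemeasurable]
    exact lintegral_congr fun t => by simp only [Pi.mul_apply, enorm_mul]; ring
  calc ∫⁻ x : ℝ, ‖cauchyTransform g (x + y * Complex.I)‖ₑ ^ r
      ≤ ∫⁻ x : ℝ, (∫⁻ t, ‖((x : ℂ) + y * Complex.I - (t : ℂ))⁻¹‖ₑ ∂μ) ^ r := by
        gcongr with x; exact hpt x
    _ ≤ μ Set.univ ^ (r - 1) * ∫⁻ t : ℝ, (∫⁻ x : ℝ,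
          ‖((x : ℂ) + y * Complex.I - (t : ℂ))⁻¹‖ₑ ^ r) ∂μ := lintegral_rpow_lintegral_le hr hm
    _ = (∫⁻ t, ‖g t‖ₑ) ^ r * ∫⁻ x : ℝ, ‖((x : ℂ) + y * Complex.I)⁻¹‖ₑ ^ r := by
        have h1 : ∀ t : ℝ, ∫⁻ x : ℝ, ‖((x : ℂ) + y * Complex.I - (t : ℂ))⁻¹‖ₑ ^ r
            = ∫⁻ x : ℝ, ‖((x : ℂ) + y * Complex.I)⁻¹‖ₑ ^ r := fun t => by
          rw [← lintegral_sub_right_eq_self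
            (fun x : ℝ => ‖((x : ℂ) + y * Complex.I)⁻¹‖ₑ ^ r) t]
          refine lintegral_congr fun x => ?_
          congr 3
          push_cast; ring
        simp only [h1]
        rw [lintegral_const, hμu, mul_comm _ (∫⁻ t, ‖g t‖ₑ), ← mul_assoc]
        congr 1
        conv_lhs => rw [← ENNReal.rpow_one (∫⁻ t, ‖g t‖ₑ), ← ENNReal.rpow_mul, one_mul,
          ← ENNReal.rpow_add_of_nonneg _ _ (by linarith) zero_le_one, sub_add_cancel]

lemma lintegral_rpow_inv_horizontal_lt_top {r : ℝ} (hr : 1 < r) {y : ℝ} (hy : y ≠ 0) :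
    ∫⁻ x : ℝ, ‖((x : ℂ) + y * Complex.I)⁻¹‖ₑ ^ r < ∞ := by
  have h := memLp_inv_ofReal_sub (z := -(y * Complex.I)) (by simpa using hy)
    (p := ENNReal.ofReal r) (by simpa using hr)
  have h2 := (eLpNorm_lt_top_iff_lintegral_rpow_enorm_lt_top
    (by simpa using zero_lt_one.trans hr) ENNReal.ofReal_ne_top).1 h.eLpNorm_lt_top
  simpa [ENNReal.toReal_ofReal (zero_lt_one.trans hr).le] using h2

/-- On a horizontal line the Cauchy transform of an integrable density is in every `L^q`, `q > 1`;
there is no uniformity in the height of the line. -/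
lemma memLp_cauchyTransform_horizontal {g : ℝ → ℂ} (hg : Integrable g) {y : ℝ} (hy : y ≠ 0)
    {q : ℝ≥0∞} (hq : 1 < q) (hq' : q ≠ ∞) :
    MemLp (fun x : ℝ => cauchyTransform g (x + y * Complex.I)) q := by
  refine ⟨(continuous_cauchyTransform_horizontal hg hy).aestronglyMeasurable, ?_⟩
  rw [eLpNorm_lt_top_iff_lintegral_rpow_enorm_lt_top (zero_lt_one.trans hq).ne' hq']
  have hr := one_lt_toReal hq hq'
  refine (lintegral_rpow_cauchyTransform_le hg hr hy).trans_lt (ENNReal.mul_lt_top ?_ ?_)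
  · exact ENNReal.rpow_lt_top_of_nonneg (by linarith) hg.2.ne
  · exact lintegral_rpow_inv_horizontal_lt_top hr hy

/-- Substitution `λ = x + y s` in a Poisson integral. -/
lemma lintegral_poisson_mul {G : ℝ → ℝ≥0∞} (hG : Measurable G) (x : ℝ) {y : ℝ} (hy : 0 < y) :
    ∫⁻ t, ENNReal.ofReal (y / ((x - t) ^ 2 + y ^ 2)) * G t
      = ∫⁻ s, G (x + y * s) ∂arctanMeasure := by
  rw [lintegral_arctanMeasure (f := fun s => G (x + y * s)) (hG.comp (by fun_prop))]
  have h := lintegral_comp_affine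
    (fun t => ENNReal.ofReal (y / ((x - t) ^ 2 + y ^ 2)) * G t) x hy
  have hy1 : ENNReal.ofReal y * ENNReal.ofReal y⁻¹ = 1 := by
    rw [← ENNReal.ofReal_mul hy.le, mul_inv_cancel₀ hy.ne', ENNReal.ofReal_one]
  rw [← one_mul (∫⁻ t, _), ← hy1, mul_assoc, ← h, ← lintegral_const_mul _ (by fun_prop)]
  refine lintegral_congr fun s => ?_
  rw [← mul_assoc, ← ENNReal.ofReal_mul hy.le]
  congr 2
  rw [show (x - (x + y * s)) ^ 2 + y ^ 2 = y ^ 2 * (1 + s ^ 2) by ring]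
  field_simp

/-- Young's inequality for the Poisson kernel, in unnormalised form. -/
lemma lintegral_rpow_poisson_le {G : ℝ → ℝ≥0∞} (hG : Measurable G) {r : ℝ} (hr : 1 < r) (y : ℝ) :
    ∫⁻ x, (∫⁻ s, G (x + y * s) ∂arctanMeasure) ^ r
      ≤ ENNReal.ofReal Real.pi ^ r * ∫⁻ t, G t ^ r := by
  refine (lintegral_rpow_lintegral_le hr (h := fun x s => G (x + y * s))
    (hG.comp (by fun_prop))).trans (le_of_eq ?_)
  simp only [lintegral_add_right_eq_self (fun t => G t ^ r)]
  rw [lintegral_const, arctanMeasure_univ, mul_comm (∫⁻ t, _), ← mul_assoc]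
  congr 1
  conv_lhs => rw [← ENNReal.rpow_one (ENNReal.ofReal Real.pi), ← ENNReal.rpow_mul, one_mul,
    ← ENNReal.rpow_add_of_nonneg _ _ (by linarith) zero_le_one, sub_add_cancel]

/-- Cauchy's theorem on the half-plane: the integrals of a decaying analytic function over
horizontal lines vanish, provided they tend to zero as the line moves to infinity. -/
lemma integral_horizontal_eq_zero {G : ℂ → ℂ} (hd : DifferentiableOn ℂ G upperPlane)
    (hint : ∀ y : ℝ, 0 < y → Integrable fun x : ℝ => G (x + y * Complex.I))
    (hdecay : ∀ a : ℝ, 0 < a → ∀ ε : ℝ, 0 < ε → ∃ R : ℝ, ∀ x y : ℝ, R ≤ |x| → a ≤ y →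
      ‖G (x + y * Complex.I)‖ ≤ ε)
    (hlim : Tendsto (fun y : ℝ => ∫ x : ℝ, G (x + y * Complex.I)) atTop (𝓝 0))
    {y : ℝ} (hy : 0 < y) : ∫ x : ℝ, G (x + y * Complex.I) = 0 := by
  refine tendsto_nhds_unique ?_ hlim
  refine tendsto_const_nhds.congr' ?_
  filter_upwards [eventually_gt_atTop y] with b hb
  have hside : ∀ (σ : ℝ), |σ| = 1 → Tendsto
      (fun R : ℝ => ∫ v in y..b, G ((σ * R : ℝ) + v * Complex.I)) atTop (𝓝 0) := fun σ hσ => by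
    rw [Metric.tendsto_atTop]
    intro ε hε
    obtain ⟨R, hR⟩ := hdecay y hy (ε / (2 * (b - y))) (div_pos hε (by linarith))
    refine ⟨max R 0, fun T hT => ?_⟩
    rw [dist_zero_right]
    have hT0 : 0 ≤ T := (le_max_right _ _).trans hT
    have h1 := intervalIntegral.norm_integral_le_of_norm_le_const (a := y) (b := b)
      (f := fun v : ℝ => G ((σ * T : ℝ) + v * Complex.I)) (C := ε / (2 * (b - y)))
      fun v hv => hR (σ * T) v (by
        rw [abs_mul, hσ, one_mul, abs_of_nonneg hT0]; exact (le_max_left _ _).trans hT)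
        (by rw [Set.uIoc_of_le hb.le] at hv; exact hv.1.le)
    rw [abs_of_pos (by linarith : 0 < b - y)] at h1
    refine h1.trans_lt ?_
    have : b - y ≠ 0 := by linarith
    field_simp
    linarith
  have htop : ∀ v : ℝ, 0 < v → Tendsto
      (fun R : ℝ => ∫ x in (-R)..R, G (x + v * Complex.I)) atTop
        (𝓝 (∫ x : ℝ, G (x + v * Complex.I))) := fun v hv =>
    intervalIntegral_tendsto_integral (hint v hv) tendsto_neg_atTop_atBot tendsto_id
  have hrect : ∀ R : ℝ, (∫ x in (-R)..R, G (x + y * Complex.I))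
      - (∫ x in (-R)..R, G (x + b * Complex.I))
      + Complex.I • (∫ v in y..b, G ((1 * R : ℝ) + v * Complex.I))
      - Complex.I • (∫ v in y..b, G ((-1 * R : ℝ) + v * Complex.I)) = 0 := fun R => by
    have := Complex.integral_boundary_rect_eq_zero_of_differentiableOn G
      (⟨-R, y⟩ : ℂ) (⟨R, b⟩ : ℂ) (hd.mono fun w hw => by
        have h2 := (Complex.mem_reProdIm.1 hw).2
        rw [Set.uIcc_of_le hb.le] at h2
        exact hy.trans_le h2.1)
    simpa using this
  have hl := (((htop y hy).sub (htop b (hy.trans hb))).add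
    ((hside 1 (by simp)).const_smul Complex.I)).sub ((hside (-1) (by simp)).const_smul Complex.I)
  have h0 := tendsto_nhds_unique hl (tendsto_const_nhds.congr fun R => (hrect R).symm)
  simp only [smul_zero, add_zero, sub_zero] at h0
  exact sub_eq_zero.1 h0

/-- The elementary inequality behind the Riesz theorem: on the right half-plane `|w|^r` is at most
`A (Re w)^r - B Re (w^r)`. Near the imaginary axis `cos (r arg w)` is negative and the second term
suffices, away from it `Re w` is comparable to `|w|`. -/
lemma exists_norm_rpow_le_re_sub_re_cpow {r : ℝ} (hr : 1 < r) (hr2 : r ≤ 2) :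
    ∃ A B : ℝ, 0 ≤ A ∧ 0 ≤ B ∧ ∀ w : ℂ, 0 < w.re →
      ‖w‖ ^ r ≤ A * w.re ^ r - B * (w ^ (r : ℂ)).re := by
  have hπ := Real.pi_pos
  set θ₀ : ℝ := Real.pi / 4 * (1 + r⁻¹) with hθ₀
  have hrinv : r⁻¹ < 1 := inv_lt_one_of_one_lt₀ hr
  have hrinv0 : 0 < r⁻¹ := by positivity
  have hθlt : θ₀ < Real.pi / 2 := by rw [hθ₀]; nlinarith
  have hθpos : 0 < θ₀ := by positivity
  have hrθ : r * θ₀ = Real.pi / 4 * (r + 1) := by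
    rw [hθ₀]; field_simp
  have hc : 0 < -Real.cos (r * θ₀) := by
    rw [neg_pos, hrθ]
    exact Real.cos_neg_of_pi_div_two_lt_of_lt (by nlinarith) (by nlinarith)
  have hc0 : 0 < Real.cos θ₀ := Real.cos_pos_of_mem_Ioo ⟨by linarith, hθlt⟩
  set B : ℝ := (-Real.cos (r * θ₀))⁻¹ with hB
  have hB0 : 0 < B := inv_pos.2 hc
  set A : ℝ := (1 + B) / Real.cos θ₀ ^ r with hA
  have hA0 : 0 < A := by positivity
  refine ⟨A, B, hA0.le, hB0.le, fun w hw => ?_⟩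
  have hθ : |w.arg| < Real.pi / 2 := Complex.abs_arg_lt_pi_div_two_iff.2 (Or.inl hw)
  have hw0 : 0 ≤ ‖w‖ := norm_nonneg w
  have hre : w.re = ‖w‖ * Real.cos |w.arg| := by
    rw [Real.cos_abs, Complex.norm_mul_cos_arg]
  have hcosn : 0 ≤ Real.cos |w.arg| :=
    (Real.cos_pos_of_mem_Ioo ⟨by linarith [abs_nonneg w.arg], hθ⟩).le
  have hpow : (w ^ (r : ℂ)).re = ‖w‖ ^ r * Real.cos (r * |w.arg|) := by
    rw [Complex.cpow_ofReal_re, ← Real.cos_abs (w.arg * r), abs_mul,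
      abs_of_pos (by linarith : 0 < r), mul_comm |w.arg|]
  rw [hpow, hre, Real.mul_rpow hw0 hcosn]
  suffices h : 1 ≤ A * Real.cos |w.arg| ^ r - B * Real.cos (r * |w.arg|) by
    have := mul_le_mul_of_nonneg_left h (Real.rpow_nonneg hw0 r)
    linarith
  rcases le_total |w.arg| θ₀ with h | h
  · have h1 : Real.cos θ₀ ≤ Real.cos |w.arg| :=
      Real.cos_le_cos_of_nonneg_of_le_pi (abs_nonneg _) (by linarith) h
    have h2 : 1 + B ≤ A * Real.cos |w.arg| ^ r := by
      calc 1 + B = A * Real.cos θ₀ ^ r := by rw [hA]; field_simp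
        _ ≤ _ := by gcongr
    have h3 : B * Real.cos (r * |w.arg|) ≤ B * 1 := by
      gcongr; exact Real.cos_le_one _
    linarith
  · have h1 : Real.cos (r * |w.arg|) ≤ Real.cos (r * θ₀) :=
      Real.cos_le_cos_of_nonneg_of_le_pi (by positivity) (by nlinarith) (by gcongr)
    have h2 : 1 ≤ -(B * Real.cos (r * |w.arg|)) := by
      calc (1 : ℝ) = B * (-Real.cos (r * θ₀)) := by rw [hB, inv_mul_cancel₀ hc.ne']
        _ ≤ B * (-Real.cos (r * |w.arg|)) := by gcongr
        _ = _ := by ring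
    have h3 : 0 ≤ A * Real.cos |w.arg| ^ r := by positivity
    linarith

/-- The Cauchy transform of an integrable density decays uniformly in `{Im z ≥ a}`. -/
lemma exists_norm_cauchyTransform_le {g : ℝ → ℂ} (hg : Integrable g) {a : ℝ} (ha : 0 < a)
    {ε : ℝ} (hε : 0 < ε) :
    ∃ R : ℝ, ∀ x y : ℝ, R ≤ |x| → a ≤ y → ‖cauchyTransform g (x + y * Complex.I)‖ ≤ ε := by
  have him : ∀ x : ℝ, ((x : ℂ) + a * Complex.I).im = a := fun x => by simp
  have hlim : Tendsto (fun x : ℝ => ∫ t : ℝ, ‖((x : ℂ) + a * Complex.I - (t : ℂ))⁻¹‖ * ‖g t‖)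
      (comap (fun x : ℝ => |x|) atTop) (𝓝 0) := by
    have h := tendsto_integral_filter_of_dominated_convergence
      (μ := volume) (l := comap (fun x : ℝ => |x|) atTop)
      (F := fun x t : ℝ => ‖((x : ℂ) + a * Complex.I - (t : ℂ))⁻¹‖ * ‖g t‖) (f := fun _ => 0)
      (fun t => |a|⁻¹ * ‖g t‖) ?_ ?_ (hg.norm.const_mul _) ?_
    · simpa using h
    · refine Eventually.of_forall fun x => ?_
      exact (continuous_inv_sub_ofReal (by rw [him]; exact ha.ne')).norm.aestronglyMeasurable.mul
        hg.aestronglyMeasurable.norm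
    · refine Eventually.of_forall fun x => Eventually.of_forall fun t => ?_
      rw [norm_mul, norm_norm, norm_norm]
      gcongr
      have := norm_inv_sub_ofReal_le (z := (x : ℂ) + a * Complex.I)
        (by rw [him]; exact ha.ne') t
      rwa [him] at this
    · refine Eventually.of_forall fun t => ?_
      have h1 : Tendsto (fun x : ℝ => ‖(x : ℂ) + a * Complex.I - (t : ℂ)‖)
          (comap (fun x : ℝ => |x|) atTop) atTop := by
        refine tendsto_atTop_mono (fun x => ?_)
          (tendsto_atTop_add_const_right _ (-|t|) tendsto_comap)
        have h2 := Complex.abs_re_le_norm ((x : ℂ) + a * Complex.I - (t : ℂ))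
        have h3 := abs_sub_abs_le_abs_sub x t
        simp at h2
        linarith
      have h2 := (tendsto_inv_atTop_zero.comp h1).mul_const ‖g t‖
      rw [zero_mul] at h2
      exact h2.congr fun x => by simp
  obtain ⟨s, hs, hsub⟩ := mem_comap.1 (hlim.eventually (gt_mem_nhds hε))
  obtain ⟨R, hR⟩ := mem_atTop_sets.1 hs
  refine ⟨R, fun x y hx hy => ?_⟩
  refine le_trans ?_ (hsub (hR |x| hx) : _ < ε).le
  have hy0 : 0 < y := ha.trans_le hy
  refine norm_integral_le_of_norm_le ?_ (Eventually.of_forall fun t => ?_)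
  · have := (integrable_inv_sub_mul hg (z := (x : ℂ) + a * Complex.I)
      (by rw [him]; exact ha.ne')).norm
    simpa only [norm_mul] using this
  · rw [norm_mul]
    gcongr
    rw [norm_inv, norm_inv]
    refine inv_anti₀ (norm_pos_iff.2 (sub_ofReal_ne_zero (by rw [him]; exact ha.ne') t)) ?_
    rw [Complex.norm_def, Complex.norm_def]
    refine Real.sqrt_le_sqrt ?_
    simp only [Complex.normSq_apply, Complex.sub_re, Complex.add_re, Complex.ofReal_re,
      Complex.mul_re, Complex.I_re, Complex.I_im, Complex.ofReal_im, Complex.sub_im, Complex.add_im,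
      Complex.mul_im]
    nlinarith

lemma re_I_mul_inv_sub (x y t : ℝ) :
    (Complex.I * ((x : ℂ) + y * Complex.I - (t : ℂ))⁻¹).re = y / ((x - t) ^ 2 + y ^ 2) := by
  rw [Complex.I_mul_re, Complex.inv_im]
  have h1 : ((x : ℂ) + y * Complex.I - (t : ℂ)).im = y := by simp
  have h2 : Complex.normSq ((x : ℂ) + y * Complex.I - (t : ℂ)) = (x - t) ^ 2 + y ^ 2 := by
    simp [Complex.normSq_apply]; ring
  rw [h1, h2]; ring

lemma re_I_mul_cauchyTransform {g : ℝ → ℝ} (hg : Integrable g) {x y : ℝ} (hy : y ≠ 0) :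
    (Complex.I * cauchyTransform (fun t => (g t : ℂ)) (x + y * Complex.I)).re
      = ∫ t, y / ((x - t) ^ 2 + y ^ 2) * g t := by
  rw [cauchyTransform, ← integral_const_mul, ← RCLike.re_eq_complex_re, ← integral_re]
  · refine integral_congr_ae (Eventually.of_forall fun t => ?_)
    simp only [RCLike.re_eq_complex_re]
    rw [← mul_assoc, mul_comm _ (g t : ℂ), Complex.re_ofReal_mul, re_I_mul_inv_sub, mul_comm]
  · exact (integrable_inv_sub_mul hg.ofReal (by simpa using hy)).const_mul _

/-- The Riesz inequality for nonnegative densities and `1 < r ≤ 2`. With `U = i F` one has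
`Re U > 0`, and the line integrals of `U ^ r` vanish. -/
lemma exists_lintegral_rpow_cauchyTransform_le {r : ℝ} (hr : 1 < r) (hr2 : r ≤ 2) :
    ∃ C : ℝ≥0∞, C ≠ ∞ ∧ ∀ g : ℝ → ℝ, Measurable g → Integrable g → (∀ t, 0 ≤ g t) →
      ∀ y : ℝ, 0 < y →
        ∫⁻ x : ℝ, ‖cauchyTransform (fun t => (g t : ℂ)) (x + y * Complex.I)‖ₑ ^ r
          ≤ C * ∫⁻ t, ‖g t‖ₑ ^ r := by
  have hr0 : 0 < r := zero_lt_one.trans hr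
  obtain ⟨A, B, hA, hB, hAB⟩ := exists_norm_rpow_le_re_sub_re_cpow hr hr2
  refine ⟨ENNReal.ofReal A * ENNReal.ofReal Real.pi ^ r,
    ENNReal.mul_ne_top ENNReal.ofReal_ne_top
      (ENNReal.rpow_ne_top_of_nonneg hr0.le ENNReal.ofReal_ne_top),
    fun g hgm hg hg0 y hy => ?_⟩
  set F : ℂ → ℂ := cauchyTransform fun t => (g t : ℂ) with hF
  by_cases hz : g =ᵐ[volume] 0
  · have h0 : F = fun _ => 0 := by
      have : (fun t => (g t : ℂ)) =ᵐ[volume] fun _ => (0 : ℂ) := by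
        filter_upwards [hz] with t ht
        simp [ht]
      rw [hF, cauchyTransform_congr this]
      funext z
      simp [cauchyTransform]
    simp [h0, hr0]
  set U : ℂ → ℂ := fun z => Complex.I * F z with hU
  have hreU : ∀ x v : ℝ, 0 < v → (U (x + v * Complex.I)).re
      = ∫ t, v / ((x - t) ^ 2 + v ^ 2) * g t := fun x v hv =>
    re_I_mul_cauchyTransform hg hv.ne'
  have hker : ∀ x v : ℝ, 0 < v → ∀ t : ℝ, 0 < v / ((x - t) ^ 2 + v ^ 2) := fun x v hv t => by
    positivity
  have hkint : ∀ x v : ℝ, 0 < v → Integrable fun t => v / ((x - t) ^ 2 + v ^ 2) * g t :=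
    fun x v hv => by
      have h := ((integrable_inv_sub_mul hg.ofReal (z := (x : ℂ) + v * Complex.I)
        (by simpa using hv.ne')).const_mul Complex.I).re
      refine h.congr (Eventually.of_forall fun t => ?_)
      simp only [RCLike.re_eq_complex_re]
      rw [← mul_assoc]
      erw [mul_comm _ (g t : ℂ)]
      rw [Complex.re_ofReal_mul, re_I_mul_inv_sub, mul_comm]
  have hpos : ∀ x v : ℝ, 0 < v → 0 < (U (x + v * Complex.I)).re := fun x v hv => by
    rw [hreU x v hv]
    refine (integral_pos_iff_support_of_nonneg
      (fun t => mul_nonneg (hker x v hv t).le (hg0 t)) (hkint x v hv)).2 ?_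
    have hs : Function.support (fun t => v / ((x - t) ^ 2 + v ^ 2) * g t)
        = Function.support g := by
      ext t
      simp only [Function.mem_support, mul_ne_zero_iff]
      exact and_iff_right (hker x v hv t).ne'
    rw [hs, pos_iff_ne_zero]
    exact fun h => hz (ae_iff.2 h)
  have hnU : ∀ z, ‖U z‖ = ‖F z‖ := fun z => by simp [hU]
  have hnG : ∀ z, ‖U z ^ (r : ℂ)‖ = ‖F z‖ ^ r := fun z => by
    rw [Complex.norm_cpow_real, hnU]
  have hzform : ∀ z : ℂ, z = (z.re : ℂ) + z.im * Complex.I := fun z => (Complex.re_add_im z).symm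
  have hslit : ∀ z ∈ upperPlane, 0 < (U z).re := fun z hz => by
    rw [hzform z]; exact hpos _ _ hz
  have hdU : DifferentiableOn ℂ (fun z => U z ^ (r : ℂ)) upperPlane := fun z hz => by
    refine DifferentiableWithinAt.cpow_const ?_ (Or.inl (hslit z hz))
    exact ((hasDerivAt_cauchyTransform hg.ofReal (ne_of_gt hz)).differentiableAt.const_mul
      _).differentiableWithinAt
  have hmem : ∀ v : ℝ, 0 < v → MemLp (fun x : ℝ => F (x + v * Complex.I)) (ENNReal.ofReal r) :=
    fun v hv => memLp_cauchyTransform_horizontal hg.ofReal hv.ne' (by simpa using hr)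
      ENNReal.ofReal_ne_top
  have hnint : ∀ v : ℝ, 0 < v → Integrable fun x : ℝ => ‖F (x + v * Complex.I)‖ ^ r :=
    fun v hv => by
      have := (hmem v hv).integrable_norm_rpow (by simpa using hr0) ENNReal.ofReal_ne_top
      rwa [ENNReal.toReal_ofReal hr0.le] at this
  have hcont : ∀ v : ℝ, 0 < v → Continuous fun x : ℝ => U (x + v * Complex.I) := fun v hv =>
    continuous_const.mul (continuous_cauchyTransform_horizontal hg.ofReal hv.ne')
  have hGint : ∀ v : ℝ, 0 < v → Integrable fun x : ℝ => U (x + v * Complex.I) ^ (r : ℂ) :=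
    fun v hv => by
      refine (hnint v hv).mono ?_ (Eventually.of_forall fun x => ?_)
      · exact (Continuous.cpow (hcont v hv) continuous_const
          fun x => Or.inl (hpos x v hv)).aestronglyMeasurable
      · rw [hnG, Real.norm_of_nonneg (by positivity)]
  have hI1 : ∫⁻ t, ‖(g t : ℂ)‖ₑ ≠ ∞ := hg.ofReal.2.ne
  have hGlim : Tendsto (fun v : ℝ => ∫ x : ℝ, U (x + v * Complex.I) ^ (r : ℂ)) atTop (𝓝 0) := by
    have hk : Tendsto (fun v : ℝ => ∫⁻ x : ℝ, ‖((x : ℂ) + v * Complex.I)⁻¹‖ₑ ^ r) atTop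
        (𝓝 0) := by
      have h := tendsto_lintegral_filter_of_dominated_convergence (μ := volume) (l := atTop)
        (F := fun v x : ℝ => ‖((x : ℂ) + v * Complex.I)⁻¹‖ₑ ^ r) (f := fun _ => 0)
        (fun x => ‖((x : ℂ) + (1 : ℝ) * Complex.I)⁻¹‖ₑ ^ r) ?_ ?_
        (lintegral_rpow_inv_horizontal_lt_top hr one_ne_zero).ne ?_
      · simpa using h
      · exact Eventually.of_forall fun v => by fun_prop
      · filter_upwards [eventually_ge_atTop 1] with v hv
        refine Eventually.of_forall fun x => ?_
        refine ENNReal.rpow_le_rpow ?_ hr0.le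
        rw [← ofReal_norm, ← ofReal_norm, norm_inv, norm_inv]
        refine ENNReal.ofReal_le_ofReal (inv_anti₀ (norm_pos_iff.2 fun h => ?_) ?_)
        · simpa using congrArg Complex.im h
        · rw [Complex.norm_add_mul_I, Complex.norm_add_mul_I]
          exact Real.sqrt_le_sqrt (by nlinarith)
      · refine Eventually.of_forall fun x => ?_
        have h1 : Tendsto (fun v : ℝ => ((x : ℂ) + v * Complex.I)⁻¹) atTop (𝓝 0) := by
          refine tendsto_inv₀_cobounded.comp (tendsto_norm_atTop_iff_cobounded.1 ?_)
          refine tendsto_atTop_mono (fun v => ?_) tendsto_id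
          have := Complex.abs_im_le_norm ((x : ℂ) + v * Complex.I)
          simp at this
          exact (le_abs_self v).trans this
        have h2 := (h1.enorm).ennrpow_const r
        rwa [enorm_zero, ENNReal.zero_rpow_of_pos hr0] at h2
    rw [tendsto_zero_iff_enorm_tendsto_zero]
    have hk' := ENNReal.Tendsto.const_mul hk (a := (∫⁻ t, ‖(g t : ℂ)‖ₑ) ^ r)
      (Or.inr (ENNReal.rpow_ne_top_of_nonneg hr0.le hI1))
    rw [mul_zero] at hk'
    refine tendsto_of_tendsto_of_tendsto_of_le_of_le' tendsto_const_nhds hk'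
      (Eventually.of_forall fun _ => zero_le) ?_
    filter_upwards [eventually_gt_atTop 0] with v hv
    refine (enorm_integral_le_lintegral_enorm _).trans ?_
    refine le_trans (le_of_eq (lintegral_congr fun x => ?_))
      (lintegral_rpow_cauchyTransform_le hg.ofReal hr hv.ne')
    rw [← ofReal_norm, hnG, ← ENNReal.ofReal_rpow_of_nonneg (norm_nonneg _) hr0.le, ofReal_norm]
    rfl
  have hzero : ∫ x : ℝ, U (x + y * Complex.I) ^ (r : ℂ) = 0 := by
    refine integral_horizontal_eq_zero hdU hGint (fun a ha ε hε => ?_) hGlim hy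
    obtain ⟨R, hR⟩ := exists_norm_cauchyTransform_le hg.ofReal ha
      (Real.rpow_pos_of_pos hε (1 / r))
    refine ⟨R, fun x v hx hv => ?_⟩
    rw [hnG]
    calc ‖F (x + v * Complex.I)‖ ^ r ≤ (ε ^ (1 / r)) ^ r := by
          gcongr; exact hR x v hx hv
      _ = ε := by rw [← Real.rpow_mul hε.le, one_div_mul_cancel hr0.ne', Real.rpow_one]
  -- the Poisson part
  have hP : ∀ x : ℝ, ENNReal.ofReal (U (x + y * Complex.I)).re
      ≤ ∫⁻ s, ‖g (x + y * s)‖ₑ ∂arctanMeasure := fun x => by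
    rw [← lintegral_poisson_mul (G := fun t => ‖g t‖ₑ) hgm.enorm x hy, hreU x y hy,
      ofReal_integral_eq_lintegral_ofReal (hkint x y hy)
        (Eventually.of_forall fun t => mul_nonneg (hker x y hy t).le (hg0 t))]
    refine lintegral_mono fun t => ?_
    simp only
    rw [ENNReal.ofReal_mul (hker x y hy t).le, Real.enorm_of_nonneg (hg0 t)]
  have hPint : Integrable fun x : ℝ => (U (x + y * Complex.I)).re ^ r := by
    refine (hnint y hy).mono ?_ (Eventually.of_forall fun x => ?_)
    · exact (Continuous.rpow_const (Complex.continuous_re.comp (hcont y hy))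
        fun x => Or.inr hr0.le).aestronglyMeasurable
    · have := (hpos x y hy).le
      rw [Real.norm_of_nonneg (by positivity), Real.norm_of_nonneg (by positivity), ← hnU]
      gcongr
      exact Complex.re_le_norm _
  have hBint : Integrable fun x : ℝ => B * (U (x + y * Complex.I) ^ (r : ℂ)).re :=
    (hGint y hy).re.const_mul B
  have hreal : ∫ x : ℝ, ‖F (x + y * Complex.I)‖ ^ r
      ≤ A * ∫ x : ℝ, (U (x + y * Complex.I)).re ^ r := by
    have h1 : ∫ x : ℝ, (U (x + y * Complex.I) ^ (r : ℂ)).re = 0 := by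
      have := integral_re (𝕜 := ℂ) (hGint y hy)
      simp only [RCLike.re_eq_complex_re] at this
      rw [this, hzero, Complex.zero_re]
    calc ∫ x : ℝ, ‖F (x + y * Complex.I)‖ ^ r
        ≤ ∫ x : ℝ, (A * (U (x + y * Complex.I)).re ^ r
            - B * (U (x + y * Complex.I) ^ (r : ℂ)).re) := by
          refine integral_mono (hnint y hy)
            ((hPint.const_mul A).sub hBint) fun x => ?_
          simp only
          rw [← hnU]
          exact hAB _ (hpos x y hy)
      _ = A * ∫ x : ℝ, (U (x + y * Complex.I)).re ^ r := by
          rw [integral_sub (hPint.const_mul A) hBint, integral_const_mul]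
          have : ∫ x : ℝ, B * (U (x + y * Complex.I) ^ (r : ℂ)).re = 0 := by
            rw [integral_const_mul, h1, mul_zero]
          rw [this, sub_zero]
  calc ∫⁻ x : ℝ, ‖F (x + y * Complex.I)‖ₑ ^ r
      = ENNReal.ofReal (∫ x : ℝ, ‖F (x + y * Complex.I)‖ ^ r) := by
        rw [ofReal_integral_eq_lintegral_ofReal (hnint y hy)
          (Eventually.of_forall fun x => by positivity)]
        refine lintegral_congr fun x => ?_
        rw [← ENNReal.ofReal_rpow_of_nonneg (norm_nonneg _) hr0.le, ofReal_norm]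
    _ ≤ ENNReal.ofReal (A * ∫ x : ℝ, (U (x + y * Complex.I)).re ^ r) :=
        ENNReal.ofReal_le_ofReal hreal
    _ = ENNReal.ofReal A * ∫⁻ x : ℝ, ENNReal.ofReal (U (x + y * Complex.I)).re ^ r := by
        rw [ENNReal.ofReal_mul hA, ofReal_integral_eq_lintegral_ofReal hPint
          (Eventually.of_forall fun x => Real.rpow_nonneg (hpos x y hy).le _)]
        congr 1
        refine lintegral_congr fun x => ?_
        rw [ENNReal.ofReal_rpow_of_nonneg (hpos x y hy).le hr0.le]
    _ ≤ ENNReal.ofReal A * ∫⁻ x : ℝ, (∫⁻ s, ‖g (x + y * s)‖ₑ ∂arctanMeasure) ^ r := by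
        gcongr with x
        exact hP x
    _ ≤ ENNReal.ofReal A * (ENNReal.ofReal Real.pi ^ r * ∫⁻ t, ‖g t‖ₑ ^ r) := by
        gcongr
        exact lintegral_rpow_poisson_le (G := fun t => ‖g t‖ₑ) hgm.enorm hr y
    _ = _ := by rw [mul_assoc]

/-- The `L^p` bound for the Cauchy transforms of densities, uniform in the height. -/
def CauchyTransformBounded (p C : ℝ≥0∞) : Prop :=
  ∀ g : ℝ → ℂ, Integrable g → ∀ y : ℝ, 0 < y →
    eLpNorm (fun x : ℝ => cauchyTransform g (x + y * Complex.I)) p volume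
      ≤ C * eLpNorm g p volume

lemma exists_cauchyTransformBounded_of_le_two {p : ℝ≥0∞} (hp : 1 < p) (hp2 : p ≤ 2) :
    ∃ C : ℝ≥0∞, C ≠ ∞ ∧ CauchyTransformBounded p C := by
  have hp' : p ≠ ∞ := ne_top_of_le_ne_top (by simp) hp2
  have hr := one_lt_toReal hp hp'
  have hr0 : 0 < p.toReal := zero_lt_one.trans hr
  obtain ⟨D, hD, hbound⟩ := exists_lintegral_rpow_cauchyTransform_le hr
    (by simpa using ENNReal.toReal_mono (by simp) hp2)
  have hD' : D ^ (1 / p.toReal) ≠ ∞ := ENNReal.rpow_ne_top_of_nonneg (by positivity) hD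
  have hnn : ∀ g : ℝ → ℝ, Measurable g → Integrable g → (∀ t, 0 ≤ g t) → ∀ y : ℝ, 0 < y →
      eLpNorm (fun x : ℝ => cauchyTransform (fun t => (g t : ℂ)) (x + y * Complex.I)) p volume
        ≤ D ^ (1 / p.toReal) * eLpNorm g p volume := fun g hgm hg hg0 y hy => by
    rw [eLpNorm_eq_lintegral_rpow_enorm_toReal (zero_lt_one.trans hp).ne' hp',
      eLpNorm_eq_lintegral_rpow_enorm_toReal (zero_lt_one.trans hp).ne' hp',
      ← ENNReal.mul_rpow_of_nonneg _ _ (by positivity)]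
    exact ENNReal.rpow_le_rpow (hbound g hgm hg hg0 y hy) (by positivity)
  refine ⟨4 * D ^ (1 / p.toReal), ENNReal.mul_ne_top (by simp) hD', fun g hg y hy => ?_⟩
  wlog hgm : Measurable g generalizing g
  · have hae := hg.aestronglyMeasurable.ae_eq_mk
    rw [cauchyTransform_congr hae, eLpNorm_congr_ae hae]
    exact this _ (hg.congr hae) hg.aestronglyMeasurable.stronglyMeasurable_mk.measurable
  -- positive and negative parts of the real and imaginary parts
  have hpart : ∀ L : ℂ → ℝ, Continuous L → (∀ z, |L z| ≤ ‖z‖) →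
      Integrable (fun t => ((max (L (g t)) 0 : ℝ) : ℂ)) ∧
      eLpNorm (fun x : ℝ => cauchyTransform (fun t => ((max (L (g t)) 0 : ℝ) : ℂ))
        (x + y * Complex.I)) p volume ≤ D ^ (1 / p.toReal) * eLpNorm g p volume := by
    intro L hL hLb
    have hm : Measurable fun t => max (L (g t)) 0 := (hL.measurable.comp hgm).max measurable_const
    have hle : ∀ t, ‖max (L (g t)) 0‖ ≤ ‖g t‖ := fun t => by
      rw [Real.norm_of_nonneg (le_max_right _ _)]
      exact max_le ((le_abs_self _).trans (hLb _)) (norm_nonneg _)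
    have hi : Integrable fun t => max (L (g t)) 0 :=
      hg.mono hm.aestronglyMeasurable (Eventually.of_forall hle)
    refine ⟨hi.ofReal, (hnn _ hm hi (fun t => le_max_right _ _) y hy).trans ?_⟩
    gcongr
    exact eLpNorm_mono hle
  obtain ⟨i1, b1⟩ := hpart (fun z => z.re) Complex.continuous_re Complex.abs_re_le_norm
  obtain ⟨i2, b2⟩ := hpart (fun z => -z.re) Complex.continuous_re.neg
    fun z => by rw [abs_neg]; exact Complex.abs_re_le_norm z
  obtain ⟨i3, b3⟩ := hpart (fun z => z.im) Complex.continuous_im Complex.abs_im_le_norm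
  obtain ⟨i4, b4⟩ := hpart (fun z => -z.im) Complex.continuous_im.neg
    fun z => by rw [abs_neg]; exact Complex.abs_im_le_norm z
  set g1 : ℝ → ℂ := fun t => ((max (g t).re 0 : ℝ) : ℂ)
  set g2 : ℝ → ℂ := fun t => ((max (-(g t).re) 0 : ℝ) : ℂ)
  set g3 : ℝ → ℂ := fun t => ((max (g t).im 0 : ℝ) : ℂ)
  set g4 : ℝ → ℂ := fun t => ((max (-(g t).im) 0 : ℝ) : ℂ)
  have i12 : Integrable fun t => g1 t - g2 t := i1.sub i2
  have i34 : Integrable fun t => g3 t - g4 t := i3.sub i4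
  have hmax : ∀ a : ℝ, max a 0 - max (-a) 0 = a := fun a => by
    rcases le_total 0 a with h | h
    · rw [max_eq_left h, max_eq_right (by linarith), sub_zero]
    · rw [max_eq_right h, max_eq_left (by linarith)]; ring
  have hdec : g = fun t => (g1 t - g2 t) + Complex.I * (g3 t - g4 t) := by
    funext t
    simp only [g1, g2, g3, g4, ← Complex.ofReal_sub, hmax]
    rw [mul_comm, Complex.re_add_im]
  have hF : (fun x : ℝ => cauchyTransform g (x + y * Complex.I)) =
      ((fun x : ℝ => cauchyTransform g1 (x + y * Complex.I))
        - (fun x : ℝ => cauchyTransform g2 (x + y * Complex.I)))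
      + Complex.I • ((fun x : ℝ => cauchyTransform g3 (x + y * Complex.I))
        - (fun x : ℝ => cauchyTransform g4 (x + y * Complex.I))) := by
    funext x
    have hz : ((x : ℂ) + y * Complex.I).im ≠ 0 := by simpa using hy.ne'
    conv_lhs => rw [hdec]
    rw [cauchyTransform_add i12 (i34.const_mul Complex.I) hz,
      cauchyTransform_sub i1 i2 hz, cauchyTransform_const_mul, cauchyTransform_sub i3 i4 hz]
    rfl
  have hm : ∀ h : ℝ → ℂ, Integrable h →
      AEStronglyMeasurable (fun x : ℝ => cauchyTransform h (x + y * Complex.I)) volume :=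
    fun h hh => (continuous_cauchyTransform_horizontal hh hy.ne').aestronglyMeasurable
  have h12 := (eLpNorm_sub_le (hm _ i1) (hm _ i2) hp.le).trans (add_le_add b1 b2)
  have h34 := (eLpNorm_sub_le (hm _ i3) (hm _ i4) hp.le).trans (add_le_add b3 b4)
  rw [hF]
  refine (eLpNorm_add_le ((hm _ i1).sub (hm _ i2)) (((hm _ i3).sub (hm _ i4)).const_smul _)
    hp.le).trans ?_
  rw [eLpNorm_const_smul]
  have hI : ‖Complex.I‖ₑ = 1 := by
    rw [← ofReal_norm, Complex.norm_I, ENNReal.ofReal_one]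
  rw [hI, one_mul]
  refine (add_le_add h12 h34).trans (le_of_eq ?_)
  ring

/-- The pairing of a Cauchy transform with an integrable function is, up to conjugation, symmetric. -/
lemma integral_cauchyTransform_mul {g h : ℝ → ℂ} (hg : Integrable g) (hh : Integrable h) {y : ℝ}
    (hy : y ≠ 0) :
    ∫ x : ℝ, cauchyTransform g (x + y * Complex.I) * h x =
      -∫ t : ℝ, g t * starRingEnd ℂ
        (cauchyTransform (fun x => starRingEnd ℂ (h x)) (t + y * Complex.I)) := by
  have hc : Continuous (fun q : ℝ × ℝ => ((q.1 : ℂ) + y * Complex.I - (q.2 : ℂ))⁻¹) :=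
    Continuous.inv₀ (by fun_prop) fun q => sub_ofReal_ne_zero (by simpa using hy) q.2
  have hint : Integrable (Function.uncurry fun x t : ℝ =>
      ((x : ℂ) + y * Complex.I - (t : ℂ))⁻¹ * g t * h x) (volume.prod volume) := by
    have h1 := ((hh.mul_prod hg).bdd_mul (c := |y|⁻¹) hc.aestronglyMeasurable
      (Eventually.of_forall fun q => by
        have := norm_inv_sub_ofReal_le (z := (q.1 : ℂ) + y * Complex.I) (by simpa using hy) q.2
        simpa using this))
    refine h1.congr (Eventually.of_forall fun q => ?_)
    simp only [Function.uncurry]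
    ring
  calc ∫ x : ℝ, cauchyTransform g (x + y * Complex.I) * h x
      = ∫ x : ℝ, ∫ t : ℝ, ((x : ℂ) + y * Complex.I - (t : ℂ))⁻¹ * g t * h x := by
        refine integral_congr_ae (Eventually.of_forall fun x => ?_)
        simp only [cauchyTransform]
        rw [integral_mul_const]
    _ = ∫ t : ℝ, ∫ x : ℝ, ((x : ℂ) + y * Complex.I - (t : ℂ))⁻¹ * g t * h x :=
        integral_integral_swap hint
    _ = _ := by
        rw [← integral_neg]
        refine integral_congr_ae (Eventually.of_forall fun t => ?_)
        simp only [cauchyTransform]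
        rw [← integral_conj, ← integral_const_mul, ← integral_neg]
        refine integral_congr_ae (Eventually.of_forall fun x => ?_)
        simp only [map_mul, map_inv₀, map_sub, map_add, Complex.conj_ofReal, Complex.conj_I,
          Complex.conj_conj]
        rw [show (t : ℂ) + y * -Complex.I - x = -((x : ℂ) + y * Complex.I - t) by ring, inv_neg]
        ring

lemma exists_cauchyTransformBounded {p : ℝ≥0∞} (hp : 1 < p) (hp' : p ≠ ∞) :
    ∃ C : ℝ≥0∞, C ≠ ∞ ∧ CauchyTransformBounded p C := by
  rcases le_or_gt p 2 with hp2 | hp2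
  · exact exists_cauchyTransformBounded_of_le_two hp hp2
  have hr := one_lt_toReal hp hp'
  have hr2 : 2 < p.toReal := by
    simpa using (ENNReal.toReal_lt_toReal (by simp) hp').2 hp2
  set r := p.toReal with hrdef
  have hr0 : 0 < r := by linarith
  set r' := r.conjExponent with hr'def
  have hconj : r.HolderConjugate r' := Real.HolderConjugate.conjExponent hr
  have hr' : 1 < r' := hconj.symm.lt
  have hr'0 : 0 < r' := hconj.symm.pos
  have hr'2 : r' ≤ 2 := by
    rw [hr'def, Real.conjExponent, div_le_iff₀ (by linarith)]
    linarith
  set q := ENNReal.ofReal r' with hq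
  have hq1 : 1 < q := by simpa [hq] using hr'
  have hq2 : q ≤ 2 := by
    rw [hq]; simpa using ENNReal.ofReal_le_ofReal hr'2
  have hqr : q.toReal = r' := ENNReal.toReal_ofReal hr'0.le
  obtain ⟨C, hC, hCb⟩ := exists_cauchyTransformBounded_of_le_two hq1 hq2
  refine ⟨C, hC, fun g hg y hy => ?_⟩
  set F : ℝ → ℂ := fun x => cauchyTransform g (x + y * Complex.I) with hF
  have hFc : Continuous F := continuous_cauchyTransform_horizontal hg hy.ne'
  have hmem : ∀ s : ℝ, 1 < s → MemLp F (ENNReal.ofReal s) := fun s hs =>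
    memLp_cauchyTransform_horizontal hg hy.ne' (by simpa using hs) ENNReal.ofReal_ne_top
  have hFint : ∀ s : ℝ, 1 < s → Integrable fun x => ‖F x‖ ^ s := fun s hs => by
    have := (hmem s hs).integrable_norm_rpow (by simpa using zero_lt_one.trans hs)
      ENNReal.ofReal_ne_top
    rwa [ENNReal.toReal_ofReal (by linarith)] at this
  -- the extremal function of the duality between `L^p` and `L^q`
  set h : ℝ → ℂ := fun x => starRingEnd ℂ (F x) * ((‖F x‖ ^ (r - 2) : ℝ) : ℂ) with hh
  have hhn : ∀ x, ‖h x‖ = ‖F x‖ ^ (r - 1) := fun x => by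
    simp only [hh]
    rw [norm_mul, RCLike.norm_conj, Complex.norm_real, Real.norm_of_nonneg (by positivity)]
    rw [show r - 1 = 1 + (r - 2) by ring, Real.rpow_add' (norm_nonneg _) (by linarith),
      Real.rpow_one]
  have hFh : ∀ x, F x * h x = ((‖F x‖ ^ r : ℝ) : ℂ) := fun x => by
    simp only [hh]
    rw [← mul_assoc, Complex.mul_conj, Complex.normSq_eq_norm_sq, ← Complex.ofReal_mul]
    congr 1
    rw [← Real.rpow_natCast, ← Real.rpow_add' (norm_nonneg _) (by push_cast; linarith)]
    congr 1
    push_cast; ring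
  have hhc : Continuous h := by
    refine (Complex.continuous_conj.comp hFc).mul (Complex.continuous_ofReal.comp ?_)
    exact Continuous.rpow_const hFc.norm fun x => Or.inr (by linarith)
  have hhi : Integrable h := by
    refine (hFint (r - 1) (by linarith)).mono hhc.aestronglyMeasurable
      (Eventually.of_forall fun x => ?_)
    rw [hhn, Real.norm_of_nonneg (by positivity)]
  set T : ℝ≥0∞ := ∫⁻ x, ‖F x‖ₑ ^ r with hT
  have hTeq : T = ENNReal.ofReal (∫ x, ‖F x‖ ^ r) := by
    rw [ofReal_integral_eq_lintegral_ofReal (hFint r hr)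
      (Eventually.of_forall fun x => by positivity)]
    refine lintegral_congr fun x => ?_
    rw [← ENNReal.ofReal_rpow_of_nonneg (norm_nonneg _) hr0.le, ofReal_norm]
  have hTtop : T ≠ ∞ := by rw [hTeq]; exact ENNReal.ofReal_ne_top
  have hhq : eLpNorm h q volume = T ^ (1 / r') := by
    rw [eLpNorm_eq_lintegral_rpow_enorm_toReal (zero_lt_one.trans hq1).ne'
      ENNReal.ofReal_ne_top, hqr, hT]
    congr 1
    refine lintegral_congr fun x => ?_
    rw [← ofReal_norm, hhn, ← ENNReal.ofReal_rpow_of_nonneg (norm_nonneg _) (by linarith),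
      ofReal_norm, ← ENNReal.rpow_mul]
    congr 1
    rw [hr'def, Real.conjExponent]
    have : r - 1 ≠ 0 := by linarith
    field_simp
  have hTle : T ≤ eLpNorm g p volume * (C * T ^ (1 / r')) := by
    set h' : ℝ → ℂ := fun x => starRingEnd ℂ (h x) with hh'
    have hh'i : Integrable h' := (integrable_norm_iff
      (Complex.continuous_conj.comp hhc).aestronglyMeasurable).1 (by simpa [hh'] using hhi.norm)
    have hh'n : eLpNorm h' q volume = eLpNorm h q volume :=
      eLpNorm_congr_norm_ae (Eventually.of_forall fun x => by simp [hh'])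
    have e1 : T = ‖∫ x, F x * h x‖ₑ := by
      simp only [hFh]
      rw [integral_complex_ofReal, hTeq, ← ofReal_norm, Complex.norm_real,
        Real.norm_of_nonneg (integral_nonneg fun x => by positivity)]
    have hd := hCb h' hh'i y hy
    rw [hh'n, hhq] at hd
    have hkc : Continuous fun t : ℝ => cauchyTransform h' (t + y * Complex.I) :=
      continuous_cauchyTransform_horizontal hh'i hy.ne'
    refine e1.le.trans ?_
    rw [integral_cauchyTransform_mul hg hhi hy.ne', enorm_neg]
    calc ‖∫ t : ℝ, g t * starRingEnd ℂ (cauchyTransform h' (t + y * Complex.I))‖ₑ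
        ≤ ∫⁻ t : ℝ, ‖g t * starRingEnd ℂ (cauchyTransform h' (t + y * Complex.I))‖ₑ :=
          enorm_integral_le_lintegral_enorm _
      _ = ∫⁻ t : ℝ, ‖g t‖ₑ * ‖cauchyTransform h' (t + y * Complex.I)‖ₑ := by
          refine lintegral_congr fun t => ?_
          rw [enorm_mul]
          congr 1
          rw [← ofReal_norm, RCLike.norm_conj, ofReal_norm]
      _ ≤ (∫⁻ t, ‖g t‖ₑ ^ r) ^ (1 / r) *
            (∫⁻ t : ℝ, ‖cauchyTransform h' (t + y * Complex.I)‖ₑ ^ r') ^ (1 / r') :=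
          ENNReal.lintegral_mul_le_Lp_mul_Lq volume hconj hg.aestronglyMeasurable.enorm
            hkc.enorm.measurable.aemeasurable
      _ ≤ eLpNorm g p volume * (C * T ^ (1 / r')) := by
          rw [eLpNorm_eq_lintegral_rpow_enorm_toReal (zero_lt_one.trans hq1).ne'
            ENNReal.ofReal_ne_top, hqr] at hd
          rw [eLpNorm_eq_lintegral_rpow_enorm_toReal (zero_lt_one.trans hp).ne' hp']
          gcongr
  rw [eLpNorm_eq_lintegral_rpow_enorm_toReal (zero_lt_one.trans hp).ne' hp', ← hrdef, ← hT]
  rcases eq_or_ne T 0 with hT0 | hT0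
  · rw [hT0, ENNReal.zero_rpow_of_pos (by positivity)]; exact zero_le
  have hpos : T ^ (1 / r') ≠ 0 := by simp [hT0, hTtop]
  have htop : T ^ (1 / r') ≠ ∞ := ENNReal.rpow_ne_top_of_nonneg (by positivity) hTtop
  rw [← ENNReal.mul_le_mul_iff_left hpos htop, ← ENNReal.rpow_add _ _ hT0 hTtop]
  have : 1 / r + 1 / r' = 1 := by simpa using hconj.inv_add_inv_eq_one
  rw [this, ENNReal.rpow_one]
  refine hTle.trans (le_of_eq ?_)
  ring

/-! ### Reproducing formulas -/

lemma integrable_inv_mul_inv_mul_prod {g : ℝ → ℂ} (hg : Integrable g) {z : ℂ} (hz : z.im ≠ 0)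
    {η : ℝ} (hη : η ≠ 0) :
    Integrable (Function.uncurry fun t lam : ℝ =>
      ((t : ℂ) - z)⁻¹ * ((t : ℂ) + η * Complex.I - (lam : ℂ))⁻¹ * g lam)
      (volume.prod volume) := by
  have hsq : ∀ {w : ℂ}, w.im ≠ 0 → Integrable fun t : ℝ => ‖((t : ℂ) - w)⁻¹‖ ^ 2 := fun {w} hw => by
    refine (integrable_inv_mul_inv hw hw).norm.congr (Eventually.of_forall fun t => ?_)
    simp only [norm_mul]; ring
  have h1 : Integrable (fun q : ℝ × ℝ => ‖((q.1 : ℂ) - z)⁻¹‖ ^ 2 * ‖g q.2‖)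
      (volume.prod volume) := (hsq hz).mul_prod hg.norm
  have hη' : (-(η * Complex.I) : ℂ).im ≠ 0 := by simpa using hη
  have h2 : Integrable (fun q : ℝ × ℝ =>
      ‖g q.2‖ * ‖(((q.1 - q.2 : ℝ) : ℂ) - -(η * Complex.I))⁻¹‖ ^ 2) (volume.prod volume) :=
    hg.norm.convolution_integrand (ContinuousLinearMap.mul ℝ ℝ) (hsq hη')
  refine (h1.add h2).mono ?_ (Eventually.of_forall fun q => ?_)
  · refine AEStronglyMeasurable.mul ?_
      (hg.aestronglyMeasurable.comp_quasiMeasurePreserving Measure.quasiMeasurePreserving_snd)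
    refine Continuous.aestronglyMeasurable (Continuous.mul ?_ ?_)
    · exact (continuous_inv_ofReal_sub hz).comp continuous_fst
    · exact Continuous.inv₀ (by fun_prop) fun q => sub_ofReal_ne_zero (by simpa using hη) q.2
  · simp only [Function.uncurry, Pi.add_apply, norm_mul]
    have e : (((q.1 - q.2 : ℝ) : ℂ) - -(η * Complex.I))
        = (q.1 : ℂ) + η * Complex.I - (q.2 : ℂ) := by push_cast; ring
    rw [e, Real.norm_of_nonneg (by positivity)]
    have h0 := norm_nonneg (g q.2)
    nlinarith [mul_nonneg h0 (sq_nonneg (‖((q.1 : ℂ) - z)⁻¹‖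
      - ‖((q.1 : ℂ) + η * Complex.I - (q.2 : ℂ))⁻¹‖)),
      mul_nonneg h0 (sq_nonneg ‖((q.1 : ℂ) - z)⁻¹‖),
      mul_nonneg h0 (sq_nonneg ‖((q.1 : ℂ) + η * Complex.I - (q.2 : ℂ))⁻¹‖)]

lemma integral_inv_mul_cauchyTransform {g : ℝ → ℂ} (hg : Integrable g) {z : ℂ} (hz : z.im ≠ 0)
    {η : ℝ} (hη : η ≠ 0) :
    ∫ t : ℝ, ((t : ℂ) - z)⁻¹ * cauchyTransform g (t + η * Complex.I) =
      ∫ lam : ℝ, (∫ t : ℝ, ((t : ℂ) - ((lam : ℂ) - η * Complex.I))⁻¹ * ((t : ℂ) - z)⁻¹) * g lam := by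
  calc ∫ t : ℝ, ((t : ℂ) - z)⁻¹ * cauchyTransform g (t + η * Complex.I)
      = ∫ t : ℝ, ∫ lam : ℝ,
          ((t : ℂ) - z)⁻¹ * ((t : ℂ) + η * Complex.I - (lam : ℂ))⁻¹ * g lam := by
        refine integral_congr_ae (Eventually.of_forall fun t => ?_)
        simp only [cauchyTransform]
        rw [← integral_const_mul]
        simp only [mul_assoc]
    _ = ∫ lam : ℝ, ∫ t : ℝ,
          ((t : ℂ) - z)⁻¹ * ((t : ℂ) + η * Complex.I - (lam : ℂ))⁻¹ * g lam :=
        integral_integral_swap (integrable_inv_mul_inv_mul_prod hg hz hη)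
    _ = _ := by
        refine integral_congr_ae (Eventually.of_forall fun lam => ?_)
        simp only
        rw [← integral_mul_const]
        refine integral_congr_ae (Eventually.of_forall fun t => ?_)
        simp only
        rw [show (t : ℂ) + η * Complex.I - (lam : ℂ) = (t : ℂ) - ((lam : ℂ) - η * Complex.I) by
          ring]
        ring

/-- Cauchy's integral formula for the Cauchy transform on a horizontal line. -/
lemma integral_inv_mul_cauchyTransform_of_pos {g : ℝ → ℂ} (hg : Integrable g) {z : ℂ}
    (hz : 0 < z.im) {η : ℝ} (hη : 0 < η) :
    ∫ t : ℝ, ((t : ℂ) - z)⁻¹ * cauchyTransform g (t + η * Complex.I) =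
      2 * Real.pi * Complex.I * cauchyTransform g (z + η * Complex.I) := by
  rw [integral_inv_mul_cauchyTransform hg hz.ne' hη.ne', cauchyTransform, ← integral_const_mul]
  refine integral_congr_ae (Eventually.of_forall fun lam => ?_)
  simp only
  rw [integral_inv_mul_inv_of_neg_of_pos (by simpa using hη) hz,
    show z - ((lam : ℂ) - η * Complex.I) = z + η * Complex.I - (lam : ℂ) by ring, mul_assoc]

lemma integral_inv_mul_cauchyTransform_of_neg {g : ℝ → ℂ} (hg : Integrable g) {z : ℂ}
    {η : ℝ} (h : z.im * η < 0) :
    ∫ t : ℝ, ((t : ℂ) - z)⁻¹ * cauchyTransform g (t + η * Complex.I) = 0 := by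
  have hz : z.im ≠ 0 := fun h0 => by simp [h0] at h
  have hη : η ≠ 0 := fun h0 => by simp [h0] at h
  rw [integral_inv_mul_cauchyTransform hg hz hη]
  refine integral_eq_zero_of_ae (Eventually.of_forall fun lam => ?_)
  simp only [Pi.zero_apply]
  rw [integral_inv_mul_inv_of_same_side (by simp; linarith), zero_mul]

/-! ### Poisson integrals -/

/-- The Poisson integral of `f` at a point `z` of the upper half-plane, with the Poisson kernel
written as the difference of the Cauchy kernels at `z` and at its conjugate. -/
noncomputable def poissonIntegral (f : ℝ → ℂ) (z : ℂ) : ℂ :=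
  (2 * Real.pi * Complex.I)⁻¹ *
    ∫ t : ℝ, (((t : ℂ) - z)⁻¹ - ((t : ℂ) - starRingEnd ℂ z)⁻¹) * f t

lemma two_pi_I_ne_zero : (2 * Real.pi * Complex.I : ℂ) ≠ 0 := by
  simp [Real.pi_ne_zero]

lemma inv_sub_inv_conj {z : ℂ} (hz : z.im ≠ 0) (t : ℝ) :
    ((t : ℂ) - z)⁻¹ - ((t : ℂ) - starRingEnd ℂ z)⁻¹
      = (z - starRingEnd ℂ z) * (((t : ℂ) - starRingEnd ℂ z)⁻¹ * ((t : ℂ) - z)⁻¹) := by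
  have h1 := ofReal_sub_ne_zero hz t
  have h2 := ofReal_sub_ne_zero (z := starRingEnd ℂ z) (by simpa using hz) t
  field_simp
  ring

lemma norm_inv_sub_inv_conj {z : ℂ} (hz : 0 < z.im) (t : ℝ) :
    ‖((t : ℂ) - z)⁻¹ - ((t : ℂ) - starRingEnd ℂ z)⁻¹‖ = 2 * (z.im / ((z.re - t) ^ 2 + z.im ^ 2)) := by
  rw [inv_sub_inv_conj hz.ne', norm_mul, norm_mul, Complex.sub_conj, norm_inv, norm_inv]
  have h1 : ‖(t : ℂ) - starRingEnd ℂ z‖ = ‖(t : ℂ) - z‖ := by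
    rw [← RCLike.norm_conj ((t : ℂ) - starRingEnd ℂ z)]
    simp
  have h2 : ‖(t : ℂ) - z‖ ^ 2 = (z.re - t) ^ 2 + z.im ^ 2 := by
    rw [Complex.sq_norm, Complex.normSq_apply]
    simp; ring
  rw [h1, ← mul_inv, ← sq, h2, norm_mul, Complex.norm_I, Complex.norm_real,
    Real.norm_of_nonneg (by positivity)]
  ring

lemma integrable_inv_sub_inv_conj {z : ℂ} (hz : z.im ≠ 0) :
    Integrable fun t : ℝ => ((t : ℂ) - z)⁻¹ - ((t : ℂ) - starRingEnd ℂ z)⁻¹ := by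
  simp only [inv_sub_inv_conj hz]
  exact (integrable_inv_mul_inv (by simpa using hz) hz).const_mul _

lemma integral_inv_sub_inv_conj {z : ℂ} (hz : 0 < z.im) :
    ∫ t : ℝ, (((t : ℂ) - z)⁻¹ - ((t : ℂ) - starRingEnd ℂ z)⁻¹) = 2 * Real.pi * Complex.I := by
  simp only [inv_sub_inv_conj hz.ne']
  rw [integral_const_mul, integral_inv_mul_inv_of_neg_of_pos (by simpa using hz) hz]
  have : z - starRingEnd ℂ z ≠ 0 := by
    rw [Complex.sub_conj]
    simp [hz.ne']
  field_simp

/-- The Poisson integral at a point of the cone `|Re z - x| ≤ a Im z` differs from any constant `c`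
by at most the Poisson mean around `x` of the distance to `c`. -/
lemma enorm_poissonIntegral_sub_le {f : ℝ → ℂ} (hf : Measurable f) {z : ℂ} (hz : 0 < z.im)
    (hint : Integrable fun t : ℝ => (((t : ℂ) - z)⁻¹ - ((t : ℂ) - starRingEnd ℂ z)⁻¹) * f t)
    {a x : ℝ} (hx : |z.re - x| ≤ a * z.im) (c : ℂ) :
    ‖poissonIntegral f z - c‖ₑ ≤
      ENNReal.ofReal (2 + 2 * a ^ 2) * ∫⁻ s, ‖f (x + z.im * s) - c‖ₑ ∂arctanMeasure := by
  have h2π := two_pi_I_ne_zero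
  have e1 : poissonIntegral f z - c = (2 * Real.pi * Complex.I)⁻¹ *
      ∫ t : ℝ, (((t : ℂ) - z)⁻¹ - ((t : ℂ) - starRingEnd ℂ z)⁻¹) * (f t - c) := by
    simp only [mul_sub]
    rw [integral_sub hint ((integrable_inv_sub_inv_conj hz.ne').mul_const c), integral_mul_const,
      integral_inv_sub_inv_conj hz, poissonIntegral, mul_sub, ← mul_assoc _ _ c,
      inv_mul_cancel₀ h2π, one_mul]
  have hm : Measurable fun t => ‖f t - c‖ₑ := (hf.sub_const c).enorm
  rw [e1, enorm_mul, ← lintegral_poisson_mul hm x hz]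
  have hker : ∀ t : ℝ, z.im / ((z.re - t) ^ 2 + z.im ^ 2)
      ≤ (2 + 2 * a ^ 2) * (z.im / ((x - t) ^ 2 + z.im ^ 2)) := fun t => by
    have hsq : (z.re - x) ^ 2 ≤ a ^ 2 * z.im ^ 2 := by
      rw [← sq_abs, ← mul_pow]; gcongr
    rw [← mul_div_assoc, div_le_div_iff₀ (by positivity) (by positivity), mul_comm _ z.im,
      mul_assoc]
    gcongr
    nlinarith [sq_nonneg ((z.re - t) + (z.re - x)), sq_nonneg (a * (z.re - t)), sq_nonneg (z.re - t),
      sq_nonneg (z.re - x)]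
  have hpi : ‖(2 * Real.pi * Complex.I : ℂ)⁻¹‖ * 2 ≤ 1 := by
    rw [norm_inv]
    simp only [norm_mul, Complex.norm_I, Complex.norm_real, Complex.norm_ofNat, mul_one,
      Real.norm_of_nonneg Real.pi_pos.le]
    rw [mul_inv, mul_comm, ← mul_assoc, mul_inv_cancel₀ two_ne_zero, one_mul]
    exact inv_le_one_of_one_le₀ (by linarith [Real.pi_gt_three])
  calc ‖(2 * Real.pi * Complex.I : ℂ)⁻¹‖ₑ *
        ‖∫ t : ℝ, (((t : ℂ) - z)⁻¹ - ((t : ℂ) - starRingEnd ℂ z)⁻¹) * (f t - c)‖ₑ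
      ≤ ‖(2 * Real.pi * Complex.I : ℂ)⁻¹‖ₑ *
          ∫⁻ t : ℝ, ENNReal.ofReal (2 * (2 + 2 * a ^ 2)) *
            (ENNReal.ofReal (z.im / ((x - t) ^ 2 + z.im ^ 2)) * ‖f t - c‖ₑ) := by
        gcongr
        refine (enorm_integral_le_lintegral_enorm _).trans (lintegral_mono fun t => ?_)
        rw [enorm_mul, ← mul_assoc, ← ENNReal.ofReal_mul (by positivity), ← ofReal_norm,
          norm_inv_sub_inv_conj hz, mul_assoc 2]
        gcongr
        exact hker t
    _ = ENNReal.ofReal (‖(2 * Real.pi * Complex.I : ℂ)⁻¹‖ * 2) * (ENNReal.ofReal (2 + 2 * a ^ 2) *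
          ∫⁻ t : ℝ, ENNReal.ofReal (z.im / ((x - t) ^ 2 + z.im ^ 2)) * ‖f t - c‖ₑ) := by
        rw [lintegral_const_mul _ (by fun_prop), ← ofReal_norm, ← mul_assoc, ← mul_assoc,
          ← ENNReal.ofReal_mul (by positivity), ← ENNReal.ofReal_mul (by positivity)]
        congr 2
        ring
    _ ≤ 1 * (ENNReal.ofReal (2 + 2 * a ^ 2) *
          ∫⁻ t : ℝ, ENNReal.ofReal (z.im / ((x - t) ^ 2 + z.im ^ 2)) * ‖f t - c‖ₑ) := by
        gcongr
        exact ENNReal.ofReal_le_one.2 hpi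
    _ = _ := one_mul _

lemma integrable_poissonKernel_mul {g : ℝ → ℂ} (hg : Integrable g) {z : ℂ} (hz : z.im ≠ 0) :
    Integrable fun t : ℝ => (((t : ℂ) - z)⁻¹ - ((t : ℂ) - starRingEnd ℂ z)⁻¹) * g t := by
  refine ((integrable_inv_sub_mul hg (z := starRingEnd ℂ z) (by simpa using hz)).sub
    (integrable_inv_sub_mul hg hz)).congr (Eventually.of_forall fun t => ?_)
  simp only [Pi.sub_apply]
  rw [← neg_sub (t : ℂ) z, ← neg_sub (t : ℂ) (starRingEnd ℂ z), inv_neg, inv_neg]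
  ring

lemma poissonIntegral_eq_cauchyTransform {g : ℝ → ℂ} (hg : Integrable g) {z : ℂ} (hz : z.im ≠ 0) :
    poissonIntegral g z = (2 * Real.pi * Complex.I)⁻¹ *
      (cauchyTransform g (starRingEnd ℂ z) - cauchyTransform g z) := by
  rw [poissonIntegral, cauchyTransform, cauchyTransform,
    ← integral_sub (integrable_inv_sub_mul hg (by simpa using hz)) (integrable_inv_sub_mul hg hz)]
  congr 1
  refine integral_congr_ae (Eventually.of_forall fun t => ?_)
  simp only
  rw [← neg_sub (t : ℂ) z, ← neg_sub (t : ℂ) (starRingEnd ℂ z), inv_neg, inv_neg]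
  ring

lemma poissonIntegral_horizontal {g : ℝ → ℂ} (hg : Integrable g) {η : ℝ} (hη : η ≠ 0) (x : ℝ) :
    poissonIntegral g (x + η * Complex.I) = (2 * Real.pi * Complex.I)⁻¹ *
      (cauchyTransform g (x + (-η : ℝ) * Complex.I) - cauchyTransform g (x + η * Complex.I)) := by
  rw [poissonIntegral_eq_cauchyTransform hg (by simpa using hη)]
  simp

lemma continuous_poissonIntegral_horizontal {g : ℝ → ℂ} (hg : Integrable g) {η : ℝ} (hη : η ≠ 0) :
    Continuous fun x : ℝ => poissonIntegral g (x + η * Complex.I) := by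
  simp only [poissonIntegral_horizontal hg hη]
  exact continuous_const.mul ((continuous_cauchyTransform_horizontal hg (neg_ne_zero.2 hη)).sub
    (continuous_cauchyTransform_horizontal hg hη))

lemma integrable_poissonIntegral_horizontal {g : ℝ → ℂ} (hgm : Measurable g) (hg : Integrable g)
    {η : ℝ} (hη : 0 < η) :
    Integrable fun x : ℝ => poissonIntegral g (x + η * Complex.I) := by
  refine ⟨(continuous_poissonIntegral_horizontal hg hη.ne').aestronglyMeasurable, ?_⟩
  have hpt : ∀ x : ℝ, ‖poissonIntegral g (x + η * Complex.I)‖ₑ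
      ≤ ENNReal.ofReal 2 * ∫⁻ s, ‖g (x + η * s)‖ₑ ∂arctanMeasure := fun x => by
    have h := enorm_poissonIntegral_sub_le hgm (z := x + η * Complex.I) (by simpa using hη)
      (integrable_poissonKernel_mul hg (by simpa using hη.ne')) (a := 0) (x := x) (by simp) 0
    simpa using h
  have hm : Measurable (Function.uncurry fun x s : ℝ => ‖g (x + η * s)‖ₑ) :=
    hgm.enorm.comp (g := fun t : ℝ => ‖g t‖ₑ) (by fun_prop)
  refine (lintegral_mono hpt).trans_lt ?_
  rw [lintegral_const_mul _ (Measurable.lintegral_prod_right hm),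
    lintegral_lintegral_swap hm.aemeasurable]
  simp only [lintegral_add_right_eq_self (fun t => ‖g t‖ₑ)]
  rw [lintegral_const]
  exact ENNReal.mul_lt_top ENNReal.ofReal_lt_top (ENNReal.mul_lt_top hg.2 (measure_lt_top _ _))

/-- Poisson integrals are an approximate identity in `L^p`. -/
lemma tendsto_eLpNorm_poissonIntegral_sub {g : ℝ → ℂ} (hgm : StronglyMeasurable g)
    (hg : Integrable g) {p : ℝ≥0∞} (hp : 1 < p) (hp' : p ≠ ∞) (hgp : MemLp g p) :
    Tendsto (fun η : ℝ => eLpNorm (fun x : ℝ => poissonIntegral g (x + η * Complex.I) - g x)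
      p volume) (𝓝[>] 0) (𝓝 0) := by
  have hr := one_lt_toReal hp hp'
  have hr0 : 0 < p.toReal := zero_lt_one.trans hr
  have hosc := (tendsto_lintegral_rpow_oscillation hgm hp hp' hgp).mono_left
    (nhdsWithin_le_nhds (s := Set.Ioi 0))
  have h2 := ((ENNReal.Tendsto.const_mul hosc
    (a := ENNReal.ofReal 2 ^ p.toReal)
    (Or.inr (ENNReal.rpow_ne_top_of_nonneg hr0.le ENNReal.ofReal_ne_top))).ennrpow_const
    (1 / p.toReal))
  rw [mul_zero, ENNReal.zero_rpow_of_pos (by positivity)] at h2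
  refine tendsto_of_tendsto_of_tendsto_of_le_of_le' tendsto_const_nhds h2
    (Eventually.of_forall fun _ => zero_le) ?_
  filter_upwards [self_mem_nhdsWithin] with η hη
  rw [Set.mem_Ioi] at hη
  rw [eLpNorm_eq_lintegral_rpow_enorm_toReal (zero_lt_one.trans hp).ne' hp']
  refine ENNReal.rpow_le_rpow ?_ (by positivity)
  rw [← lintegral_const_mul' _ _ (ENNReal.rpow_ne_top_of_nonneg hr0.le ENNReal.ofReal_ne_top)]
  refine lintegral_mono fun x => ?_
  simp only
  rw [← ENNReal.mul_rpow_of_nonneg _ _ hr0.le]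
  refine ENNReal.rpow_le_rpow ?_ hr0.le
  have h := enorm_poissonIntegral_sub_le hgm.measurable (z := x + η * Complex.I) (by simpa using hη)
    (integrable_poissonKernel_mul hg (by simpa using hη.ne')) (a := 0) (x := x) (by simp) (g x)
  simpa using h

/-- Shifting the Cauchy transform upwards amounts to replacing the density by its Poisson
integral. -/
lemma cauchyTransform_poissonIntegral {g : ℝ → ℂ} (hg : Integrable g) {η : ℝ} (hη : 0 < η) {z : ℂ}
    (hz : 0 < z.im) :
    cauchyTransform (fun x : ℝ => poissonIntegral g (x + η * Complex.I)) z
      = cauchyTransform g (z + η * Complex.I) := by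
  have hint : ∀ v : ℝ, v ≠ 0 → Integrable fun t : ℝ =>
      ((t : ℂ) - z)⁻¹ * cauchyTransform g (t + v * Complex.I) := fun v hv =>
    (memLp_inv_ofReal_sub hz.ne' (p := 2) (by norm_num)).integrable_mul
      (memLp_cauchyTransform_horizontal hg hv (q := 2) (by norm_num) (by simp))
  have e : ∀ t : ℝ, (z - (t : ℂ))⁻¹ * poissonIntegral g (t + η * Complex.I)
      = (2 * Real.pi * Complex.I)⁻¹ *
        (((t : ℂ) - z)⁻¹ * cauchyTransform g (t + η * Complex.I)
          - ((t : ℂ) - z)⁻¹ * cauchyTransform g (t + (-η : ℝ) * Complex.I)) := fun t => by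
    rw [poissonIntegral_horizontal hg hη.ne', ← neg_sub (t : ℂ) z, inv_neg]
    ring
  rw [cauchyTransform]
  simp only [e]
  rw [integral_const_mul, integral_sub (hint η hη.ne') (hint (-η) (neg_ne_zero.2 hη.ne')),
    integral_inv_mul_cauchyTransform_of_pos hg hz hη,
    integral_inv_mul_cauchyTransform_of_neg hg (by nlinarith), sub_zero, ← mul_assoc,
    inv_mul_cancel₀ two_pi_I_ne_zero, one_mul]

/-! ### Boundary values of the Cauchy transform -/

lemma one_lt_conjExponent {p : ℝ≥0∞} (hp' : p ≠ ∞) : 1 < ENNReal.conjExponent p := by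
  rw [ENNReal.conjExponent]
  refine ENNReal.lt_add_right ENNReal.one_ne_top ?_
  exact ENNReal.inv_ne_zero.2 (ENNReal.sub_ne_top hp')

lemma integrable_inv_ofReal_sub_mul {f : ℝ → ℂ} {p : ℝ≥0∞} (hp : 1 < p) (hp' : p ≠ ∞)
    (hf : MemLp f p) {z : ℂ} (hz : z.im ≠ 0) : Integrable fun t : ℝ => ((t : ℂ) - z)⁻¹ * f t := by
  have := ENNReal.HolderConjugate.conjExponent hp.le
  have := ENNReal.HolderConjugate.symm (p := p) (q := ENNReal.conjExponent p)
  exact (memLp_inv_ofReal_sub hz (one_lt_conjExponent hp')).integrable_mul hf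

/-- Pairing with a Cauchy kernel is continuous in `L^p`. -/
lemma tendsto_integral_inv_ofReal_sub_mul {ι : Type*} {l : Filter ι} {F : ι → ℝ → ℂ} {f : ℝ → ℂ}
    {p : ℝ≥0∞} (hp : 1 < p) (hp' : p ≠ ∞) (hF : ∀ᶠ i in l, MemLp (F i) p) (hf : MemLp f p)
    (h : Tendsto (fun i => eLpNorm (F i - f) p volume) l (𝓝 0)) {z : ℂ} (hz : z.im ≠ 0) :
    Tendsto (fun i => ∫ t : ℝ, ((t : ℂ) - z)⁻¹ * F i t) l (𝓝 (∫ t : ℝ, ((t : ℂ) - z)⁻¹ * f t)) := by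
  have := ENNReal.HolderConjugate.conjExponent hp.le
  have := ENNReal.HolderConjugate.symm (p := p) (q := ENNReal.conjExponent p)
  set φ : ℝ → ℂ := fun t => ((t : ℂ) - z)⁻¹
  have hφ : MemLp φ (ENNReal.conjExponent p) := memLp_inv_ofReal_sub hz (one_lt_conjExponent hp')
  rw [tendsto_iff_edist_tendsto_0]
  have h2 := ENNReal.Tendsto.const_mul h (Or.inr hφ.eLpNorm_ne_top)
  rw [mul_zero] at h2
  refine tendsto_of_tendsto_of_tendsto_of_le_of_le' tendsto_const_nhds h2
    (Eventually.of_forall fun _ => zero_le) ?_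
  filter_upwards [hF] with i hi
  rw [edist_eq_enorm_sub, ← integral_sub (integrable_inv_ofReal_sub_mul hp hp' hi hz)
    (integrable_inv_ofReal_sub_mul hp hp' hf hz)]
  refine (enorm_integral_le_lintegral_enorm _).trans ?_
  have h3 := eLpNorm_smul_le_mul_eLpNorm (p := ENNReal.conjExponent p) (q := p) (r := 1) (hi.sub hf).aestronglyMeasurable
    hφ.aestronglyMeasurable
  rw [eLpNorm_one_eq_lintegral_enorm] at h3
  refine le_trans (le_of_eq (lintegral_congr fun t => ?_)) h3
  simp only [Pi.smul_apply', Pi.sub_apply, smul_eq_mul]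
  congr 1
  simp only [φ]
  ring

/-- `f` is the `L^p` boundary function of the Cauchy transform of `g`: the restrictions to
horizontal lines converge to `f` in `L^p`, and the transform is recovered from `f` by the Cauchy
integral, which vanishes in the lower half-plane. -/
structure IsCauchyBoundary (g f : ℝ → ℂ) (p : ℝ≥0∞) : Prop where
  stronglyMeasurable : StronglyMeasurable f
  memLp : MemLp f p
  tendsto_Lp : Tendsto (fun y : ℝ => eLpNorm
    (fun x : ℝ => cauchyTransform g (x + y * Complex.I) - f x) p volume) (𝓝[>] 0) (𝓝 0)
  integral_upper : ∀ z : ℂ, 0 < z.im →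
    ∫ t : ℝ, ((t : ℂ) - z)⁻¹ * f t = 2 * Real.pi * Complex.I * cauchyTransform g z
  integral_lower : ∀ z : ℂ, z.im < 0 → ∫ t : ℝ, ((t : ℂ) - z)⁻¹ * f t = 0

/-- The horizontal restrictions are Cauchy in `L^p`: the difference of two of them is the Cauchy
transform of `g - P_η g`, which is small by the Riesz inequality and the approximate identity. -/
lemma exists_tendsto_eLpNorm_cauchyTransform_sub {g : ℝ → ℂ} (hgm : StronglyMeasurable g)
    (hg : Integrable g) {p : ℝ≥0∞} (hp : 1 < p) (hp' : p ≠ ∞) (hgp : MemLp g p) :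
    ∃ f : ℝ → ℂ, StronglyMeasurable f ∧ MemLp f p ∧ Tendsto (fun y : ℝ => eLpNorm
      (fun x : ℝ => cauchyTransform g (x + y * Complex.I) - f x) p volume) (𝓝[>] 0) (𝓝 0) := by
  have : Fact (1 ≤ p) := ⟨hp.le⟩
  obtain ⟨C, hC, hCb⟩ := exists_cauchyTransformBounded hp hp'
  set F : ℝ → ℝ → ℂ := fun y x => cauchyTransform g (x + y * Complex.I) with hF
  have hFm : ∀ y, 0 < y → MemLp (F y) p := fun y hy =>
    memLp_cauchyTransform_horizontal hg hy.ne' hp hp'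
  set δ : ℝ → ℝ≥0∞ := fun η => C * eLpNorm
    (fun x : ℝ => poissonIntegral g (x + η * Complex.I) - g x) p volume with hδ
  have hδ0 : Tendsto δ (𝓝[>] 0) (𝓝 0) := by
    have := ENNReal.Tendsto.const_mul
      (tendsto_eLpNorm_poissonIntegral_sub hgm hg hp hp' hgp) (Or.inr hC)
    rwa [mul_zero] at this
  have hdiff : ∀ y η, 0 < y → 0 < η → eLpNorm (F (y + η) - F y) p volume ≤ δ η :=
    fun y η hy hη => by
      have hPi := integrable_poissonIntegral_horizontal hgm.measurable hg hη
      refine le_trans (le_of_eq ?_) (hCb _ (hPi.sub hg) y hy)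
      congr 1
      funext x
      have hz : 0 < ((x : ℂ) + y * Complex.I).im := by simpa using hy
      have := cauchyTransform_sub hPi hg hz.ne'
      rw [cauchyTransform_poissonIntegral hg hη hz] at this
      simp only [Pi.sub_apply, hF]
      refine Eq.trans ?_ this.symm
      congr 2
      push_cast; ring
  have hsmall : ∀ ε : ℝ≥0∞, 0 < ε → ∃ η₀ : ℝ, 0 < η₀ ∧ ∀ y y', 0 < y → y < y' → y' < η₀ →
      eLpNorm (F y' - F y) p volume < ε := fun ε hε => by
    obtain ⟨η₀, hη₀, hsub⟩ := mem_nhdsGT_iff_exists_Ioo_subset.1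
      (hδ0.eventually (gt_mem_nhds hε))
    refine ⟨η₀, hη₀, fun y y' hy hyy' hy' => ?_⟩
    have h1 := hdiff y (y' - y) hy (by linarith)
    rw [add_sub_cancel] at h1
    exact h1.trans_lt (hsub ⟨by linarith, by linarith⟩)
  set u : ℕ → ℝ := fun n => 1 / ((n : ℝ) + 1) with hu
  have hu0 : ∀ n, 0 < u n := fun n => by positivity
  have hulim : Tendsto u atTop (𝓝 0) := tendsto_one_div_add_atTop_nhds_zero_nat
  set Φ : ℕ → Lp ℂ p (volume : Measure ℝ) := fun n => (hFm (u n) (hu0 n)).toLp with hΦ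
  have hcauchy : CauchySeq Φ := by
    rw [EMetric.cauchySeq_iff]
    intro ε hε
    obtain ⟨η₀, hη₀, hsm⟩ := hsmall ε hε
    obtain ⟨N, hN⟩ := eventually_atTop.1 (hulim.eventually (gt_mem_nhds hη₀))
    refine ⟨N, fun m hm n hn => ?_⟩
    rw [hΦ, Lp.edist_toLp_toLp]
    rcases lt_trichotomy (u m) (u n) with h | h | h
    · rw [eLpNorm_sub_comm]; exact hsm _ _ (hu0 m) h (hN n hn)
    · rw [h, sub_self]; simpa using hε
    · exact hsm _ _ (hu0 n) h (hN m hm)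
  obtain ⟨fLp, hf⟩ := cauchySeq_tendsto_of_complete hcauchy
  set f : ℝ → ℂ := ⇑fLp with hfdef
  have hfm : MemLp f p := Lp.memLp fLp
  have hflim : Tendsto (fun n => eLpNorm (F (u n) - f) p volume) atTop (𝓝 0) := by
    rw [tendsto_iff_edist_tendsto_0] at hf
    refine hf.congr fun n => ?_
    rw [Lp.edist_def]
    exact eLpNorm_congr_ae ((hFm (u n) (hu0 n)).coeFn_toLp.sub EventuallyEq.rfl)
  refine ⟨f, Lp.stronglyMeasurable fLp, hfm, ?_⟩
  rw [ENNReal.tendsto_nhds_zero]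
  intro ε hε
  obtain ⟨η₀, hη₀, hsm⟩ := hsmall ε hε
  filter_upwards [Ioo_mem_nhdsGT hη₀] with y hy
  have hlim2 : Tendsto (fun n => ε + eLpNorm (F (u n) - f) p volume) atTop (𝓝 (ε + 0)) :=
    hflim.const_add ε
  rw [add_zero] at hlim2
  refine ge_of_tendsto hlim2 ?_
  filter_upwards [hulim.eventually (gt_mem_nhds hy.1)] with n hn
  have h1 := hsm _ _ (hu0 n) hn hy.2
  have h2 : (fun x : ℝ => cauchyTransform g (x + y * Complex.I) - f x)
      = (F y - F (u n)) + (F (u n) - f) := by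
    funext x; simp [hF]
  rw [h2]
  refine (eLpNorm_add_le ((hFm y hy.1).sub (hFm _ (hu0 n))).aestronglyMeasurable
    ((hFm _ (hu0 n)).sub hfm).aestronglyMeasurable hp.le).trans ?_
  gcongr

lemma exists_isCauchyBoundary {g : ℝ → ℂ} (hg : Integrable g) {p : ℝ≥0∞} (hp : 1 < p)
    (hp' : p ≠ ∞) (hgp : MemLp g p) : ∃ f, IsCauchyBoundary g f p := by
  obtain ⟨f, hfm, hf, hlim⟩ : ∃ f : ℝ → ℂ, StronglyMeasurable f ∧ MemLp f p ∧
      Tendsto (fun y : ℝ => eLpNorm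
        (fun x : ℝ => cauchyTransform g (x + y * Complex.I) - f x) p volume) (𝓝[>] 0) (𝓝 0) := by
    have hae := hg.aestronglyMeasurable.ae_eq_mk
    rw [cauchyTransform_congr hae]
    exact exists_tendsto_eLpNorm_cauchyTransform_sub hg.aestronglyMeasurable.stronglyMeasurable_mk
      (hg.congr hae) hp hp' ((memLp_congr_ae hae).1 hgp)
  have hF : ∀ᶠ η : ℝ in 𝓝[>] 0, MemLp (fun x : ℝ => cauchyTransform g (x + η * Complex.I)) p := by
    filter_upwards [self_mem_nhdsWithin] with η hη
    exact memLp_cauchyTransform_horizontal hg (ne_of_gt hη) hp hp'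
  refine ⟨f, hfm, hf, hlim, fun z hz => ?_, fun z hz => ?_⟩
  · have h1 := tendsto_integral_inv_ofReal_sub_mul hp hp' hF hf hlim hz.ne'
    refine tendsto_nhds_unique h1 ?_
    have h2 : Tendsto (fun η : ℝ => z + η * Complex.I) (𝓝[>] 0) (𝓝 z) := by
      have : Continuous fun η : ℝ => z + η * Complex.I := by fun_prop
      simpa using (this.tendsto 0).mono_left (nhdsWithin_le_nhds (s := Set.Ioi 0))
    have h3 := ((continuousAt_cauchyTransform hg hz.ne').tendsto.comp h2).const_mul
      (2 * Real.pi * Complex.I)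
    refine h3.congr' ?_
    filter_upwards [self_mem_nhdsWithin] with η hη
    exact (integral_inv_mul_cauchyTransform_of_pos hg hz hη).symm
  · have h1 := tendsto_integral_inv_ofReal_sub_mul hp hp' hF hf hlim hz.ne
    refine tendsto_nhds_unique h1 (tendsto_const_nhds.congr' ?_)
    filter_upwards [self_mem_nhdsWithin] with η hη
    exact (integral_inv_mul_cauchyTransform_of_neg hg (mul_neg_of_neg_of_pos hz hη)).symm

namespace IsCauchyBoundary

variable {g f : ℝ → ℂ} {p : ℝ≥0∞}

lemma integrable_poissonKernel_mul (h : IsCauchyBoundary g f p) (hp : 1 < p) (hp' : p ≠ ∞) {z : ℂ}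
    (hz : z.im ≠ 0) :
    Integrable fun t : ℝ => (((t : ℂ) - z)⁻¹ - ((t : ℂ) - starRingEnd ℂ z)⁻¹) * f t := by
  simp only [sub_mul]
  exact (integrable_inv_ofReal_sub_mul hp hp' h.memLp hz).sub
    (integrable_inv_ofReal_sub_mul hp hp' h.memLp (by simpa using hz))

lemma poissonIntegral_eq (h : IsCauchyBoundary g f p) (hp : 1 < p) (hp' : p ≠ ∞) {z : ℂ}
    (hz : 0 < z.im) : poissonIntegral f z = cauchyTransform g z := by
  rw [poissonIntegral]
  simp only [sub_mul]
  rw [integral_sub (integrable_inv_ofReal_sub_mul hp hp' h.memLp hz.ne')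
      (integrable_inv_ofReal_sub_mul hp hp' h.memLp (by simpa using hz.ne')),
    h.integral_upper z hz, h.integral_lower _ (by simpa using hz), sub_zero, ← mul_assoc,
    inv_mul_cancel₀ two_pi_I_ne_zero, one_mul]

/-- Fatou's theorem: the boundary function is the non-tangential limit at its Lebesgue points. -/
lemma isBoundaryValue (h : IsCauchyBoundary g f p) (hp : 1 < p) (hp' : p ≠ ∞) :
    IsBoundaryValue (cauchyTransform g) f p where
  memLp := h.memLp
  tendsto_Lp := h.tendsto_Lp
  nontangential := by
    filter_upwards [ae_tendsto_lintegral_oscillation h.stronglyMeasurable hp hp' h.memLp] with x hx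
    intro a ha
    rw [tendsto_iff_edist_tendsto_0]
    have him : Tendsto (fun z : ℂ => z.im) (𝓝[stolzCone a x] (x : ℂ)) (𝓝[>] 0) := by
      refine tendsto_nhdsWithin_iff.2 ⟨?_, ?_⟩
      · have := Complex.continuous_im.tendsto (x : ℂ)
        rw [Complex.ofReal_im] at this
        exact this.mono_left nhdsWithin_le_nhds
      · filter_upwards [self_mem_nhdsWithin] with z hz using hz.1
    have h2 := ENNReal.Tendsto.const_mul (hx.comp him) (a := ENNReal.ofReal (2 + 2 * a ^ 2))
      (Or.inr ENNReal.ofReal_ne_top)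
    rw [mul_zero] at h2
    refine tendsto_of_tendsto_of_tendsto_of_le_of_le' tendsto_const_nhds h2
      (Eventually.of_forall fun _ => zero_le) ?_
    filter_upwards [self_mem_nhdsWithin] with z hz
    rw [edist_eq_enorm_sub, ← h.poissonIntegral_eq hp hp' hz.1]
    exact enorm_poissonIntegral_sub_le h.stronglyMeasurable.measurable hz.1
      (h.integrable_poissonKernel_mul hp hp' hz.1.ne') hz.2.le _

/-- The transform is the Cauchy integral of the imaginary part of its boundary function. -/
lemma integral_inv_mul_im (h : IsCauchyBoundary g f p) (hp : 1 < p) (hp' : p ≠ ∞) {z : ℂ}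
    (hz : 0 < z.im) :
    ∫ t : ℝ, ((t : ℂ) - z)⁻¹ * ((f t).im : ℂ) = Real.pi * cauchyTransform g z := by
  have hz' : (starRingEnd ℂ z).im < 0 := by simpa using hz
  have i1 := integrable_inv_ofReal_sub_mul hp hp' h.memLp hz.ne'
  have i2 := integrable_inv_ofReal_sub_mul hp hp' h.memLp hz'.ne
  have hc : ∀ t : ℝ, starRingEnd ℂ (((t : ℂ) - starRingEnd ℂ z)⁻¹ * f t)
      = ((t : ℂ) - z)⁻¹ * starRingEnd ℂ (f t) := fun t => by simp
  have i3 : Integrable fun t : ℝ => ((t : ℂ) - z)⁻¹ * starRingEnd ℂ (f t) := by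
    simp only [← hc]
    exact (Complex.conjCLE : ℂ ≃L[ℝ] ℂ).toContinuousLinearMap.integrable_comp i2
  have e3 : ∫ t : ℝ, ((t : ℂ) - z)⁻¹ * starRingEnd ℂ (f t) = 0 := by
    simp only [← hc]
    rw [integral_conj, h.integral_lower _ hz', map_zero]
  have e : ∀ t : ℝ, ((t : ℂ) - z)⁻¹ * ((f t).im : ℂ) = (2 * Complex.I)⁻¹ *
      (((t : ℂ) - z)⁻¹ * f t - ((t : ℂ) - z)⁻¹ * starRingEnd ℂ (f t)) := fun t => by
    rw [← mul_sub, Complex.sub_conj]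
    push_cast
    field_simp [Complex.I_ne_zero]
  simp only [e]
  rw [integral_const_mul, integral_sub i1 i3, e3, h.integral_upper z hz, sub_zero]
  field_simp [Complex.I_ne_zero]

end IsCauchyBoundary

/-! ### Truncated dispersion integrals -/

/-- The difference of the truncated Hilbert kernel and the conjugate Poisson kernel at
height `ε`. -/
noncomputable def truncationError (ε u : ℝ) : ℝ :=
  {u : ℝ | ε < |u|}.indicator (fun u => u⁻¹) u - u / (u ^ 2 + ε ^ 2)

lemma measurableSet_lt_abs (ε : ℝ) : MeasurableSet {u : ℝ | ε < |u|} :=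
  measurableSet_lt measurable_const measurable_norm

lemma measurable_truncationError (ε : ℝ) : Measurable (truncationError ε) :=
  (measurable_inv.indicator (measurableSet_lt_abs ε)).sub (by fun_prop)

lemma truncationError_neg (ε u : ℝ) : truncationError ε (-u) = -truncationError ε u := by
  unfold truncationError
  by_cases h : ε < |u|
  · rw [Set.indicator_of_mem (by simpa using h), Set.indicator_of_mem (by simpa using h), inv_neg,
      neg_sq]
    ring
  · rw [Set.indicator_of_notMem (by simpa using h), Set.indicator_of_notMem (by simpa using h),
      neg_sq]
    ring

lemma abs_truncationError_le {ε : ℝ} (hε : 0 < ε) (u : ℝ) :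
    |truncationError ε u| ≤ ε / (u ^ 2 + ε ^ 2) := by
  have hpos : 0 < u ^ 2 + ε ^ 2 := by positivity
  unfold truncationError
  by_cases h : ε < |u|
  · rw [Set.indicator_of_mem (by simpa using h)]
    have hu : u ≠ 0 := fun h0 => by rw [h0, abs_zero] at h; linarith
    have hua : 0 < |u| := abs_pos.2 hu
    have e : u⁻¹ - u / (u ^ 2 + ε ^ 2) = ε ^ 2 / (u * (u ^ 2 + ε ^ 2)) := by
      field_simp; ring
    rw [e, abs_div, abs_mul, abs_of_pos hpos, abs_of_pos (by positivity : 0 < ε ^ 2),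
      div_le_div_iff₀ (by positivity) hpos]
    have := mul_le_mul_of_nonneg_left h.le (mul_pos hε hpos).le
    nlinarith
  · rw [Set.indicator_of_notMem (by simpa using h), zero_sub, abs_neg, abs_div, abs_of_pos hpos]
    gcongr
    exact not_lt.1 h

lemma integrable_truncationError {ε : ℝ} (hε : 0 < ε) : Integrable (truncationError ε) := by
  have h := (integrable_inv_mul_inv (a := ε * Complex.I) (b := -(ε * Complex.I))
    (by simpa using hε.ne') (by simpa using hε.ne')).norm.const_mul ε
  refine h.mono (measurable_truncationError ε).aestronglyMeasurable
    (Eventually.of_forall fun u => ?_)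
  rw [Real.norm_eq_abs]
  refine (abs_truncationError_le hε u).trans ((le_of_eq ?_).trans (Real.le_norm_self _))
  rw [← mul_inv, norm_inv, show ((u : ℂ) - ε * Complex.I) * ((u : ℂ) - -(ε * Complex.I))
    = ((u ^ 2 + ε ^ 2 : ℝ) : ℂ) by push_cast; linear_combination (-(ε : ℂ) ^ 2) * Complex.I_sq,
    Complex.norm_real, Real.norm_of_nonneg (by positivity)]
  rfl

lemma integral_truncationError (ε : ℝ) : ∫ u, truncationError ε u = 0 := by
  have h := integral_neg_eq_self (truncationError ε) volume
  simp only [truncationError_neg] at h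
  rw [integral_neg] at h
  linarith

lemma integrableOn_inv_mul {v : ℝ → ℝ} {p : ℝ≥0∞} (hp : 1 < p) (hp' : p ≠ ∞) (hv : MemLp v p)
    (ω : ℝ) {ε : ℝ} (hε : 0 < ε) :
    IntegrableOn (fun t : ℝ => (t - ω)⁻¹ • v t) {t : ℝ | ε < |t - ω|} := by
  have hz : ((ω : ℂ) + ε * Complex.I).im ≠ 0 := by simpa using hε.ne'
  have hms : MeasurableSet {t : ℝ | ε < |t - ω|} :=
    measurableSet_lt measurable_const (by fun_prop)
  have h1 := (integrable_inv_ofReal_sub_mul hp hp' hv.ofReal hz).norm.const_mul 2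
  refine Integrable.mono h1.integrableOn.integrable ?_ ((ae_restrict_mem hms).mono fun t ht => ?_)
  · exact ((measurable_id.sub_const ω).inv.aestronglyMeasurable.smul
      hv.aestronglyMeasurable).restrict
  · replace ht : ε < |t - ω| := ht
    refine le_trans ?_ (Real.le_norm_self _)
    rw [norm_smul, norm_mul, norm_inv, norm_inv, ← mul_assoc]
    have hv' : ‖((v t : ℝ) : ℂ)‖ = ‖v t‖ := Complex.norm_real _
    have hpos : 0 < ‖(t : ℂ) - (ω + ε * Complex.I)‖ := norm_pos_iff.2 (ofReal_sub_ne_zero hz t)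
    have ht0 : 0 < |t - ω| := hε.trans ht
    have hle : ‖(t : ℂ) - (ω + ε * Complex.I)‖ ≤ 2 * |t - ω| := by
      have e : (t : ℂ) - (ω + ε * Complex.I) = ((t - ω : ℝ) : ℂ) - ε * Complex.I := by
        push_cast; ring
      rw [e]
      refine (norm_sub_le _ _).trans ?_
      rw [Complex.norm_real, norm_mul, Complex.norm_I, Complex.norm_real, mul_one,
        Real.norm_eq_abs, Real.norm_of_nonneg hε.le]
      linarith
    refine mul_le_mul ?_ (le_of_eq hv'.symm) (norm_nonneg _) (by positivity)
    rw [Real.norm_eq_abs, ← div_eq_mul_inv, inv_eq_one_div, div_le_div_iff₀ ht0 hpos]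
    linarith

lemma tendsto_vertical_stolzCone (x : ℝ) :
    Tendsto (fun ε : ℝ => (x : ℂ) + ε * Complex.I) (𝓝[>] 0) (𝓝[stolzCone 1 x] (x : ℂ)) := by
  refine tendsto_nhdsWithin_iff.2 ⟨?_, ?_⟩
  · have : Continuous fun ε : ℝ => (x : ℂ) + ε * Complex.I := by fun_prop
    simpa using (this.tendsto 0).mono_left (nhdsWithin_le_nhds (s := Set.Ioi 0))
  · filter_upwards [self_mem_nhdsWithin] with ε hε
    rw [Set.mem_Ioi] at hε
    exact ⟨by simpa using hε, by simpa using hε⟩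

lemma re_inv_ofReal_sub (t ω ε : ℝ) :
    (((t : ℂ) - (ω + ε * Complex.I))⁻¹).re = (t - ω) / ((t - ω) ^ 2 + ε ^ 2) := by
  rw [Complex.inv_re]
  have h1 : ((t : ℂ) - (ω + ε * Complex.I)).re = t - ω := by simp
  have h2 : Complex.normSq ((t : ℂ) - (ω + ε * Complex.I)) = (t - ω) ^ 2 + ε ^ 2 := by
    simp [Complex.normSq_apply]; ring
  rw [h1, h2]

lemma truncatedDispersion_eq_integral (v : ℝ → ℝ) (ε ω : ℝ) :
    truncatedDispersion v ε ω =
      Real.pi⁻¹ * ∫ t, {u : ℝ | ε < |u|}.indicator (fun u => u⁻¹) (t - ω) * v t := by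
  have hms : MeasurableSet {t : ℝ | ε < |t - ω|} := measurableSet_lt measurable_const (by fun_prop)
  rw [truncatedDispersion, smul_eq_mul, ← integral_indicator hms]
  congr 1
  refine integral_congr_ae (Eventually.of_forall fun t => ?_)
  by_cases h : ε < |t - ω|
  · rw [Set.indicator_of_mem (by simpa using h)]
    simp only [smul_eq_mul]
    rw [Set.indicator_of_mem (by simpa using h)]
  · rw [Set.indicator_of_notMem (by simpa using h)]
    simp only
    rw [Set.indicator_of_notMem (by simpa using h), zero_mul]

lemma stronglyMeasurable_truncatedDispersion {v : ℝ → ℝ} (hv : StronglyMeasurable v) (ε : ℝ) :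
    StronglyMeasurable (truncatedDispersion v ε) := by
  have h : StronglyMeasurable fun q : ℝ × ℝ =>
      {u : ℝ | ε < |u|}.indicator (fun u => u⁻¹) (q.2 - q.1) * v q.2 := by
    refine StronglyMeasurable.mul ?_ (hv.comp_measurable measurable_snd)
    exact ((measurable_inv.indicator (measurableSet_lt_abs ε)).comp
      (measurable_snd.sub measurable_fst)).stronglyMeasurable
  have h2 := (h.integral_prod_right' (ν := volume)).const_mul Real.pi⁻¹
  refine (congrArg StronglyMeasurable ?_).mpr h2
  funext ω
  exact truncatedDispersion_eq_integral v ε ω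

namespace IsCauchyBoundary

variable {g f : ℝ → ℂ} {p : ℝ≥0∞}

/-- The truncated dispersion integral of the dissipative part differs from the reactive part at
height `ε` by a Poisson mean of an oscillation, since the kernel of the difference is odd and is
dominated by the Poisson kernel. -/
lemma enorm_truncatedDispersion_sub_le (h : IsCauchyBoundary g f p) (hp : 1 < p) (hp' : p ≠ ∞)
    (ω : ℝ) {ε : ℝ} (hε : 0 < ε) :
    ‖truncatedDispersion (fun t => (f t).im) ε ω - (cauchyTransform g (ω + ε * Complex.I)).re‖ₑ
      ≤ ∫⁻ s, ‖(f (ω + ε * s)).im - (f ω).im‖ₑ ∂arctanMeasure := by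
  set v : ℝ → ℝ := fun t => (f t).im with hv
  have hvm : Measurable v := Complex.measurable_im.comp h.stronglyMeasurable.measurable
  have hvp : MemLp v p := h.memLp.im
  have hz : 0 < ((ω : ℂ) + ε * Complex.I).im := by simpa using hε
  have hms : MeasurableSet {t : ℝ | ε < |t - ω|} := measurableSet_lt measurable_const (by fun_prop)
  have i1 : Integrable fun t => {u : ℝ | ε < |u|}.indicator (fun u => u⁻¹) (t - ω) * v t := by
    refine ((integrable_indicator_iff hms).2 (integrableOn_inv_mul hp hp' hvp ω hε)).congr
      (Eventually.of_forall fun t => ?_)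
    by_cases ht : ε < |t - ω|
    · rw [Set.indicator_of_mem (by simpa using ht)]
      simp only [smul_eq_mul]
      rw [Set.indicator_of_mem (by simpa using ht)]
    · rw [Set.indicator_of_notMem (by simpa using ht)]
      simp only
      rw [Set.indicator_of_notMem (by simpa using ht), zero_mul]
  have ic := integrable_inv_ofReal_sub_mul hp hp' hvp.ofReal hz.ne'
  have hre : ∀ t : ℝ, (((t : ℂ) - (ω + ε * Complex.I))⁻¹ * ((v t : ℝ) : ℂ)).re
      = (t - ω) / ((t - ω) ^ 2 + ε ^ 2) * v t := fun t => by
    rw [mul_comm, Complex.re_ofReal_mul, re_inv_ofReal_sub, mul_comm]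
  have i2 : Integrable fun t => (t - ω) / ((t - ω) ^ 2 + ε ^ 2) * v t := by
    simp only [← hre]
    exact ic.re
  have e2 : (cauchyTransform g (ω + ε * Complex.I)).re
      = Real.pi⁻¹ * ∫ t, (t - ω) / ((t - ω) ^ 2 + ε ^ 2) * v t := by
    simp only [← hre]
    have h3 := integral_re (𝕜 := ℂ) ic
    simp only [RCLike.re_eq_complex_re] at h3
    refine Eq.trans ?_ (congrArg (fun r => Real.pi⁻¹ * r) h3.symm)
    have h4 := h.integral_inv_mul_im hp hp' hz
    simp only [hv]
    erw [h4]
    rw [Complex.re_ofReal_mul, ← mul_assoc, inv_mul_cancel₀ Real.pi_ne_zero, one_mul]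
  have iD : Integrable fun t => truncationError ε (t - ω) :=
    (integrable_truncationError hε).comp_sub_right ω
  have iDv : Integrable fun t => truncationError ε (t - ω) * v t := by
    refine (i1.sub i2).congr (Eventually.of_forall fun t => ?_)
    simp only [Pi.sub_apply, truncationError, sub_mul]
  have hDz : ∫ t, truncationError ε (t - ω) = 0 := by
    rw [integral_sub_right_eq_self (truncationError ε) ω, integral_truncationError]
  have e3 : truncatedDispersion v ε ω - (cauchyTransform g (ω + ε * Complex.I)).re
      = Real.pi⁻¹ * ∫ t, truncationError ε (t - ω) * (v t - v ω) := by
    rw [truncatedDispersion_eq_integral, e2, ← mul_sub, ← integral_sub i1 i2]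
    congr 1
    simp only [mul_sub]
    rw [integral_sub iDv (iD.mul_const _), integral_mul_const, hDz, zero_mul, sub_zero]
    refine integral_congr_ae (Eventually.of_forall fun t => ?_)
    simp only [truncationError, sub_mul]
  rw [e3, enorm_mul, ← lintegral_poisson_mul (G := fun t => ‖v t - v ω‖ₑ)
    (hvm.sub_const _).enorm ω hε]
  have hpi : ‖Real.pi⁻¹‖ₑ ≤ 1 := by
    rw [Real.enorm_of_nonneg (by positivity)]
    exact ENNReal.ofReal_le_one.2 (inv_le_one_of_one_le₀ (by linarith [Real.pi_gt_three]))
  refine (mul_le_mul' hpi (enorm_integral_le_lintegral_enorm _)).trans ?_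
  rw [one_mul]
  refine lintegral_mono fun t => ?_
  simp only
  rw [enorm_mul, Real.enorm_eq_ofReal_abs (truncationError ε (t - ω))]
  gcongr
  refine (abs_truncationError_le hε _).trans (le_of_eq ?_)
  rw [← neg_sub ω t, neg_sq]

/-- The Kramers–Kronig relation for the boundary function of a Cauchy transform. -/
lemma isDispersionPair (h : IsCauchyBoundary g f p) (hg : Integrable g) (hp : 1 < p)
    (hp' : p ≠ ∞) :
    IsDispersionPair (fun ω => (f ω).re) (fun ω => (f ω).im) p := by
  have hr := one_lt_toReal hp hp'
  have hr0 : 0 < p.toReal := zero_lt_one.trans hr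
  have hvm : StronglyMeasurable fun t => (f t).im :=
    Complex.continuous_im.comp_stronglyMeasurable h.stronglyMeasurable
  have hvp : MemLp (fun t => (f t).im) p := h.memLp.im
  have hbv := h.isBoundaryValue hp hp'
  refine ⟨fun ω ε hε => integrableOn_inv_mul hp hp' hvp ω hε, ?_, ?_⟩
  · filter_upwards [ae_tendsto_lintegral_oscillation hvm hp hp' hvp, hbv.nontangential]
      with ω hω hω2
    have h1 := (Complex.continuous_re.tendsto _).comp ((hω2 1 one_pos).comp (tendsto_vertical_stolzCone ω))
    have h2 : Tendsto (fun ε => truncatedDispersion (fun t => (f t).im) ε ω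
        - (cauchyTransform g (ω + ε * Complex.I)).re) (𝓝[>] 0) (𝓝 0) := by
      rw [tendsto_zero_iff_enorm_tendsto_zero]
      refine tendsto_of_tendsto_of_tendsto_of_le_of_le' tendsto_const_nhds hω
        (Eventually.of_forall fun _ => zero_le) ?_
      filter_upwards [self_mem_nhdsWithin] with ε hε
      exact h.enorm_truncatedDispersion_sub_le hp hp' ω hε
    have h3 := h2.add h1
    rw [zero_add] at h3
    refine h3.congr fun ε => ?_
    simp
  · have hosc := (tendsto_lintegral_rpow_oscillation hvm hp hp' hvp).mono_left
      (nhdsWithin_le_nhds (s := Set.Ioi 0))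
    have hosc' := hosc.ennrpow_const (1 / p.toReal)
    rw [ENNReal.zero_rpow_of_pos (by positivity)] at hosc'
    have hsum := hosc'.add h.tendsto_Lp
    rw [add_zero] at hsum
    have hum : StronglyMeasurable fun t => (f t).re :=
      Complex.continuous_re.comp_stronglyMeasurable h.stronglyMeasurable
    refine tendsto_of_tendsto_of_tendsto_of_le_of_le' tendsto_const_nhds hsum
      (Eventually.of_forall fun _ => zero_le) ?_
    filter_upwards [self_mem_nhdsWithin] with ε hε
    rw [Set.mem_Ioi] at hε
    have hFre : AEStronglyMeasurable (fun x : ℝ => (cauchyTransform g (x + ε * Complex.I)).re)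
        volume := Complex.continuous_re.comp_aestronglyMeasurable
          (continuous_cauchyTransform_horizontal hg hε.ne').aestronglyMeasurable
    have hsplit : (fun ω => truncatedDispersion (fun t => (f t).im) ε ω - (f ω).re)
        = (fun ω : ℝ => truncatedDispersion (fun t => (f t).im) ε ω
            - (cauchyTransform g (ω + ε * Complex.I)).re)
          + fun ω : ℝ => (cauchyTransform g (ω + ε * Complex.I)).re - (f ω).re := by
      funext ω; simp
    rw [hsplit]
    refine (eLpNorm_add_le
      ((stronglyMeasurable_truncatedDispersion hvm ε).aestronglyMeasurable.sub hFre)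
      (hFre.sub hum.aestronglyMeasurable) hp.le).trans (add_le_add ?_ ?_)
    · rw [eLpNorm_eq_lintegral_rpow_enorm_toReal (zero_lt_one.trans hp).ne' hp']
      refine ENNReal.rpow_le_rpow (lintegral_mono fun ω => ?_) (by positivity)
      exact ENNReal.rpow_le_rpow (h.enorm_truncatedDispersion_sub_le hp hp' ω hε) hr0.le
    · refine eLpNorm_mono fun ω => ?_
      simp only [Pi.sub_apply]
      rw [← Complex.sub_re]
      exact Complex.abs_re_le_norm _

end IsCauchyBoundary

/-! ### Finite sums of scalar functions with vector coefficients -/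

section FiniteSums

lemma eLpNorm_sum_smul_le {ι 𝕜 V : Type*} [Fintype ι] [NormedField 𝕜] [NormedAddCommGroup V]
    [NormedSpace 𝕜 V] {p : ℝ≥0∞} (hp : 1 ≤ p) {c : ι → ℝ → 𝕜}
    (hc : ∀ i, AEStronglyMeasurable (c i) volume) (T : ι → V) :
    eLpNorm (fun x => ∑ i, c i x • T i) p volume ≤ ∑ i, ‖T i‖ₑ * eLpNorm (c i) p volume := by
  have e : (fun x => ∑ i, c i x • T i) = ∑ i, fun x => c i x • T i := by
    funext x; simp
  rw [e]
  refine (eLpNorm_sum_le (fun i _ => (hc i).smul_const (T i)) hp).trans ?_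
  refine Finset.sum_le_sum fun i _ => ?_
  refine (eLpNorm_le_nnreal_smul_eLpNorm_of_ae_le_mul (c := ‖T i‖₊)
    (Eventually.of_forall fun x => ?_) p).trans (le_of_eq rfl)
  rw [nnnorm_smul, mul_comm]

variable {ι : Type*} [Fintype ι] {p : ℝ≥0∞}

lemma IsBoundaryValue.sum_smul {V : Type*} [NormedAddCommGroup V] [NormedSpace ℂ V]
    (hp : 1 ≤ p) {F : ι → ℂ → ℂ} {f : ι → ℝ → ℂ} (h : ∀ i, IsBoundaryValue (F i) (f i) p)
    (hF : ∀ i, ∀ y : ℝ, 0 < y →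
      AEStronglyMeasurable (fun x : ℝ => F i (x + y * Complex.I)) volume) (T : ι → V) :
    IsBoundaryValue (fun z => ∑ i, F i z • T i) (fun x => ∑ i, f i x • T i) p where
  memLp := memLp_finsetSum _ fun i _ => by
    refine ⟨(h i).memLp.aestronglyMeasurable.smul_const _, ?_⟩
    refine (eLpNorm_le_nnreal_smul_eLpNorm_of_ae_le_mul (c := ‖T i‖₊)
      (Eventually.of_forall fun x => ?_) p).trans_lt
      (ENNReal.mul_lt_top ENNReal.coe_lt_top (h i).memLp.eLpNorm_lt_top)
    rw [nnnorm_smul, mul_comm]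
  nontangential := by
    filter_upwards [ae_all_iff.2 fun i => (h i).nontangential] with x hx a ha
    exact tendsto_finsetSum _ fun i _ => (hx i a ha).smul_const (T i)
  tendsto_Lp := by
    have hlim : Tendsto (fun y : ℝ => ∑ i, ‖T i‖ₑ *
        eLpNorm (fun x : ℝ => F i (x + y * Complex.I) - f i x) p volume) (𝓝[>] 0) (𝓝 0) := by
      rw [show (0 : ℝ≥0∞) = ∑ i : ι, ‖T i‖ₑ * 0 by simp]
      exact tendsto_finsetSum _ fun i _ =>
        ENNReal.Tendsto.const_mul (h i).tendsto_Lp (Or.inr enorm_ne_top)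
    refine tendsto_of_tendsto_of_tendsto_of_le_of_le' tendsto_const_nhds hlim
      (Eventually.of_forall fun _ => zero_le) ?_
    filter_upwards [self_mem_nhdsWithin] with y hy
    have h1 := eLpNorm_sum_smul_le hp
      (fun i => (hF i y hy).sub (h i).memLp.aestronglyMeasurable) T
    refine le_trans (le_of_eq ?_) h1
    congr 1
    funext x
    simp [sub_smul]

lemma IsBoundaryValue.congr {V : Type*} [NormedAddCommGroup V] {F G : ℂ → V} {f : ℝ → V}
    (h : IsBoundaryValue F f p) (hFG : ∀ z ∈ upperPlane, F z = G z) : IsBoundaryValue G f p where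
  memLp := h.memLp
  nontangential := by
    filter_upwards [h.nontangential] with x hx a ha
    refine (hx a ha).congr' ?_
    filter_upwards [self_mem_nhdsWithin] with z hz using hFG z hz.1
  tendsto_Lp := by
    refine h.tendsto_Lp.congr' ?_
    filter_upwards [self_mem_nhdsWithin] with y hy
    have : ∀ x : ℝ, F (x + y * Complex.I) = G (x + y * Complex.I) := fun x =>
      hFG _ (by simpa [upperPlane] using hy)
    simp only [this]

lemma IsDispersionPair.congr {V : Type*} [NormedAddCommGroup V] [NormedSpace ℝ V]
    {u v u' v' : ℝ → V} (h : IsDispersionPair u v p) (hu : u =ᵐ[volume] u')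
    (hv : v =ᵐ[volume] v') : IsDispersionPair u' v' p := by
  have hK : ∀ ω, (fun t => (t - ω)⁻¹ • v t) =ᵐ[volume] fun t => (t - ω)⁻¹ • v' t := fun ω =>
    hv.mono fun t ht => by simp only [ht]
  have hT : truncatedDispersion v = truncatedDispersion v' := by
    funext ε ω
    rw [truncatedDispersion, truncatedDispersion, integral_congr_ae (ae_restrict_of_ae (hK ω))]
  refine ⟨fun ω ε hε => ?_, ?_, ?_⟩
  · exact (integrable_congr (ae_restrict_of_ae (hK ω))).1 (h.integrable ω ε hε)
  · filter_upwards [h.tendsto_ae, hu] with ω h1 h2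
    rw [← hT, ← h2]
    exact h1
  · rw [← hT]
    refine h.tendsto_Lp.congr fun ε => eLpNorm_congr_ae ?_
    filter_upwards [hu] with ω h2
    rw [h2]

lemma IsDispersionPair.sum_smul {V : Type*} [NormedAddCommGroup V] [NormedSpace ℝ V]
    [CompleteSpace V] (hp : 1 ≤ p) {u v : ι → ℝ → ℝ} (h : ∀ i, IsDispersionPair (u i) (v i) p)
    (hu : ∀ i, StronglyMeasurable (u i)) (hv : ∀ i, StronglyMeasurable (v i)) (T : ι → V) :
    IsDispersionPair (fun ω => ∑ i, u i ω • T i) (fun ω => ∑ i, v i ω • T i) p := by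
  have hsm : ∀ ω t : ℝ, (t - ω)⁻¹ • ∑ i, v i t • T i = ∑ i, ((t - ω)⁻¹ • v i t) • T i :=
    fun ω t => by
      rw [Finset.smul_sum]
      simp only [smul_assoc]
  have hT : ∀ ε ω : ℝ, 0 < ε → truncatedDispersion (fun ω => ∑ i, v i ω • T i) ε ω
      = ∑ i, truncatedDispersion (v i) ε ω • T i := fun ε ω hε => by
    rw [truncatedDispersion]
    simp only [hsm]
    rw [integral_finsetSum _ fun i _ => ((h i).integrable ω ε hε).integrable.smul_const (T i),
      Finset.smul_sum]
    refine Finset.sum_congr rfl fun i _ => ?_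
    rw [integral_smul_const, truncatedDispersion, smul_assoc]
  refine ⟨fun ω ε hε => ?_, ?_, ?_⟩
  · simp only [hsm]
    exact integrable_finsetSum _ fun i _ => ((h i).integrable ω ε hε).integrable.smul_const (T i)
  · filter_upwards [ae_all_iff.2 fun i => (h i).tendsto_ae] with ω hω
    have h1 : Tendsto (fun ε => ∑ i, truncatedDispersion (v i) ε ω • T i) (𝓝[>] 0)
        (𝓝 (∑ i, u i ω • T i)) := tendsto_finsetSum _ fun i _ => (hω i).smul_const (T i)
    refine h1.congr' ?_
    filter_upwards [self_mem_nhdsWithin] with ε hε using (hT ε ω hε).symm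
  · have hlim : Tendsto (fun ε : ℝ => ∑ i, ‖T i‖ₑ *
        eLpNorm (fun ω : ℝ => truncatedDispersion (v i) ε ω - u i ω) p volume) (𝓝[>] 0)
          (𝓝 0) := by
      rw [show (0 : ℝ≥0∞) = ∑ i : ι, ‖T i‖ₑ * 0 by simp]
      exact tendsto_finsetSum _ fun i _ =>
        ENNReal.Tendsto.const_mul (h i).tendsto_Lp (Or.inr enorm_ne_top)
    refine tendsto_of_tendsto_of_tendsto_of_le_of_le' tendsto_const_nhds hlim
      (Eventually.of_forall fun _ => zero_le) ?_
    filter_upwards [self_mem_nhdsWithin] with ε hε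
    have h1 := eLpNorm_sum_smul_le hp (fun i =>
      ((stronglyMeasurable_truncatedDispersion (hv i) ε).sub (hu i)).aestronglyMeasurable) T
    refine le_trans (le_of_eq ?_) h1
    congr 1
    funext ω
    rw [hT ε ω hε]
    simp [sub_smul]

end FiniteSums

/-! ### Operator-valued densities -/

/-- Lebesgue spaces decrease towards the middle: `L¹ ∩ L^{p₀} ⊆ L^p` for `1 < p ≤ p₀`. -/
lemma MeasureTheory.MemLp.of_one_of_le {α V : Type*} [MeasurableSpace α] {μ : Measure α}
    [NormedAddCommGroup V] {w : α → V} {p p₀ : ℝ≥0∞} (h1 : MemLp w 1 μ) (h0 : MemLp w p₀ μ)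
    (hp : 1 < p) (hpp : p ≤ p₀) (hp' : p ≠ ∞) : MemLp w p μ := by
  have hp0 : p ≠ 0 := (zero_lt_one.trans hp).ne'
  have hr : 1 < p.toReal := one_lt_toReal hp hp'
  have h1' : ∫⁻ x, ‖w x‖ₑ ∂μ < ∞ := by
    rw [← eLpNorm_one_eq_lintegral_enorm]; exact h1.eLpNorm_lt_top
  refine ⟨h1.aestronglyMeasurable, ?_⟩
  rw [eLpNorm_lt_top_iff_lintegral_rpow_enorm_lt_top hp0 hp']
  rcases eq_or_ne p₀ ∞ with rfl | hp₀
  · have hM : eLpNormEssSup w μ ^ (p.toReal - 1) ≠ ∞ :=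
      ENNReal.rpow_ne_top_of_nonneg (by linarith) (by simpa using h0.eLpNorm_ne_top)
    refine lt_of_le_of_lt (b := ∫⁻ x, eLpNormEssSup w μ ^ (p.toReal - 1) * ‖w x‖ₑ ∂μ) ?_ ?_
    · refine lintegral_mono_ae ?_
      filter_upwards [enorm_ae_le_eLpNormEssSup w μ] with x hx
      calc ‖w x‖ₑ ^ p.toReal = ‖w x‖ₑ ^ (p.toReal - 1) * ‖w x‖ₑ := by
            conv_rhs => rw [← ENNReal.rpow_one ‖w x‖ₑ, ← ENNReal.rpow_mul, one_mul,
              ← ENNReal.rpow_add_of_nonneg _ _ (by linarith) zero_le_one, sub_add_cancel]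
        _ ≤ _ := by
            gcongr
    · rw [lintegral_const_mul' _ _ hM]
      exact ENNReal.mul_lt_top hM.lt_top h1'
  · have hle : p.toReal ≤ p₀.toReal := ENNReal.toReal_mono hp₀ hpp
    have h0' := (eLpNorm_lt_top_iff_lintegral_rpow_enorm_lt_top
      ((zero_lt_one.trans hp).trans_le hpp).ne' hp₀).1 h0.eLpNorm_lt_top
    refine lt_of_le_of_lt (b := ∫⁻ x, (‖w x‖ₑ + ‖w x‖ₑ ^ p₀.toReal) ∂μ) ?_ ?_
    · refine lintegral_mono fun x => ?_
      rcases le_total ‖w x‖ₑ 1 with h | h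
      · refine le_trans ?_ le_self_add
        simpa using ENNReal.rpow_le_rpow_of_exponent_ge h hr.le
      · exact (ENNReal.rpow_le_rpow_of_exponent_le h hle).trans le_add_self
    · rw [lintegral_add_left' h1.aestronglyMeasurable.enorm]
      exact ENNReal.add_lt_top.2 ⟨h1', h0'⟩

section Operators

variable {E : Type*} [NormedAddCommGroup E] [InnerProductSpace ℂ E]

lemma inner_polarization (A : E →L[ℂ] E) (x y : E) :
    inner ℂ x (A y) = ∑ k : Fin 4, (starRingEnd ℂ (Complex.I ^ (k : ℕ)) / 4) *
      inner ℂ (x + Complex.I ^ (k : ℕ) • y) (A (x + Complex.I ^ (k : ℕ) • y)) := by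
  have hI : Complex.I * Complex.I = -1 := Complex.I_mul_I
  rw [Fin.sum_univ_four]
  simp only [map_add, map_smul, inner_add_left, inner_add_right, inner_smul_left,
    inner_smul_right, map_pow, Complex.conj_I, Fin.val_zero, Fin.val_one, Fin.val_two, pow_zero,
    pow_one, show ((3 : Fin 4) : ℕ) = 3 from rfl]
  have h2 : Complex.I ^ 2 = -1 := Complex.I_sq
  have h3 : Complex.I ^ 3 = -Complex.I := Complex.I_pow_three
  have h2' : (-Complex.I) ^ 2 = -1 := by rw [neg_sq, h2]
  have h3' : (-Complex.I) ^ 3 = Complex.I := by rw [Odd.neg_pow (by decide), h3, neg_neg]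
  rw [h2, h3, h2', h3', map_one]
  linear_combination (1 / 2 : ℂ) * (inner ℂ x (A y) - inner ℂ y (A x)) * hI

/-- An operator on a finite-dimensional space is a linear combination, with fixed coefficient
operators, of finitely many of its diagonal matrix elements. -/
lemma exists_diagonal_expansion [FiniteDimensional ℂ E] :
    ∃ (ι : Type) (_ : Fintype ι) (ζ : ι → E) (T : ι → E →L[ℂ] E),
      ∀ A : E →L[ℂ] E, A = ∑ m, inner ℂ (ζ m) (A (ζ m)) • T m := by
  set b := stdOrthonormalBasis ℂ E with hb
  refine ⟨Fin (Module.finrank ℂ E) × Fin (Module.finrank ℂ E) × Fin 4, inferInstance,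
    fun m => b m.1 + Complex.I ^ (m.2.2 : ℕ) • b m.2.1,
    fun m => (starRingEnd ℂ (Complex.I ^ (m.2.2 : ℕ)) / 4) •
      (innerSL ℂ (b m.2.1)).smulRight (b m.1), fun A => ?_⟩
  ext x
  rw [Fintype.sum_prod_type]
  simp only [Fintype.sum_prod_type, smul_smul, ← Finset.sum_smul, sum_apply]
  have h : ∀ i j, ∑ k : Fin 4, inner ℂ (b i + Complex.I ^ (k : ℕ) • b j)
      (A (b i + Complex.I ^ (k : ℕ) • b j)) * (starRingEnd ℂ (Complex.I ^ (k : ℕ)) / 4)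
        = inner ℂ (b i) (A (b j)) := fun i j => by
    rw [inner_polarization A (b i) (b j)]
    exact Finset.sum_congr rfl fun k _ => mul_comm _ _
  simp only [h, smul_apply, ContinuousLinearMap.smulRight_apply,
    innerSL_apply_apply]
  rw [Finset.sum_comm]
  conv_lhs => rw [← b.sum_repr x, map_sum]
  refine Finset.sum_congr rfl fun j _ => ?_
  rw [map_smul, ← b.sum_repr (A (b j)), Finset.smul_sum]
  refine Finset.sum_congr rfl fun i _ => ?_
  rw [b.repr_apply_apply, b.repr_apply_apply, b.sum_repr, smul_smul, smul_smul, mul_comm]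

variable [CompleteSpace E]

lemma inner_realPart (A : E →L[ℂ] E) (ξ : E) :
    inner ℂ ξ ((ℜ A : E →L[ℂ] E) ξ) = ((inner ℂ ξ (A ξ)).re : ℂ) := by
  rw [realPart_apply_coe, ContinuousLinearMap.star_eq_adjoint]
  simp only [smul_apply, add_apply]
  rw [inner_smul_right_eq_smul, inner_add_right, ContinuousLinearMap.adjoint_inner_right,
    ← inner_conj_symm (A ξ) ξ, Complex.add_conj]
  rw [Complex.real_smul]
  push_cast
  ring

lemma inner_imaginaryPart (A : E →L[ℂ] E) (ξ : E) :
    inner ℂ ξ ((ℑ A : E →L[ℂ] E) ξ) = ((inner ℂ ξ (A ξ)).im : ℂ) := by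
  rw [imaginaryPart_apply_coe, ContinuousLinearMap.star_eq_adjoint]
  simp only [smul_apply, sub_apply]
  rw [inner_smul_right, inner_smul_right_eq_smul, inner_sub_right,
    ContinuousLinearMap.adjoint_inner_right, ← inner_conj_symm (A ξ) ξ, Complex.sub_conj]
  rw [Complex.real_smul]
  push_cast
  linear_combination (-((inner ℂ ξ (A ξ)).im : ℂ)) * Complex.I_sq

lemma isPositive_neg_imaginaryPart {A : E →L[ℂ] E} (h : ∀ ξ, (inner ℂ ξ (A ξ)).im ≤ 0) :
    (-(ℑ A : E →L[ℂ] E)).IsPositive := by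
  rw [ContinuousLinearMap.isPositive_iff]
  refine ⟨(IsSelfAdjoint.neg (ℑ A).2).isSymmetric, fun ξ => ?_⟩
  have h2 := inner_imaginaryPart A ξ
  rw [neg_apply, inner_neg_left, ← inner_conj_symm, h2, Complex.conj_ofReal,
    ← Complex.ofReal_neg]
  exact_mod_cast neg_nonneg.2 (h ξ)

end Operators

section MatrixElements

variable {E : Type*} [NormedAddCommGroup E] [InnerProductSpace ℂ E]

/-- The matrix element `A ↦ ⟪ξ, A η⟫` as a continuous linear functional. -/
noncomputable def matrixElement (ξ η : E) : (E →L[ℂ] E) →L[ℂ] ℂ :=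
  (innerSL ℂ ξ).comp (ContinuousLinearMap.apply ℂ E η)

lemma matrixElement_apply (ξ η : E) (A : E →L[ℂ] E) : matrixElement ξ η A = inner ℂ ξ (A η) :=
  rfl

variable [CompleteSpace E] {K : ℂ → E →L[ℂ] E} {w : ℝ → E →L[ℂ] E} {p₀ : ℝ≥0∞}

lemma IsHardySpectralDensity.integrable_matrixElement (h : IsHardySpectralDensity K w p₀)
    (ξ η : E) : Integrable fun lam => matrixElement ξ η (w lam) :=
  (matrixElement ξ η).integrable_comp (memLp_one_iff_integrable.1 h.memLp_one)

lemma IsHardySpectralDensity.inner_eq_cauchyTransform (h : IsHardySpectralDensity K w p₀)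
    (ξ η : E) {z : ℂ} (hz : z ∈ upperPlane) :
    inner ℂ ξ (K z η) = cauchyTransform (fun lam => matrixElement ξ η (w lam)) z := by
  have hint := integrable_inv_sub_smul (memLp_one_iff_integrable.1 h.memLp_one)
    (ne_of_gt (show 0 < z.im from hz))
  rw [← matrixElement_apply, h.cauchy z hz, ← (matrixElement ξ η).integral_comp_comm hint,
    cauchyTransform]
  refine integral_congr_ae (Eventually.of_forall fun lam => ?_)
  simp only [map_smul, smul_eq_mul]

variable {p : ℝ≥0∞}

lemma IsHardySpectralDensity.memLp_matrixElement (h : IsHardySpectralDensity K w p₀)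
    (hp : 1 < p) (hpp : p ≤ p₀) (hp' : p ≠ ∞) (ξ η : E) :
    MemLp (fun lam => matrixElement ξ η (w lam)) p :=
  (matrixElement ξ η).comp_memLp' (h.memLp_one.of_one_of_le h.memLp hp hpp hp')

variable [FiniteDimensional ℂ E]

lemma IsHardySpectralDensity.differentiableOn (h : IsHardySpectralDensity K w p₀) :
    DifferentiableOn ℂ K upperPlane := by
  obtain ⟨ι, _, ζ, T, hexp⟩ := exists_diagonal_expansion (E := E)
  have hd : DifferentiableOn ℂ (fun z => ∑ m,
      cauchyTransform (fun lam => matrixElement (ζ m) (ζ m) (w lam)) z • T m) upperPlane :=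
    DifferentiableOn.fun_sum fun m _ z hz =>
      ((hasDerivAt_cauchyTransform (h.integrable_matrixElement (ζ m) (ζ m))
        (ne_of_gt (show 0 < z.im from hz))).differentiableAt.smul_const
        (T m)).differentiableWithinAt
  refine hd.congr fun z hz => ?_
  rw [hexp (K z)]
  exact Finset.sum_congr rfl fun m _ => by rw [h.inner_eq_cauchyTransform _ _ hz]

lemma IsHardySpectralDensity.memHardy (h : IsHardySpectralDensity K w p₀)
    (hp : 1 < p) (hpp : p ≤ p₀) (hp' : p ≠ ∞) : MemHardy K p := by
  obtain ⟨ι, _, ζ, T, hexp⟩ := exists_diagonal_expansion (E := E)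
  obtain ⟨C, hC, hCb⟩ := exists_cauchyTransformBounded hp hp'
  refine ⟨h.differentiableOn, ?_⟩
  set g : ι → ℝ → ℂ := fun m lam => matrixElement (ζ m) (ζ m) (w lam) with hg
  have hgi : ∀ m, Integrable (g m) := fun m => h.integrable_matrixElement _ _
  refine lt_of_le_of_lt (b := ∑ m, ‖T m‖ₑ * (C * eLpNorm (g m) p volume)) ?_ ?_
  · refine iSup₂_le fun y hy => ?_
    have e : (fun x : ℝ => K (x + y * Complex.I))
        = fun x : ℝ => ∑ m, cauchyTransform (g m) (x + y * Complex.I) • T m := by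
      funext x
      have hz : (x : ℂ) + y * Complex.I ∈ upperPlane := by simpa [upperPlane] using hy
      conv_lhs => rw [hexp (K _)]
      exact Finset.sum_congr rfl fun m _ => by rw [h.inner_eq_cauchyTransform _ _ hz]
    rw [e]
    refine (eLpNorm_sum_smul_le hp.le (fun m =>
      (continuous_cauchyTransform_horizontal (hgi m) hy.ne').aestronglyMeasurable) T).trans ?_
    gcongr with m
    exact hCb _ (hgi m) y hy
  · exact ENNReal.sum_lt_top.2 fun m _ => ENNReal.mul_lt_top (by simp)
      (ENNReal.mul_lt_top hC.lt_top (h.memLp_matrixElement hp hpp hp' _ _).eLpNorm_lt_top)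

lemma IsHardySpectralDensity.obeysKramersKronig (h : IsHardySpectralDensity K w p₀)
    (hp : 1 < p) (hpp : p ≤ p₀) (hp' : p ≠ ∞) : ObeysKramersKronig K p := by
  obtain ⟨ι, _, ζ, T, hexp⟩ := exists_diagonal_expansion (E := E)
  have hgi : ∀ ξ η : E, Integrable fun lam => matrixElement ξ η (w lam) :=
    fun ξ η => h.integrable_matrixElement ξ η
  choose f hf using fun ξ η : E => exists_isCauchyBoundary (hgi ξ η) hp hp'
    (h.memLp_matrixElement hp hpp hp' ξ η)
  set Fb : ℝ → E →L[ℂ] E := fun x => ∑ m, f (ζ m) (ζ m) x • T m with hFb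
  have hbv : IsBoundaryValue K Fb p := by
    refine (IsBoundaryValue.sum_smul hp.le
      (fun m => (hf (ζ m) (ζ m)).isBoundaryValue hp hp') (fun m y hy =>
        (continuous_cauchyTransform_horizontal (hgi _ _) hy.ne').aestronglyMeasurable) T).congr
      fun z hz => ?_
    rw [hexp (K z)]
    exact Finset.sum_congr rfl fun m _ => by rw [h.inner_eq_cauchyTransform _ _ hz]
  have hel : ∀ ξ η : E, (fun x => inner ℂ ξ (Fb x η)) =ᵐ[volume] f ξ η := fun ξ η => by
    filter_upwards [hbv.nontangential, ((hf ξ η).isBoundaryValue hp hp').nontangential]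
      with x hx hx'
    have h1 := ((matrixElement ξ η).continuous.tendsto _).comp (hx 1 one_pos)
    have h2 : Tendsto (fun z => inner ℂ ξ (K z η)) (𝓝[stolzCone 1 x] (x : ℂ))
        (𝓝 (f ξ η x)) := by
      refine (hx' 1 one_pos).congr' ?_
      filter_upwards [self_mem_nhdsWithin] with z hz
      exact (h.inner_eq_cauchyTransform ξ η hz.1).symm
    exact tendsto_nhds_unique (h1.comp (tendsto_vertical_stolzCone x))
      (h2.comp (tendsto_vertical_stolzCone x))
  have hpair : ∀ ξ η : E, IsDispersionPair (fun x => (f ξ η x).re) (fun x => (f ξ η x).im) p :=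
    fun ξ η => (hf ξ η).isDispersionPair (hgi ξ η) hp hp'
  refine ⟨Fb, hbv, ?_, fun ξ η => ?_⟩
  · -- the diagonal matrix elements of `ℜ Fb`, `ℑ Fb` are the real and imaginary parts of those
    -- of `Fb`, and operators are combinations of diagonal matrix elements
    have hsum := IsDispersionPair.sum_smul hp.le (fun m => hpair (ζ m) (ζ m))
      (fun m => Complex.continuous_re.comp_stronglyMeasurable (hf _ _).stronglyMeasurable)
      (fun m => Complex.continuous_im.comp_stronglyMeasurable (hf _ _).stronglyMeasurable) T
    have hae : ∀ᵐ x : ℝ, ∀ m, inner ℂ (ζ m) (Fb x (ζ m)) = f (ζ m) (ζ m) x :=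
      ae_all_iff.2 fun m => hel (ζ m) (ζ m)
    refine hsum.congr ?_ ?_
    · filter_upwards [hae] with x hx
      rw [hexp (ℜ (Fb x) : E →L[ℂ] E)]
      refine Finset.sum_congr rfl fun m _ => ?_
      rw [inner_realPart, hx m, Complex.coe_smul]
    · filter_upwards [hae] with x hx
      rw [hexp (ℑ (Fb x) : E →L[ℂ] E)]
      refine Finset.sum_congr rfl fun m _ => ?_
      rw [inner_imaginaryPart, hx m, Complex.coe_smul]
  · refine (hpair ξ η).congr ?_ ?_
    · filter_upwards [hel ξ η] with x hx
      rw [hx]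
    · filter_upwards [hel ξ η] with x hx
      rw [hx]

end MatrixElements

theorem theorem5 {Hs : Type*} [NormedAddCommGroup Hs] [InnerProductSpace ℂ Hs]
    [FiniteDimensional ℂ Hs]
    (K : ℂ → SuperOp Hs) (w : ℝ → SuperOp Hs) (p₀ : ℝ≥0∞)
    (hspec : IsHardySpectralDensity K w p₀)
    (hpos : ∀ᵐ lam : ℝ, (w lam).IsPositive)
    (hdiss : IsDissipative K) :
    (∀ p : ℝ≥0∞, 1 < p → p ≤ p₀ → p ≠ ∞ → MemHardy K p ∧ ObeysKramersKronig K p) ∧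
      IsHerglotz (fun z => -K z) ∧ IsAntiHerglotz K := by
  have hneg : ∀ z ∈ upperPlane,
      (-(ℑ (K z) : HilbertSchmidt Hs →L[ℂ] HilbertSchmidt Hs)).IsPositive := fun z hz =>
    isPositive_neg_imaginaryPart (hdiss z hz)
  refine ⟨fun p hp hpp hp' => ⟨hspec.memHardy hp hpp hp', hspec.obeysKramersKronig hp hpp hp'⟩,
    ⟨hspec.differentiableOn.neg, fun z hz => ?_⟩, hspec.differentiableOn, hneg⟩
  have := hneg z hz
  rwa [map_neg, NegMemClass.coe_neg]
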